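/- **Definitions.** Let $\mathbb{D}$ be a (pseudo) double category. A proarrow from $x$ to $y$ is written $x\rightsquigarrow y$, and a cell lies over a pair of arrows, its left and right boundaries. The double category $\mathbb{D}$ has *strong finite coproducts* if the following hold. 1. Every finite family of objects $x=(x_i)_{i\in I}$ has a chosen coproduct $\Sigma x$, with coprojections $\iota_i: x_i\to\Sigma x$, in the category of objects and arrows of $\mathbb{D}$. The choice is normalized: the coproduct of a single object $x$, as a family indexed by the one-point set, is $x$ itself with identity coprojection. 2. Given a finite span $I\xleftarrow{l} A\xrightarrow{r} J$, families of objects $x$ over $I$ and $y$ over $J$, and proarrows $m_a: x_{l(a)}\rightsquigarrow y_{r(a)}$ for $a\in A$, there are a chosen proarrow $\Sigma m:\Sigma x\rightsquigarrow \Sigma y$ and cells $\iota_a: m_a\Rightarrow\Sigma m$ over $\iota_{l(a)}$ and $\iota_{r(a)}$ with the following universal property. For all arrows $f:\Sigma x\to z$ and $g:\Sigma y\to w$, every proarrow $n:z\rightsquigarrow w$ and all cells $\varphi_a: m_a\Rightarrow n$ over $f\circ\iota_{l(a)}$ and $g\circ\iota_{r(a)}$, there is a unique cell $\psi:\Sigma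 m\Rightarrow n$ over $f$ and $g$ with $\psi\circ\iota_a=\varphi_a$ for all $a$. 3. These coproducts commute with external composition and external identities: the canonical comparison cells $\Sigma(m\odot n)\Rightarrow\Sigma m\odot\Sigma n$ (where $m\odot n$ is indexed by the composite of spans, formed by pullback) and $\Sigma(\mathrm{id}_x)\Rightarrow\mathrm{id}_{\Sigma x}$ are invertible. The *underlying bicategory* $\mathbf{D}$ of $\mathbb{D}$ consists of its objects, proarrows and globular cells. For a finite set $I$, let $\oplus:\mathbf{D}^I\to\mathbf{D}$ be the pseudofunctor sending parallel families of objects, proarrows and globular cells to their coproducts, let $\Delta:\mathbf{D}\to\mathbf{D}^I$ be the diagonal, and let $\nabla_z:\Sigma_{i\in I}z\to z$ be the codiagonal arrows. A bicategory has *direct sums* if every finite family of objects $(x_i)_{i \in I}$ has a bicategorical coproduct and a bicategorical product with the same underlying object $s$. That is, there are 1-cells $x_i\to s$ inducing equivalences $\mathbf{B}(s,z)\simeq\prod_i\mathbf{B}(x_i,z)$, and 1-cells $s\to x_i$ inducing equivalences $\mathbf{B}(z,s)\simeq\prod_i\mathbf{B}(z,x_i)$, for every object $z$. **Theorem.** Let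 $\mathbb{D}$ be a double category with strong finite coproducts. Then its underlying bicategory $\mathbf{D}$ has direct sums. More precisely, for every finite set $I$ there are biadjunctions $$(\iota_!,\nabla_!):\ \oplus\dashv\Delta:\ \mathbf{D}^I\rightleftarrows\mathbf{D}\qquad\text{and}\qquad(\nabla^*,\iota^*):\ \Delta\dashv\oplus:\ \mathbf{D}\rightleftarrows\mathbf{D}^I,$$ consisting of pseudofunctors, pseudonatural unit and counit, and invertible modifications satisfying the swallowtail identities. The unit $\iota_!$ and counit $\nabla_!$ of the first are obtained from the coprojections and codiagonals by taking companions, and the unit $\nabla^*$ and counit $\iota^*$ of the second are obtained from the codiagonals and coprojections by taking conjoints. That is, their component 1-cells are companions (respectively conjoints) of the component arrows, and their structure 2-cells are (respectively, are inverse to) the globular cells obtained by reshaping the component cells of the coprojections (respectively codiagonals) at proarrows by the companion (respectively conjoint) units and counits. For every family $x$ of objects indexed by $I$, the 1-cells $(\iota_i)_!: x_i\rightsquigarrow \Sigma x$ exhibit $\Sigma x$ as a bicategorical coproduct of $x$, and the 1-cells $(\iota_i)^*:\Sigma x\rightsquigarrow x_i$ exhibit it as a bicategorical product of $x$. -/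

import Mathlib

open CategoryTheory CategoryTheory.Limits CategoryTheory.Bicategory

universe t w v u w₂ v₂ u₂

/-- A (pseudo) double category. The objects of `D` and the arrows between them form a category
`D₀`; proarrows `Pro x y` and cells between proarrows form a category `D₁`; a cell `α : Cell m n`
has a left boundary arrow and a right boundary arrow, functorially in `α`. External composition
and external identities are functors `D₁ ×_{D₀} D₁ ⥤ D₁` and `D₀ ⥤ D₁`, associative and unital up
to globular natural isomorphisms which satisfy the pentagon and triangle identities.
External composition is written in diagrammatic order. -/
class DoubleCategory (D : Type u) extends Category.{v} D where
  Pro : D → D → Type w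
  Cell {x y x' y' : D} : Pro x y → Pro x' y' → Type t
  left {x y x' y' : D} {m : Pro x y} {n : Pro x' y'} : Cell m n → (x ⟶ x')
  right {x y x' y' : D} {m : Pro x y} {n : Pro x' y'} : Cell m n → (y ⟶ y')
  cellId {x y : D} (m : Pro x y) : Cell m m
  cellComp {x y x' y' x'' y'' : D} {m : Pro x y} {n : Pro x' y'} {p : Pro x'' y''} :
    Cell m n → Cell n p → Cell m p
  id_cellComp {x y x' y' : D} {m : Pro x y} {n : Pro x' y'} (α : Cell m n) :
    cellComp (cellId m) α = α
  cellComp_id {x y x' y' : D} {m : Pro x y} {n : Pro x' y'} (α : Cell m n) :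
    cellComp α (cellId n) = α
  cellComp_assoc {x₁ y₁ x₂ y₂ x₃ y₃ x₄ y₄ : D} {m : Pro x₁ y₁} {n : Pro x₂ y₂} {p : Pro x₃ y₃}
    {q : Pro x₄ y₄} (α : Cell m n) (β : Cell n p) (γ : Cell p q) :
    cellComp (cellComp α β) γ = cellComp α (cellComp β γ)
  left_cellId {x y : D} (m : Pro x y) : left (cellId m) = 𝟙 x
  right_cellId {x y : D} (m : Pro x y) : right (cellId m) = 𝟙 y
  left_cellComp {x y x' y' x'' y'' : D} {m : Pro x y} {n : Pro x' y'} {p : Pro x'' y''}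
    (α : Cell m n) (β : Cell n p) : left (cellComp α β) = left α ≫ left β
  right_cellComp {x y x' y' x'' y'' : D} {m : Pro x y} {n : Pro x' y'} {p : Pro x'' y''}
    (α : Cell m n) (β : Cell n p) : right (cellComp α β) = right α ≫ right β
  proId (x : D) : Pro x x
  idCell {x y : D} (f : x ⟶ y) : Cell (proId x) (proId y)
  left_idCell {x y : D} (f : x ⟶ y) : left (idCell f) = f
  right_idCell {x y : D} (f : x ⟶ y) : right (idCell f) = f
  idCell_id (x : D) : idCell (𝟙 x) = cellId (proId x)
  idCell_comp {x y z : D} (f : x ⟶ y) (g : y ⟶ z) :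
    idCell (f ≫ g) = cellComp (idCell f) (idCell g)
  proComp {x y z : D} : Pro x y → Pro y z → Pro x z
  hcomp {x y z x' y' z' : D} {m : Pro x y} {n : Pro y z} {m' : Pro x' y'} {n' : Pro y' z'}
    (α : Cell m m') (β : Cell n n') (h : right α = left β) : Cell (proComp m n) (proComp m' n')
  left_hcomp {x y z x' y' z' : D} {m : Pro x y} {n : Pro y z} {m' : Pro x' y'} {n' : Pro y' z'}
    (α : Cell m m') (β : Cell n n') (h : right α = left β) : left (hcomp α β h) = left α
  right_hcomp {x y z x' y' z' : D} {m : Pro x y} {n : Pro y z} {m' : Pro x' y'} {n' : Pro y' z'}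
    (α : Cell m m') (β : Cell n n') (h : right α = left β) : right (hcomp α β h) = right β
  hcomp_id {x y z : D} (m : Pro x y) (n : Pro y z) :
    hcomp (cellId m) (cellId n) ((right_cellId m).trans (left_cellId n).symm) =
      cellId (proComp m n)
  hcomp_cellComp {x y z x' y' z' x'' y'' z'' : D} {m : Pro x y} {n : Pro y z} {m' : Pro x' y'}
    {n' : Pro y' z'} {m'' : Pro x'' y''} {n'' : Pro y'' z''}
    (α : Cell m m') (β : Cell n n') (α' : Cell m' m'') (β' : Cell n' n'')
    (h : right α = left β) (h' : right α' = left β') :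
    hcomp (cellComp α α') (cellComp β β')
        (by rw [right_cellComp, left_cellComp, h, h']) =
      cellComp (hcomp α β h) (hcomp α' β' h')
  assocHom {x y z a : D} (m : Pro x y) (n : Pro y z) (p : Pro z a) :
    Cell (proComp (proComp m n) p) (proComp m (proComp n p))
  assocInv {x y z a : D} (m : Pro x y) (n : Pro y z) (p : Pro z a) :
    Cell (proComp m (proComp n p)) (proComp (proComp m n) p)
  left_assocHom {x y z a : D} (m : Pro x y) (n : Pro y z) (p : Pro z a) :
    left (assocHom m n p) = 𝟙 x
  right_assocHom {x y z a : D} (m : Pro x y) (n : Pro y z) (p : Pro z a) :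
    right (assocHom m n p) = 𝟙 a
  left_assocInv {x y z a : D} (m : Pro x y) (n : Pro y z) (p : Pro z a) :
    left (assocInv m n p) = 𝟙 x
  right_assocInv {x y z a : D} (m : Pro x y) (n : Pro y z) (p : Pro z a) :
    right (assocInv m n p) = 𝟙 a
  assoc_hom_inv {x y z a : D} (m : Pro x y) (n : Pro y z) (p : Pro z a) :
    cellComp (assocHom m n p) (assocInv m n p) = cellId _
  assoc_inv_hom {x y z a : D} (m : Pro x y) (n : Pro y z) (p : Pro z a) :
    cellComp (assocInv m n p) (assocHom m n p) = cellId _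
  assoc_naturality {x y z a x' y' z' a' : D} {m : Pro x y} {n : Pro y z} {p : Pro z a}
    {m' : Pro x' y'} {n' : Pro y' z'} {p' : Pro z' a'}
    (α : Cell m m') (β : Cell n n') (γ : Cell p p') (h : right α = left β)
    (h' : right β = left γ) :
    cellComp (hcomp (hcomp α β h) γ ((right_hcomp α β h).trans h')) (assocHom m' n' p') =
      cellComp (assocHom m n p) (hcomp α (hcomp β γ h') (h.trans (left_hcomp β γ h').symm))
  leftUnitorHom {x y : D} (m : Pro x y) : Cell (proComp (proId x) m) m
  leftUnitorInv {x y : D} (m : Pro x y) : Cell m (proComp (proId x) m)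
  left_leftUnitorHom {x y : D} (m : Pro x y) : left (leftUnitorHom m) = 𝟙 x
  right_leftUnitorHom {x y : D} (m : Pro x y) : right (leftUnitorHom m) = 𝟙 y
  left_leftUnitorInv {x y : D} (m : Pro x y) : left (leftUnitorInv m) = 𝟙 x
  right_leftUnitorInv {x y : D} (m : Pro x y) : right (leftUnitorInv m) = 𝟙 y
  leftUnitor_hom_inv {x y : D} (m : Pro x y) :
    cellComp (leftUnitorHom m) (leftUnitorInv m) = cellId _
  leftUnitor_inv_hom {x y : D} (m : Pro x y) :
    cellComp (leftUnitorInv m) (leftUnitorHom m) = cellId _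
  leftUnitorHom_naturality {x y x' y' : D} {m : Pro x y} {m' : Pro x' y'} (α : Cell m m') :
    cellComp (hcomp (idCell (left α)) α (right_idCell _)) (leftUnitorHom m') =
      cellComp (leftUnitorHom m) α
  rightUnitorHom {x y : D} (m : Pro x y) : Cell (proComp m (proId y)) m
  rightUnitorInv {x y : D} (m : Pro x y) : Cell m (proComp m (proId y))
  left_rightUnitorHom {x y : D} (m : Pro x y) : left (rightUnitorHom m) = 𝟙 x
  right_rightUnitorHom {x y : D} (m : Pro x y) : right (rightUnitorHom m) = 𝟙 y
  left_rightUnitorInv {x y : D} (m : Pro x y) : left (rightUnitorInv m) = 𝟙 x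
  right_rightUnitorInv {x y : D} (m : Pro x y) : right (rightUnitorInv m) = 𝟙 y
  rightUnitor_hom_inv {x y : D} (m : Pro x y) :
    cellComp (rightUnitorHom m) (rightUnitorInv m) = cellId _
  rightUnitor_inv_hom {x y : D} (m : Pro x y) :
    cellComp (rightUnitorInv m) (rightUnitorHom m) = cellId _
  rightUnitorHom_naturality {x y x' y' : D} {m : Pro x y} {m' : Pro x' y'} (α : Cell m m') :
    cellComp (hcomp α (idCell (right α)) (left_idCell _).symm) (rightUnitorHom m') =
      cellComp (rightUnitorHom m) α
  pro_pentagon {x y z a b : D} (m : Pro x y) (n : Pro y z) (p : Pro z a) (q : Pro a b) :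
    cellComp (hcomp (assocHom m n p) (cellId q)
        ((right_assocHom m n p).trans (left_cellId q).symm))
      (cellComp (assocHom m (proComp n p) q) (hcomp (cellId m) (assocHom n p q)
        ((right_cellId m).trans (left_assocHom n p q).symm))) =
    cellComp (assocHom (proComp m n) p q) (assocHom m n (proComp p q))
  pro_triangle {x y z : D} (m : Pro x y) (n : Pro y z) :
    cellComp (assocHom m (proId y) n) (hcomp (cellId m) (leftUnitorHom n)
        ((right_cellId m).trans (left_leftUnitorHom n).symm)) =
      hcomp (rightUnitorHom m) (cellId n) ((right_rightUnitorHom m).trans (left_cellId n).symm)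

namespace DoubleCategory

attribute [simp] id_cellComp cellComp_id cellComp_assoc left_cellId right_cellId left_cellComp
  right_cellComp left_idCell right_idCell idCell_id left_hcomp right_hcomp hcomp_id
  left_assocHom right_assocHom left_assocInv right_assocInv assoc_hom_inv assoc_inv_hom
  left_leftUnitorHom right_leftUnitorHom left_leftUnitorInv right_leftUnitorInv
  leftUnitor_hom_inv leftUnitor_inv_hom
  left_rightUnitorHom right_rightUnitorHom left_rightUnitorInv right_rightUnitorInv
  rightUnitor_hom_inv rightUnitor_inv_hom

variable {D : Type u} [DoubleCategory.{t, w, v} D]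

/-! ### The underlying bicategory -/

/-- A globular cell: a cell whose left and right boundary arrows are identities. -/
@[ext]
structure Globular {x y : D} (m n : Pro x y) where
  cell : Cell m n
  left_eq : left cell = 𝟙 x
  right_eq : right cell = 𝟙 y

attribute [simp] Globular.left_eq Globular.right_eq

end DoubleCategory

open DoubleCategory

/-- The objects of the underlying bicategory of the double category `D`. -/
structure Loose (D : Type u) where
  obj : D

section Underlying

variable {D : Type u} [DoubleCategory.{t, w, v} D]

instance : CategoryStruct (Loose D) where
  Hom X Y := Pro X.obj Y.obj
  id X := proId X.obj
  comp m n := proComp m n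

instance looseHomCategory (X Y : Loose D) : Category.{t} (X ⟶ Y) where
  Hom m n := Globular (D := D) m n
  id m := ⟨cellId (D := D) m, left_cellId _, right_cellId _⟩
  comp α β := ⟨cellComp α.cell β.cell, by simp, by simp⟩
  id_comp α := Globular.ext (id_cellComp _)
  comp_id α := Globular.ext (cellComp_id _)
  assoc α β γ := Globular.ext (cellComp_assoc _ _ _)

/-- The underlying bicategory of a double category: objects, proarrows, globular cells. -/
instance looseBicategory : Bicategory.{t, w} (Loose D) where
  homCategory := looseHomCategory
  whiskerLeft m _ _ α := Globular.mk (hcomp (cellId (D := D) m) α.cell (by simp)) (by simp) (by simp)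
  whiskerRight α p := Globular.mk (hcomp α.cell (cellId (D := D) p) (by simp)) (by simp) (by simp)
  associator m n p :=
    { hom := Globular.mk (assocHom (D := D) m n p) (by simp) (by simp)
      inv := Globular.mk (assocInv (D := D) m n p) (by simp) (by simp)
      hom_inv_id := Globular.ext (assoc_hom_inv _ _ _)
      inv_hom_id := Globular.ext (assoc_inv_hom _ _ _) }
  leftUnitor m :=
    { hom := Globular.mk (leftUnitorHom (D := D) m) (by simp) (by simp)
      inv := Globular.mk (leftUnitorInv (D := D) m) (by simp) (by simp)
      hom_inv_id := Globular.ext (leftUnitor_hom_inv _)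
      inv_hom_id := Globular.ext (leftUnitor_inv_hom _) }
  rightUnitor m :=
    { hom := Globular.mk (rightUnitorHom (D := D) m) (by simp) (by simp)
      inv := Globular.mk (rightUnitorInv (D := D) m) (by simp) (by simp)
      hom_inv_id := Globular.ext (rightUnitor_hom_inv _)
      inv_hom_id := Globular.ext (rightUnitor_inv_hom _) }
  whiskerLeft_id m n := Globular.ext (hcomp_id _ _)
  whiskerLeft_comp m _ _ _ α β := by
    apply Globular.ext
    change hcomp _ (cellComp _ _) _ = cellComp (hcomp _ _ _) (hcomp _ _ _)
    rw [← hcomp_cellComp]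
    congr 1
    exact (id_cellComp _).symm
  id_whiskerLeft {X Y m n} α := by
    apply Globular.ext
    change hcomp (cellId (proId _)) α.cell _ =
      cellComp (leftUnitorHom _) (cellComp α.cell (leftUnitorInv _))
    rw [← cellComp_assoc, ← leftUnitorHom_naturality, cellComp_assoc, leftUnitor_hom_inv,
      cellComp_id]
    congr 1
    rw [α.left_eq, idCell_id]
  comp_whiskerLeft m n _ _ α := by
    apply Globular.ext
    change hcomp (cellId (proComp _ _)) α.cell _ = cellComp (assocHom _ _ _)
      (cellComp (hcomp (cellId _) (hcomp (cellId _) α.cell _) _) (assocInv _ _ _))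
    rw [← cellComp_assoc, ← assoc_naturality, cellComp_assoc, assoc_hom_inv, cellComp_id]
    congr 1
    exact (hcomp_id _ _).symm
  id_whiskerRight m n := Globular.ext (hcomp_id _ _)
  comp_whiskerRight α β p := by
    apply Globular.ext
    change hcomp (cellComp _ _) _ _ = cellComp (hcomp _ _ _) (hcomp _ _ _)
    rw [← hcomp_cellComp]
    congr 1
    exact (id_cellComp _).symm
  whiskerRight_id {X Y m n} α := by
    apply Globular.ext
    change hcomp α.cell (cellId (proId _)) _ =
      cellComp (rightUnitorHom _) (cellComp α.cell (rightUnitorInv _))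
    rw [← cellComp_assoc, ← rightUnitorHom_naturality, cellComp_assoc, rightUnitor_hom_inv,
      cellComp_id]
    congr 1
    rw [α.right_eq, idCell_id]
  whiskerRight_comp {_ _ _ _ m m'} α n p := by
    apply Globular.ext
    change hcomp α.cell (cellId (proComp _ _)) _ = cellComp (assocInv _ _ _)
      (cellComp (hcomp (hcomp α.cell (cellId _) _) (cellId _) _) (assocHom _ _ _))
    rw [assoc_naturality α.cell (cellId (D := D) n) (cellId (D := D) p) (by simp) (by simp),
      ← cellComp_assoc, assoc_inv_hom, id_cellComp]
    congr 1
    exact (hcomp_id _ _).symm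
  whisker_assoc m _ _ α p := by
    apply Globular.ext
    change hcomp (hcomp (cellId _) α.cell _) (cellId _) _ = cellComp (assocHom _ _ _)
      (cellComp (hcomp (cellId _) (hcomp α.cell (cellId _) _) _) (assocInv _ _ _))
    rw [← cellComp_assoc, ← assoc_naturality, cellComp_assoc, assoc_hom_inv, cellComp_id]
  whisker_exchange α β := by
    apply Globular.ext
    change cellComp (hcomp _ _ _) (hcomp _ _ _) = cellComp (hcomp _ _ _) (hcomp _ _ _)
    rw [← hcomp_cellComp, ← hcomp_cellComp]
    congr 1 <;> simp
  pentagon m n p q := Globular.ext (pro_pentagon (D := D) m n p q)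
  triangle m n := Globular.ext (pro_triangle (D := D) m n)

end Underlying

/-! ### Products of bicategories, diagonals, biadjunctions, direct sums -/

section Bicategories

/-- The power `B ^ I` of a bicategory, with componentwise structure. -/
instance powerBicategory (I : Type) (B : Type u) [Bicategory.{w, v} B] :
    Bicategory.{w, v} (I → B) where
  Hom x y := ∀ i, x i ⟶ y i
  id x := fun i => 𝟙 (x i)
  comp f g := fun i => f i ≫ g i
  homCategory x y := CategoryTheory.pi fun i => (x i ⟶ y i)
  whiskerLeft f _ _ θ := fun i => f i ◁ θ i
  whiskerRight θ h := fun i => θ i ▷ h i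
  associator f g h :=
    { hom := fun i => (α_ (f i) (g i) (h i)).hom
      inv := fun i => (α_ (f i) (g i) (h i)).inv
      hom_inv_id := funext fun _ => Iso.hom_inv_id _
      inv_hom_id := funext fun _ => Iso.inv_hom_id _ }
  leftUnitor f :=
    { hom := fun i => (λ_ (f i)).hom
      inv := fun i => (λ_ (f i)).inv
      hom_inv_id := funext fun _ => Iso.hom_inv_id _
      inv_hom_id := funext fun _ => Iso.inv_hom_id _ }
  rightUnitor f :=
    { hom := fun i => (ρ_ (f i)).hom
      inv := fun i => (ρ_ (f i)).inv
      hom_inv_id := funext fun _ => Iso.hom_inv_id _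
      inv_hom_id := funext fun _ => Iso.inv_hom_id _ }
  whiskerLeft_id _ _ := funext fun _ => Bicategory.whiskerLeft_id _ _
  whiskerLeft_comp _ _ _ _ _ _ := funext fun _ => Bicategory.whiskerLeft_comp _ _ _
  id_whiskerLeft _ := funext fun _ => Bicategory.id_whiskerLeft _
  comp_whiskerLeft _ _ _ _ _ := funext fun _ => Bicategory.comp_whiskerLeft _ _ _
  id_whiskerRight _ _ := funext fun _ => Bicategory.id_whiskerRight _ _
  comp_whiskerRight _ _ _ := funext fun _ => Bicategory.comp_whiskerRight _ _ _
  whiskerRight_id _ := funext fun _ => Bicategory.whiskerRight_id _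
  whiskerRight_comp _ _ _ := funext fun _ => Bicategory.whiskerRight_comp _ _ _
  whisker_assoc _ _ _ _ _ := funext fun _ => Bicategory.whisker_assoc _ _ _
  whisker_exchange _ _ := funext fun _ => Bicategory.whisker_exchange _ _
  pentagon _ _ _ _ := funext fun _ => Bicategory.pentagon _ _ _ _
  triangle _ _ := funext fun _ => Bicategory.triangle _ _

/-- The diagonal pseudofunctor `B ⥤ᵖ B ^ I`. -/
def diagonal (I : Type) (B : Type u) [Bicategory.{w, v} B] : Pseudofunctor B (I → B) where
  obj b := fun _ => b
  map f := fun _ => f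
  map₂ η := fun _ => η
  map₂_id _ := rfl
  map₂_comp _ _ := rfl
  mapId _ := Iso.refl _
  mapComp _ _ := Iso.refl _
  map₂_whisker_left f _ _ η := by
    funext i
    change f ◁ η = 𝟙 _ ≫ f ◁ η ≫ 𝟙 _
    simp
  map₂_whisker_right η h := by
    funext i
    change η ▷ h = 𝟙 _ ≫ η ▷ h ≫ 𝟙 _
    simp
  map₂_associator f g h := by
    funext i
    change (α_ f g h).hom = 𝟙 _ ≫ 𝟙 _ ▷ h ≫ (α_ f g h).hom ≫ f ◁ 𝟙 _ ≫ 𝟙 _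
    simp
  map₂_left_unitor f := by
    funext i
    change (λ_ f).hom = 𝟙 _ ≫ 𝟙 _ ▷ f ≫ (λ_ f).hom
    simp
  map₂_right_unitor f := by
    funext i
    change (ρ_ f).hom = 𝟙 _ ≫ f ◁ 𝟙 _ ≫ (ρ_ f).hom
    simp

variable {B : Type u} [Bicategory.{w, v} B] {C : Type u₂} [Bicategory.{w₂, v₂} C]

/-- A biadjunction `F ⊣ G` between bicategories: pseudonatural unit and counit, and invertible
modifications from the identity of `F` to
`F unit ≫ counit F` and from `unit G ≫ G counit` to the identity of `G`, satisfying the swallowtail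
identities. All modifications and pasting diagrams are written out in components. -/
structure Biadjunction (F : Pseudofunctor B C) (G : Pseudofunctor C B) where
  unit : Pseudofunctor.StrongTrans (Pseudofunctor.id B) (F.comp G)
  counit : Pseudofunctor.StrongTrans (G.comp F) (Pseudofunctor.id C)
  triangulatorLeft (b : B) : 𝟙 (F.obj b) ≅ F.map (unit.app b) ≫ counit.app (F.obj b)
  triangulatorRight (c : C) : unit.app (G.obj c) ≫ G.map (counit.app c) ≅ 𝟙 (G.obj c)
  /-- `triangulatorLeft` is a modification. -/
  triangulatorLeft_naturality {b b' : B} (f : b ⟶ b') :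
    F.map f ◁ (triangulatorLeft b').hom ≫ (α_ _ _ _).inv ≫
        ((F.mapComp f (unit.app b')).inv ≫ F.map₂ (unit.naturality f).hom ≫
          (F.mapComp (unit.app b) (G.map (F.map f))).hom) ▷ counit.app (F.obj b') ≫
        (α_ _ _ _).hom ≫ F.map (unit.app b) ◁ (counit.naturality (F.map f)).hom ≫
        (α_ _ _ _).inv =
      (ρ_ (F.map f)).hom ≫ (λ_ (F.map f)).inv ≫ (triangulatorLeft b).hom ▷ F.map f
  /-- `triangulatorRight` is a modification. -/
  triangulatorRight_naturality {c c' : C} (g : c ⟶ c') :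
    G.map g ◁ (triangulatorRight c').hom ≫ (ρ_ (G.map g)).hom ≫ (λ_ (G.map g)).inv =
      (α_ _ _ _).inv ≫ (unit.naturality (G.map g)).hom ▷ G.map (counit.app c') ≫
        (α_ _ _ _).hom ≫ unit.app (G.obj c) ◁
          ((G.mapComp (F.map (G.map g)) (counit.app c')).inv ≫
            G.map₂ (counit.naturality g).hom ≫ (G.mapComp (counit.app c) g).hom) ≫
        (α_ _ _ _).inv ≫ (triangulatorRight c).hom ▷ G.map g
  /-- The first swallowtail identity. -/
  swallowtail_unit (b : B) :
    (ρ_ (unit.app b)).inv ≫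
      unit.app b ◁ ((G.mapId (F.obj b)).inv ≫ G.map₂ (triangulatorLeft b).hom ≫
        (G.mapComp (F.map (unit.app b)) (counit.app (F.obj b))).hom) ≫
      (α_ _ _ _).inv ≫ (unit.naturality (unit.app b)).inv ▷ G.map (counit.app (F.obj b)) ≫
      (α_ _ _ _).hom ≫ unit.app b ◁ (triangulatorRight (F.obj b)).hom ≫
      (ρ_ (unit.app b)).hom = 𝟙 (unit.app b)
  /-- The second swallowtail identity. -/
  swallowtail_counit (c : C) :
    (λ_ (counit.app c)).inv ≫ (triangulatorLeft (G.obj c)).hom ▷ counit.app c ≫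
      (α_ _ _ _).hom ≫ F.map (unit.app (G.obj c)) ◁ (counit.naturality (counit.app c)).inv ≫
      (α_ _ _ _).inv ≫
      ((F.mapComp (unit.app (G.obj c)) (G.map (counit.app c))).inv ≫
        F.map₂ (triangulatorRight c).hom ≫ (F.mapId (G.obj c)).hom) ▷ counit.app c ≫
      (λ_ (counit.app c)).hom = 𝟙 (counit.app c)

/-- The 1-cells `ι i : x i ⟶ s` exhibit `s` as a bicategorical coproduct of the family `x`:
for every object `z`, restriction along the `ι i` is an equivalence of categories
`B(s, z) ≌ ∏ i, B(x i, z)`. -/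
def IsBicategoricalCoproduct {I : Type} {x : I → B} {s : B} (ι : ∀ i, x i ⟶ s) : Prop :=
  ∀ z : B, (Functor.pi' fun i => Bicategory.precomp z (ι i)).IsEquivalence

/-- The 1-cells `π i : s ⟶ x i` exhibit `s` as a bicategorical product of the family `x`:
for every object `z`, composition with the `π i` is an equivalence of categories
`B(z, s) ≌ ∏ i, B(z, x i)`. -/
def IsBicategoricalProduct {I : Type} {x : I → B} {s : B} (π : ∀ i, s ⟶ x i) : Prop :=
  ∀ z : B, (Functor.pi' fun i => Bicategory.postcomp z (π i)).IsEquivalence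

/-- A bicategory has direct sums if every finite family of objects has a bicategorical coproduct
and a bicategorical product with the same underlying object. -/
def HasDirectSums (B : Type u) [Bicategory.{w, v} B] : Prop :=
  ∀ (I : Type) [Finite I] (x : I → B), ∃ (s : B) (ι : ∀ i, x i ⟶ s) (π : ∀ i, s ⟶ x i),
    IsBicategoricalCoproduct ι ∧ IsBicategoricalProduct π

end Bicategories

/-! ### Companions and conjoints -/

namespace DoubleCategory

variable {D : Type u} [DoubleCategory.{t, w, v} D]

/-- The structure of a companion of the arrow `f` on the proarrow `p`. -/
structure CompanionData {x y : D} (f : x ⟶ y) (p : Pro x y) where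
  unit : Cell (proId x) p
  counit : Cell p (proId y)
  left_unit : left unit = 𝟙 x
  right_unit : right unit = f
  left_counit : left counit = f
  right_counit : right counit = 𝟙 y
  unit_counit : cellComp unit counit = idCell f
  unit_hcomp_counit :
    cellComp (leftUnitorInv p) (cellComp (hcomp unit counit (right_unit.trans left_counit.symm))
      (rightUnitorHom p)) = cellId p

/-- The structure of a conjoint of the arrow `f` on the proarrow `p`. -/
structure ConjointData {x y : D} (f : x ⟶ y) (p : Pro y x) where
  unit : Cell (proId x) p
  counit : Cell p (proId y)
  left_unit : left unit = f
  right_unit : right unit = 𝟙 x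
  left_counit : left counit = 𝟙 y
  right_counit : right counit = f
  unit_counit : cellComp unit counit = idCell f
  counit_hcomp_unit :
    cellComp (rightUnitorInv p) (cellComp (hcomp counit unit (right_counit.trans left_unit.symm))
      (leftUnitorHom p)) = cellId p

/-- Given companions `p` of `f` and `q` of `g`, a cell `α : m ⟶ n` with left boundary `f` and right
boundary `g` is reshaped into the globular cell `m ⊙ q ⟶ p ⊙ n` given by pasting `α` with the unit
of `p` and the counit of `q`. -/
def companionSlide {x y x' y' : D} {f : x ⟶ x'} {g : y ⟶ y'} {p : Pro x x'} {q : Pro y y'}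
    (cf : CompanionData f p) (cg : CompanionData g q) {m : Pro x y} {n : Pro x' y'}
    (α : Cell m n) (hl : left α = f) (hr : right α = g) : Cell (proComp m q) (proComp p n) :=
  cellComp (hcomp (leftUnitorInv m) (cellId q) (by simp))
    (cellComp
      (hcomp (hcomp cf.unit α (by rw [cf.right_unit, hl])) cg.counit
        (by rw [right_hcomp, hr, cg.left_counit]))
      (rightUnitorHom (proComp p n)))

/-- Given conjoints `p` of `f` and `q` of `g`, a cell `α : m ⟶ n` with left boundary `f` and right
boundary `g` is reshaped into the globular cell `p ⊙ m ⟶ n ⊙ q` given by pasting `α` with the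
counit of `p` and the unit of `q`. -/
def conjointSlide {x y x' y' : D} {f : x ⟶ x'} {g : y ⟶ y'} {p : Pro x' x} {q : Pro y' y}
    (cf : ConjointData f p) (cg : ConjointData g q) {m : Pro x y} {n : Pro x' y'}
    (α : Cell m n) (hl : left α = f) (hr : right α = g) : Cell (proComp p m) (proComp n q) :=
  cellComp (hcomp (cellId p) (rightUnitorInv m) (by simp))
    (cellComp
      (hcomp cf.counit (hcomp α cg.unit (by rw [cg.left_unit, hr]))
        (by rw [left_hcomp, hl, cf.right_counit]))
      (leftUnitorHom (proComp n q)))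

/-! ### Strong finite coproducts

A span of sets from `I` to `J` is given by the family `A : I → J → Type` of fibres of its apex
over `I × J`; thus a family of proarrows from `x : I → D` to `y : J → D` indexed by the span
consists of a proarrow `m i j a : Pro (x i) (y j)` for all `i`, `j` and `a : A i j`.
In these terms the composite of spans (the pullback) has the fibres `Σ j, A i j × B j k`, and the
identity span has the fibres `PLift (i = j)`. -/

/-- The cells `κ i j a : m i j a ⟶ P`, lying over the arrows `s i` on the left and `r j` on the
right, exhibit `P` as a coproduct of the span-indexed family of proarrows `m`: for all arrows
`f`, `g` out of the source and target of `P`, every family of cells from `m` to a proarrow `n`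
lying over the arrows `s i ≫ f` and `r j ≫ g` factors through `κ` by a unique cell `P ⟶ n` lying
over `f` and `g`. -/
structure IsSpanCoproduct {I J : Type} {x : I → D} {y : J → D} {A : I → J → Type}
    (m : ∀ i j, A i j → Pro (x i) (y j)) {X Y : D} (s : ∀ i, x i ⟶ X) (r : ∀ j, y j ⟶ Y)
    (P : Pro X Y) (κ : ∀ i j (a : A i j), Cell (m i j a) P) : Prop where
  left_eq : ∀ i j a, left (κ i j a) = s i
  right_eq : ∀ i j a, right (κ i j a) = r j
  existsUnique : ∀ {z w : D} (n : Pro z w) (f : X ⟶ z) (g : Y ⟶ w)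
    (φ : ∀ i j (a : A i j), Cell (m i j a) n), (∀ i j a, left (φ i j a) = s i ≫ f) →
    (∀ i j a, right (φ i j a) = r j ≫ g) →
    ∃! ψ : Cell P n, left ψ = f ∧ right ψ = g ∧ ∀ i j a, cellComp (κ i j a) ψ = φ i j a

/-- The composite of two composable span-indexed families of proarrows. -/
def compFamily {I J K : Type} {x : I → D} {y : J → D} {z : K → D} {A : I → J → Type}
    {B : J → K → Type} (m : ∀ i j, A i j → Pro (x i) (y j)) (n : ∀ j k, B j k → Pro (y j) (z k)) :
    ∀ i k, (Σ j, A i j × B j k) → Pro (x i) (z k) :=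
  fun i k a => proComp (m i a.1 a.2.1) (n a.1 k a.2.2)

/-- A parallel family of proarrows, as a family indexed by the identity span. -/
def parallelFamily {I : Type} {x y : I → D} (m : ∀ i, Pro (x i) (y i)) :
    ∀ i j, PLift (i = j) → Pro (x i) (y j)
  | i, _, ⟨rfl⟩ => m i

/-- A parallel family of cells into a single proarrow, as a family indexed by the identity
span. -/
def parallelCells {I : Type} {x y : I → D} {m : ∀ i, Pro (x i) (y i)} {X Y : D} {P : Pro X Y}
    (κ : ∀ i, Cell (m i) P) : ∀ i j (a : PLift (i = j)), Cell (parallelFamily m i j a) P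
  | i, _, ⟨rfl⟩ => κ i

variable (D) in
/-- Strong finite coproducts in a double category: every finite family of objects has a (chosen)
coproduct, every finite span-indexed family of proarrows has a (chosen) coproduct between the
chosen coproducts of objects, and coproducts of span-indexed families commute with external
composition and external identities, in the sense that external composites and identities of
coproducts, with the composite and identity coprojections, are again coproducts. Equivalently, the
canonical comparison cells are invertible. The choice of coproducts is normalized: the coproduct
of a family consisting of a single object is the object itself. -/
structure StrongFiniteCoproducts where
  cofan {I : Type} [Finite I] (x : I → D) : Cofan x
  isColimit {I : Type} [Finite I] (x : I → D) : IsColimit (cofan x)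
  cofan_single (x : D) : cofan (fun _ : PUnit.{1} => x) = Cofan.mk x fun _ => 𝟙 x
  pro {I J : Type} [Finite I] [Finite J] {x : I → D} {y : J → D} {A : I → J → Type}
    [∀ i j, Finite (A i j)] (m : ∀ i j, A i j → Pro (x i) (y j)) : Pro (cofan x).pt (cofan y).pt
  incl {I J : Type} [Finite I] [Finite J] {x : I → D} {y : J → D} {A : I → J → Type}
    [∀ i j, Finite (A i j)] (m : ∀ i j, A i j → Pro (x i) (y j)) (i : I) (j : J) (a : A i j) :
    Cell (m i j a) (pro m)
  isSpanCoproduct {I J : Type} [Finite I] [Finite J] {x : I → D} {y : J → D} {A : I → J → Type}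
    [∀ i j, Finite (A i j)] (m : ∀ i j, A i j → Pro (x i) (y j)) :
    IsSpanCoproduct m (cofan x).inj (cofan y).inj (pro m) (incl m)
  isSpanCoproduct_comp {I J K : Type} [Finite I] [Finite J] [Finite K] {x : I → D} {y : J → D}
    {z : K → D} {A : I → J → Type} {B : J → K → Type} [∀ i j, Finite (A i j)]
    [∀ j k, Finite (B j k)] (m : ∀ i j, A i j → Pro (x i) (y j))
    (n : ∀ j k, B j k → Pro (y j) (z k)) :
    IsSpanCoproduct (compFamily m n) (cofan x).inj (cofan z).inj (proComp (pro m) (pro n))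
      (fun i k a => hcomp (incl m i a.1 a.2.1) (incl n a.1 k a.2.2)
        (((isSpanCoproduct m).right_eq _ _ _).trans ((isSpanCoproduct n).left_eq _ _ _).symm))
  isSpanCoproduct_id {I : Type} [Finite I] (x : I → D) :
    IsSpanCoproduct (parallelFamily fun i => proId (x i)) (cofan x).inj (cofan x).inj
      (proId (cofan x).pt) (parallelCells fun i => idCell ((cofan x).inj i))

namespace StrongFiniteCoproducts

/-- The universal property of coproducts of parallel families. -/
lemma existsUnique_of_isSpanCoproduct {I : Type} {x y : I → D} {m : ∀ i, Pro (x i) (y i)} {X Y : D}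
    {s : ∀ i, x i ⟶ X} {r : ∀ j, y j ⟶ Y} {P : Pro X Y} {κ : ∀ i, Cell (m i) P}
    (h : IsSpanCoproduct (parallelFamily m) s r P (parallelCells κ))
    {z w : D} (n : Pro z w) (f : X ⟶ z) (g : Y ⟶ w) (φ : ∀ i, Cell (m i) n)
    (hl : ∀ i, left (φ i) = s i ≫ f) (hr : ∀ i, right (φ i) = r i ≫ g) :
    ∃! ψ : Cell P n, left ψ = f ∧ right ψ = g ∧ ∀ i, cellComp (κ i) ψ = φ i := by
  obtain ⟨ψ, ⟨h1, h2, h3⟩, h4⟩ := h.existsUnique n f g (parallelCells φ)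
    (by rintro i _ ⟨rfl⟩; exact hl i) (by rintro i _ ⟨rfl⟩; exact hr i)
  refine ⟨ψ, ⟨h1, h2, fun i => h3 i i ⟨rfl⟩⟩, fun ψ' ⟨k1, k2, k3⟩ => h4 ψ' ⟨k1, k2, ?_⟩⟩
  rintro i _ ⟨rfl⟩
  exact k3 i

variable (S : StrongFiniteCoproducts D) {I : Type} [Finite I]

/-- The coproduct of a finite family of objects. -/
abbrev sum (x : I → D) : D := (S.cofan x).pt

/-- The coprojections. -/
abbrev inj (x : I → D) (i : I) : x i ⟶ S.sum x := (S.cofan x).inj i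

/-- The codiagonal. -/
def codiag (I : Type) [Finite I] (z : D) : S.sum (fun _ : I => z) ⟶ z :=
  Cofan.IsColimit.desc (S.isColimit _) fun _ => 𝟙 z

lemma inj_codiag (z : D) (i : I) : S.inj (fun _ : I => z) i ≫ S.codiag I z = 𝟙 z :=
  Cofan.IsColimit.fac (S.isColimit _) _ i

/-- The coproduct of a finite parallel family of proarrows. -/
def sumPro {x y : I → D} (m : ∀ i, Pro (x i) (y i)) : Pro (S.sum x) (S.sum y) :=
  S.pro (parallelFamily m)

/-- The coprojections of the coproduct of a finite parallel family of proarrows. -/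
def inclPro {x y : I → D} (m : ∀ i, Pro (x i) (y i)) (i : I) : Cell (m i) (S.sumPro m) :=
  S.incl (parallelFamily m) i i ⟨rfl⟩

@[simp]
lemma left_inclPro {x y : I → D} (m : ∀ i, Pro (x i) (y i)) (i : I) :
    left (S.inclPro m i) = S.inj x i :=
  (S.isSpanCoproduct (parallelFamily m)).left_eq i i ⟨rfl⟩

@[simp]
lemma right_inclPro {x y : I → D} (m : ∀ i, Pro (x i) (y i)) (i : I) :
    right (S.inclPro m i) = S.inj y i :=
  (S.isSpanCoproduct (parallelFamily m)).right_eq i i ⟨rfl⟩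

lemma incl_parallelFamily {x y : I → D} (m : ∀ i, Pro (x i) (y i)) :
    S.incl (parallelFamily m) = parallelCells (P := S.sumPro m) (S.inclPro m) := by
  funext i j a
  obtain ⟨rfl⟩ := a
  rfl

lemma isSpanCoproduct_sumPro {x y : I → D} (m : ∀ i, Pro (x i) (y i)) :
    IsSpanCoproduct (parallelFamily m) (S.inj x) (S.inj y) (S.sumPro m)
      (parallelCells (S.inclPro m)) :=
  S.incl_parallelFamily m ▸ S.isSpanCoproduct (parallelFamily m)

lemma isSpanCoproduct_sumPro_comp {x y z : I → D} (m : ∀ i, Pro (x i) (y i))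
    (n : ∀ i, Pro (y i) (z i)) :
    IsSpanCoproduct (parallelFamily fun i => proComp (m i) (n i)) (S.inj x) (S.inj z)
      (proComp (S.sumPro m) (S.sumPro n))
      (parallelCells fun i => hcomp (S.inclPro m i) (S.inclPro n i) (by simp)) where
  left_eq := by rintro i _ ⟨rfl⟩; exact (left_hcomp _ _ _).trans (S.left_inclPro m i)
  right_eq := by rintro i _ ⟨rfl⟩; exact (right_hcomp _ _ _).trans (S.right_inclPro n i)
  existsUnique {_ _} p f g φ hl hr := by
    obtain ⟨ψ, ⟨h1, h2, h3⟩, h4⟩ :=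
      (S.isSpanCoproduct_comp (parallelFamily m) (parallelFamily n)).existsUnique p f g
        (fun i k a => match i, k, a with
          | i, _, ⟨_, ⟨rfl⟩, ⟨rfl⟩⟩ => φ i i ⟨rfl⟩)
        (by rintro i _ ⟨_, ⟨rfl⟩, ⟨rfl⟩⟩; exact hl i i ⟨rfl⟩)
        (by rintro i _ ⟨_, ⟨rfl⟩, ⟨rfl⟩⟩; exact hr i i ⟨rfl⟩)
    refine ⟨ψ, ⟨h1, h2, ?_⟩, fun ψ' ⟨k1, k2, k3⟩ => h4 ψ' ⟨k1, k2, ?_⟩⟩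
    · rintro i _ ⟨rfl⟩
      exact h3 i i ⟨i, ⟨rfl⟩, ⟨rfl⟩⟩
    · rintro i _ ⟨_, ⟨rfl⟩, ⟨rfl⟩⟩
      exact k3 i i ⟨rfl⟩

/-- The cell out of a coproduct of proarrows determined by a family of cells. -/
noncomputable def descPro {x y : I → D} {m : ∀ i, Pro (x i) (y i)} {z w : D} {n : Pro z w}
    (f : S.sum x ⟶ z) (g : S.sum y ⟶ w) (φ : ∀ i, Cell (m i) n)
    (hl : ∀ i, left (φ i) = S.inj x i ≫ f) (hr : ∀ i, right (φ i) = S.inj y i ≫ g) :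
    Cell (S.sumPro m) n :=
  (existsUnique_of_isSpanCoproduct (S.isSpanCoproduct_sumPro m) n f g φ hl hr).choose

section

variable {x y : I → D} {m : ∀ i, Pro (x i) (y i)} {z w : D} {n : Pro z w}
    (f : S.sum x ⟶ z) (g : S.sum y ⟶ w) (φ : ∀ i, Cell (m i) n)
    (hl : ∀ i, left (φ i) = S.inj x i ≫ f) (hr : ∀ i, right (φ i) = S.inj y i ≫ g)

@[simp]
lemma left_descPro : left (S.descPro f g φ hl hr) = f :=
  (existsUnique_of_isSpanCoproduct
    (S.isSpanCoproduct_sumPro m) n f g φ hl hr).choose_spec.1.1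

@[simp]
lemma right_descPro : right (S.descPro f g φ hl hr) = g :=
  (existsUnique_of_isSpanCoproduct
    (S.isSpanCoproduct_sumPro m) n f g φ hl hr).choose_spec.1.2.1

@[simp]
lemma inclPro_descPro (i : I) : cellComp (S.inclPro m i) (S.descPro f g φ hl hr) = φ i :=
  (existsUnique_of_isSpanCoproduct
    (S.isSpanCoproduct_sumPro m) n f g φ hl hr).choose_spec.1.2.2 i

@[simp]
lemma inclPro_descPro_assoc (i : I) {z' w' : D} {p : Pro z' w'} (β : Cell n p) :
    cellComp (S.inclPro m i) (cellComp (S.descPro f g φ hl hr) β) = cellComp (φ i) β := by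
  rw [← cellComp_assoc, inclPro_descPro]

lemma sumPro_hom_ext {α β : Cell (S.sumPro m) n} (h1 : left α = left β) (h2 : right α = right β)
    (h : ∀ i, cellComp (S.inclPro m i) α = cellComp (S.inclPro m i) β) : α = β :=
  (existsUnique_of_isSpanCoproduct (S.isSpanCoproduct_sumPro m) n (left β) (right β)
    (fun i => cellComp (S.inclPro m i) β) (by simp) (by simp)).unique
    ⟨h1, h2, h⟩ ⟨rfl, rfl, fun _ => rfl⟩

end

/-- A coproduct of a parallel family is globularly isomorphic to the chosen one. -/
noncomputable def isoOfIsSpanCoproduct {x y : I → D} {m : ∀ i, Pro (x i) (y i)}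
    {P : Pro (S.sum x) (S.sum y)} {κ : ∀ i, Cell (m i) P}
    (h : IsSpanCoproduct (parallelFamily m) (S.inj x) (S.inj y) P (parallelCells κ)) :
    Iso (C := (Loose.mk (S.sum x) ⟶ Loose.mk (S.sum y))) (S.sumPro m) P :=
  have hl (i : I) : left (κ i) = S.inj x i := h.left_eq i i ⟨rfl⟩
  have hr (i : I) : right (κ i) = S.inj y i := h.right_eq i i ⟨rfl⟩
  have hs := existsUnique_of_isSpanCoproduct h (S.sumPro m) (𝟙 _) (𝟙 _) (S.inclPro m)
    (by simp) (by simp)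
  { hom := Globular.mk (S.descPro (𝟙 _) (𝟙 _) κ (by simp [hl]) (by simp [hr])) (by simp) (by simp)
    inv := Globular.mk hs.choose hs.choose_spec.1.1 hs.choose_spec.1.2.1
    hom_inv_id := by
      apply Globular.ext
      change cellComp (S.descPro (𝟙 _) (𝟙 _) κ (by simp [hl]) (by simp [hr])) hs.choose = cellId _
      apply S.sumPro_hom_ext
      · simp only [left_cellComp, left_descPro, left_cellId, Category.id_comp]
        exact hs.choose_spec.1.1
      · simp only [right_cellComp, right_descPro, right_cellId, Category.id_comp]
        exact hs.choose_spec.1.2.1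
      · intro i
        rw [inclPro_descPro_assoc, cellComp_id]
        exact hs.choose_spec.1.2.2 i
    inv_hom_id := by
      apply Globular.ext
      change cellComp hs.choose (S.descPro (𝟙 _) (𝟙 _) κ (by simp [hl]) (by simp [hr])) = cellId _
      refine (existsUnique_of_isSpanCoproduct h P (𝟙 _) (𝟙 _) κ (by simp [hl])
        (by simp [hr])).unique ⟨?_, ?_, ?_⟩ ⟨?_, ?_, ?_⟩
      · simp only [left_cellComp, left_descPro, Category.comp_id]
        exact hs.choose_spec.1.1
      · simp only [right_cellComp, right_descPro, Category.comp_id]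
        exact hs.choose_spec.1.2.1
      · intro i
        rw [← cellComp_assoc, hs.choose_spec.1.2.2 i, inclPro_descPro]
      · simp
      · simp
      · simp }

section

variable {x y : I → D} {m : ∀ i, Pro (x i) (y i)}
    {P : Pro (S.sum x) (S.sum y)} {κ : ∀ i, Cell (m i) P}
    (h : IsSpanCoproduct (parallelFamily m) (S.inj x) (S.inj y) P (parallelCells κ))

lemma inclPro_iso_hom (i : I) :
    cellComp (S.inclPro m i) (S.isoOfIsSpanCoproduct h).hom.cell = κ i :=
  S.inclPro_descPro (𝟙 _) (𝟙 _) κ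
    (fun i => (h.left_eq i i ⟨rfl⟩).trans (Category.comp_id _).symm)
    (fun i => (h.right_eq i i ⟨rfl⟩).trans (Category.comp_id _).symm) i

lemma inclPro_iso_inv (i : I) :
    cellComp (κ i) (S.isoOfIsSpanCoproduct h).inv.cell = S.inclPro m i := by
  rw [← S.inclPro_iso_hom h i, cellComp_assoc]
  have := congrArg Globular.cell (S.isoOfIsSpanCoproduct h).hom_inv_id
  change cellComp _ _ = cellId _ at this
  rw [this, cellComp_id]

end

/-- The globular cell between coproducts of parallel families induced by globular cells. -/
noncomputable def sumMap {x y : I → D} {m n : ∀ i, Pro (x i) (y i)}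
    (θ : ∀ i, Globular (m i) (n i)) : Globular (S.sumPro m) (S.sumPro n) where
  cell := S.descPro (𝟙 _) (𝟙 _) (fun i => cellComp (θ i).cell (S.inclPro n i))
    (by simp) (by simp)
  left_eq := by simp
  right_eq := by simp

lemma inclPro_sumMap {x y : I → D} {m n : ∀ i, Pro (x i) (y i)}
    (θ : ∀ i, Globular (m i) (n i)) (i : I) :
    cellComp (S.inclPro m i) (S.sumMap θ).cell = cellComp (θ i).cell (S.inclPro n i) :=
  S.inclPro_descPro (𝟙 _) (𝟙 _) (fun i => cellComp (θ i).cell (S.inclPro n i))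
    (by simp) (by simp) i

/-- The comparison `⊕ (m ⊙ n) ≅ (⊕ m) ⊙ (⊕ n)`. -/
noncomputable def sumComp {x y z : I → D} (m : ∀ i, Pro (x i) (y i)) (n : ∀ i, Pro (y i) (z i)) :
    Iso (C := (Loose.mk (S.sum x) ⟶ Loose.mk (S.sum z)))
      (S.sumPro fun i => proComp (m i) (n i)) (proComp (S.sumPro m) (S.sumPro n)) :=
  S.isoOfIsSpanCoproduct (S.isSpanCoproduct_sumPro_comp m n)

/-- The comparison `⊕ id ≅ id`. -/
noncomputable def sumId (x : I → D) :
    Iso (C := (Loose.mk (S.sum x) ⟶ Loose.mk (S.sum x)))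
      (S.sumPro fun i => proId (x i)) (proId (S.sum x)) :=
  S.isoOfIsSpanCoproduct (S.isSpanCoproduct_id x)

lemma inclPro_sumComp_hom {x y z : I → D} (m : ∀ i, Pro (x i) (y i)) (n : ∀ i, Pro (y i) (z i))
    (i : I) : cellComp (S.inclPro (fun i => proComp (m i) (n i)) i) (S.sumComp m n).hom.cell =
      hcomp (S.inclPro m i) (S.inclPro n i) (by simp) :=
  S.inclPro_iso_hom _ i

lemma inclPro_sumComp_inv {x y z : I → D} (m : ∀ i, Pro (x i) (y i)) (n : ∀ i, Pro (y i) (z i))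
    (i : I) : cellComp (hcomp (S.inclPro m i) (S.inclPro n i) (by simp)) (S.sumComp m n).inv.cell =
      S.inclPro (fun i => proComp (m i) (n i)) i :=
  S.inclPro_iso_inv (S.isSpanCoproduct_sumPro_comp m n) i

lemma inclPro_sumId_hom (x : I → D) (i : I) :
    cellComp (S.inclPro (fun i => proId (x i)) i) (S.sumId x).hom.cell = idCell (S.inj x i) :=
  S.inclPro_iso_hom _ i

/-- Horizontal composition of cells, keeping track of equations only. -/
lemma hcomp_congr {x y z x' y' z' : D} {m : Pro x y} {n : Pro y z} {m' : Pro x' y'}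
    {n' : Pro y' z'} {α α' : Cell m m'} {β β' : Cell n n'} (h : right α = left β) (hα : α = α')
    (hβ : β = β') : hcomp α β h = hcomp α' β' (hα ▸ hβ ▸ h) := by
  subst hα hβ
  rfl

variable (I) in
/-- The pseudofunctor of bicategories `⊕ : 𝐃 ^ I ⥤ᵖ 𝐃` underlying the coproduct double functor:
it sends parallel families of objects, proarrows and globular cells to their coproducts. -/
noncomputable def directSum : Pseudofunctor (I → Loose D) (Loose D) where
  obj x := ⟨S.sum fun i => (x i).obj⟩
  map m := S.sumPro (D := D) m
  map₂ θ := S.sumMap θ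
  map₂_id {x y} m := by
    apply Globular.ext
    apply S.sumPro_hom_ext
    · exact (Globular.left_eq _).trans (left_cellId _).symm
    · exact (Globular.right_eq _).trans (right_cellId _).symm
    · intro i
      rw [inclPro_sumMap]
      exact (id_cellComp _).trans (cellComp_id _).symm
  map₂_comp {x y m n p} θ θ' := by
    apply Globular.ext
    apply S.sumPro_hom_ext
    · exact (Globular.left_eq _).trans (Globular.left_eq _).symm
    · exact (Globular.right_eq _).trans (Globular.right_eq _).symm
    · intro i
      change _ = cellComp _ (cellComp (S.sumMap θ).cell (S.sumMap θ').cell)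
      rw [inclPro_sumMap, ← cellComp_assoc, inclPro_sumMap, cellComp_assoc, inclPro_sumMap,
        ← cellComp_assoc]
      rfl
  mapId x := S.sumId fun i => (x i).obj
  mapComp m n := S.sumComp (D := D) m n
  map₂_whisker_left {x y z} m n p θ := by
    apply Globular.ext
    apply S.sumPro_hom_ext
    · exact (Globular.left_eq _).trans (Globular.left_eq _).symm
    · exact (Globular.right_eq _).trans (Globular.right_eq _).symm
    · intro i
      change _ = cellComp (S.inclPro (fun i => proComp (m i) (n i)) i)
        (cellComp (S.sumComp (D := D) m n).hom.cell
        (cellComp (hcomp (cellId (S.sumPro (D := D) m)) (S.sumMap θ).cell _)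
          (S.sumComp (D := D) m p).inv.cell))
      rw [inclPro_sumMap, ← cellComp_assoc, inclPro_sumComp_hom, ← cellComp_assoc,
        ← hcomp_cellComp, hcomp_congr _ (cellComp_id _) (S.inclPro_sumMap θ i)]
      refine (congrArg (cellComp _) (S.inclPro_sumComp_inv (D := D) m p i).symm).trans ?_
      rw [← cellComp_assoc]
      congr 1
      refine (hcomp_cellComp (D := D) (cellId (D := D) (m i)) (θ i).cell (S.inclPro (D := D) m i)
        (S.inclPro (D := D) p i) (by simp) (by simp)).symm.trans ?_
      exact hcomp_congr _ (id_cellComp _) rfl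
  map₂_whisker_right {x y z m n} θ p := by
    apply Globular.ext
    apply S.sumPro_hom_ext
    · exact (Globular.left_eq _).trans (Globular.left_eq _).symm
    · exact (Globular.right_eq _).trans (Globular.right_eq _).symm
    · intro i
      change _ = cellComp (S.inclPro (fun i => proComp (m i) (p i)) i)
        (cellComp (S.sumComp (D := D) m p).hom.cell
        (cellComp (hcomp (S.sumMap θ).cell (cellId (S.sumPro (D := D) p)) _)
          (S.sumComp (D := D) n p).inv.cell))
      rw [inclPro_sumMap, ← cellComp_assoc, inclPro_sumComp_hom, ← cellComp_assoc,
        ← hcomp_cellComp, hcomp_congr _ (S.inclPro_sumMap θ i) (cellComp_id _)]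
      refine (congrArg (cellComp _) (S.inclPro_sumComp_inv (D := D) n p i).symm).trans ?_
      rw [← cellComp_assoc]
      congr 1
      refine (hcomp_cellComp (D := D) (θ i).cell (cellId (D := D) (p i)) (S.inclPro (D := D) n i)
        (S.inclPro (D := D) p i) (by simp) (by simp)).symm.trans ?_
      exact hcomp_congr _ rfl (id_cellComp _)
  map₂_associator {x y z a} m n p := by
    apply Globular.ext
    apply S.sumPro_hom_ext
    · exact (Globular.left_eq _).trans (Globular.left_eq _).symm
    · exact (Globular.right_eq _).trans (Globular.right_eq _).symm
    · intro i
      change _ = cellComp (S.inclPro (fun i => proComp (proComp (m i) (n i)) (p i)) i)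
        (cellComp (S.sumComp (D := D) (fun i => proComp (m i) (n i)) p).hom.cell
        (cellComp (hcomp (S.sumComp (D := D) m n).hom.cell (cellId (S.sumPro (D := D) p)) _)
        (cellComp (assocHom _ _ _)
        (cellComp (hcomp (cellId (S.sumPro (D := D) m)) (S.sumComp (D := D) n p).inv.cell _)
          (S.sumComp (D := D) m (fun i => proComp (n i) (p i))).inv.cell))))
      rw [inclPro_sumMap, ← cellComp_assoc, inclPro_sumComp_hom, ← cellComp_assoc,
        ← hcomp_cellComp, hcomp_congr _ (S.inclPro_sumComp_hom (D := D) m n i) (cellComp_id _),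
        ← cellComp_assoc, assoc_naturality _ _ _ (by simp) (by simp), cellComp_assoc,
        ← cellComp_assoc (hcomp _ _ _), ← hcomp_cellComp,
        hcomp_congr _ (cellComp_id _) (S.inclPro_sumComp_inv (D := D) n p i),
        inclPro_sumComp_inv]
      rfl
  map₂_left_unitor {x y} m := by
    apply Globular.ext
    apply S.sumPro_hom_ext
    · exact (Globular.left_eq _).trans (Globular.left_eq _).symm
    · exact (Globular.right_eq _).trans (Globular.right_eq _).symm
    · intro i
      change _ = cellComp (S.inclPro (fun i => proComp (proId (x i).obj) (m i)) i)
        (cellComp (S.sumComp (D := D) (fun i => proId (x i).obj) m).hom.cell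
        (cellComp (hcomp (S.sumId fun i => (x i).obj).hom.cell (cellId (S.sumPro (D := D) m)) _)
        (leftUnitorHom _)))
      rw [inclPro_sumMap, ← cellComp_assoc, inclPro_sumComp_hom, ← cellComp_assoc,
        ← hcomp_cellComp, hcomp_congr _ (S.inclPro_sumId_hom (fun i => (x i).obj) i) (cellComp_id _)]
      refine (leftUnitorHom_naturality (S.inclPro (D := D) m i)).symm.trans ?_
      congr 1
      exact hcomp_congr _ (congrArg idCell (S.left_inclPro (D := D) m i)) rfl
  map₂_right_unitor {x y} m := by
    apply Globular.ext
    apply S.sumPro_hom_ext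
    · exact (Globular.left_eq _).trans (Globular.left_eq _).symm
    · exact (Globular.right_eq _).trans (Globular.right_eq _).symm
    · intro i
      change _ = cellComp (S.inclPro (fun i => proComp (m i) (proId (y i).obj)) i)
        (cellComp (S.sumComp (D := D) m (fun i => proId (y i).obj)).hom.cell
        (cellComp (hcomp (cellId (S.sumPro (D := D) m)) (S.sumId fun i => (y i).obj).hom.cell _)
        (rightUnitorHom _)))
      rw [inclPro_sumMap, ← cellComp_assoc, inclPro_sumComp_hom, ← cellComp_assoc,
        ← hcomp_cellComp, hcomp_congr _ (cellComp_id _) (S.inclPro_sumId_hom (fun i => (y i).obj) i)]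
      refine (rightUnitorHom_naturality (S.inclPro (D := D) m i)).symm.trans ?_
      congr 1
      exact hcomp_congr _ rfl (congrArg idCell (S.right_inclPro (D := D) m i))

/-- The component of the codiagonal transformation at a proarrow. -/
noncomputable def codiagPro (I : Type) [Finite I] {z w : D} (n : Pro z w) :
    Cell (S.sumPro fun _ : I => n) n :=
  S.descPro (S.codiag I z) (S.codiag I w) (fun _ => cellId n)
    (fun i => (left_cellId n).trans (S.inj_codiag z i).symm)
    (fun i => (right_cellId n).trans (S.inj_codiag w i).symm)

lemma left_codiagPro (I : Type) [Finite I] {z w : D} (n : Pro z w) :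
    left (S.codiagPro I n) = S.codiag I z :=
  S.left_descPro _ _ _ _ _

lemma right_codiagPro (I : Type) [Finite I] {z w : D} (n : Pro z w) :
    right (S.codiagPro I n) = S.codiag I w :=
  S.right_descPro _ _ _ _ _

/-- The pseudonatural transformation `θ : 1 ⟶ Δ ∘ ⊕` is obtained from the coprojections by taking
companions: its component 1-cells are companions of the coprojections of objects, and its component
2-cells are the reshaped coprojections of proarrows. -/
def IsCompanionOfInj (θ : Pseudofunctor.StrongTrans (Pseudofunctor.id (I → Loose D))
    ((S.directSum I).comp (diagonal I (Loose D)))) : Prop :=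
  ∃ c : ∀ (x : I → Loose D) (i : I), CompanionData (S.inj (fun i => (x i).obj) i) (θ.app x i),
    ∀ (x y : I → Loose D) (m : x ⟶ y) (i : I), ((θ.naturality m).hom i).cell =
      companionSlide (c x i) (c y i) (S.inclPro (D := D) m i) (S.left_inclPro (D := D) m i)
        (S.right_inclPro (D := D) m i)

/-- The pseudonatural transformation `θ : ⊕ ∘ Δ ⟶ 1` is obtained from the codiagonals by taking
companions. -/
def IsCompanionOfCodiag (θ : Pseudofunctor.StrongTrans
    ((diagonal I (Loose D)).comp (S.directSum I)) (Pseudofunctor.id (Loose D))) : Prop :=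
  ∃ c : ∀ z : Loose D, CompanionData (S.codiag I z.obj) (θ.app z),
    ∀ (z z' : Loose D) (n : z ⟶ z'), ((θ.naturality n).hom).cell =
      companionSlide (c z) (c z') (S.codiagPro (D := D) I n) (S.left_codiagPro (D := D) I n)
        (S.right_codiagPro (D := D) I n)

/-- The pseudonatural transformation `θ : 1 ⟶ ⊕ ∘ Δ` is obtained from the codiagonals by taking
conjoints. -/
def IsConjointOfCodiag (θ : Pseudofunctor.StrongTrans (Pseudofunctor.id (Loose D))
    ((diagonal I (Loose D)).comp (S.directSum I))) : Prop :=
  ∃ c : ∀ z : Loose D, ConjointData (S.codiag I z.obj) (θ.app z),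
    ∀ (z z' : Loose D) (n : z ⟶ z'), ((θ.naturality n).inv).cell =
      conjointSlide (c z) (c z') (S.codiagPro (D := D) I n) (S.left_codiagPro (D := D) I n)
        (S.right_codiagPro (D := D) I n)

/-- The pseudonatural transformation `θ : Δ ∘ ⊕ ⟶ 1` is obtained from the coprojections by taking
conjoints. -/
def IsConjointOfInj (θ : Pseudofunctor.StrongTrans
    ((S.directSum I).comp (diagonal I (Loose D))) (Pseudofunctor.id (I → Loose D))) : Prop :=
  ∃ c : ∀ (x : I → Loose D) (i : I), ConjointData (S.inj (fun i => (x i).obj) i) (θ.app x i),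
    ∀ (x y : I → Loose D) (m : x ⟶ y) (i : I), ((θ.naturality m).inv i).cell =
      conjointSlide (c x i) (c y i) (S.inclPro (D := D) m i) (S.left_inclPro (D := D) m i)
        (S.right_inclPro (D := D) m i)

end StrongFiniteCoproducts
end DoubleCategory

/-!
Taking coproducts of families is left adjoint to the diagonal already on the level of arrows and
cells, with the coprojections and codiagonals as unit and counit, because coproducts of objects and
of proarrows have compatible universal properties. Companions turn this into a biadjunction of
underlying bicategories: a companion of a given arrow is unique up to a unique invertible 2-cell
compatible with the binding cells, so the pseudonatural transformations, the triangulators and all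
equations between them come from the triangle identities of the arrows. Companions of the
coprojections and codiagonals exist, and the reshaped cells are invertible, because the coproduct of
identity proarrows along a function is a companion of the induced arrow and coproducts of proarrows
commute with external composition. Conjoints are companions in the horizontal opposite.
-/

universe t' w' v' u' v₃ u₃ t'' w'' v'' u'' v₄ u₄

/-- A double category whose underlying bicategory is `B`: the objects of `B` lie over those of a
category `T` of arrows, the 1-cells of `B` are the proarrows, and its 2-cells are the cells between
identity arrows. Encoding double categories in this way lets the same results apply to `Loose D`,
to its powers, and to the horizontal opposites `Bᵒᵖ`, in which conjoints become companions. -/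
class DoubleStructure (B : Type u) [Bicategory.{w, v} B] (T : outParam (Type u₂))
    [Category.{v₂} T] where
  ob : B → T
  Cell {x y x' y' : B} : (x ⟶ y) → (x' ⟶ y') → Type t
  left {x y x' y' : B} {m : x ⟶ y} {n : x' ⟶ y'} : Cell m n → (ob x ⟶ ob x')
  right {x y x' y' : B} {m : x ⟶ y} {n : x' ⟶ y'} : Cell m n → (ob y ⟶ ob y')
  comp {x y x' y' x'' y'' : B} {m : x ⟶ y} {n : x' ⟶ y'} {p : x'' ⟶ y''} :
    Cell m n → Cell n p → Cell m p
  comp_assoc {x₁ y₁ x₂ y₂ x₃ y₃ x₄ y₄ : B} {m : x₁ ⟶ y₁} {n : x₂ ⟶ y₂} {p : x₃ ⟶ y₃}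
    {q : x₄ ⟶ y₄} (α : Cell m n) (β : Cell n p) (γ : Cell p q) :
    comp (comp α β) γ = comp α (comp β γ)
  left_comp {x y x' y' x'' y'' : B} {m : x ⟶ y} {n : x' ⟶ y'} {p : x'' ⟶ y''}
    (α : Cell m n) (β : Cell n p) : left (comp α β) = left α ≫ left β
  right_comp {x y x' y' x'' y'' : B} {m : x ⟶ y} {n : x' ⟶ y'} {p : x'' ⟶ y''}
    (α : Cell m n) (β : Cell n p) : right (comp α β) = right α ≫ right β
  ofHom {x y : B} {m n : x ⟶ y} : (m ⟶ n) → Cell m n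
  left_ofHom {x y : B} {m n : x ⟶ y} (θ : m ⟶ n) : left (ofHom θ) = 𝟙 (ob x)
  right_ofHom {x y : B} {m n : x ⟶ y} (θ : m ⟶ n) : right (ofHom θ) = 𝟙 (ob y)
  ofHom_comp {x y : B} {m n p : x ⟶ y} (θ : m ⟶ n) (η : n ⟶ p) :
    ofHom (θ ≫ η) = comp (ofHom θ) (ofHom η)
  ofHom_id_comp {x y x' y' : B} {m : x ⟶ y} {n : x' ⟶ y'} (α : Cell m n) :
    comp (ofHom (𝟙 m)) α = α
  comp_ofHom_id {x y x' y' : B} {m : x ⟶ y} {n : x' ⟶ y'} (α : Cell m n) :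
    comp α (ofHom (𝟙 n)) = α
  toHom {x y : B} {m n : x ⟶ y} (α : Cell m n) (hl : left α = 𝟙 (ob x))
    (hr : right α = 𝟙 (ob y)) : m ⟶ n
  ofHom_toHom {x y : B} {m n : x ⟶ y} (α : Cell m n) (hl : left α = 𝟙 (ob x))
    (hr : right α = 𝟙 (ob y)) : ofHom (toHom α hl hr) = α
  ofHom_injective {x y : B} {m n : x ⟶ y} {θ η : m ⟶ n} : ofHom θ = ofHom η → θ = η
  idCell {x y : B} (f : ob x ⟶ ob y) : Cell (𝟙 x) (𝟙 y)
  left_idCell {x y : B} (f : ob x ⟶ ob y) : left (idCell f) = f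
  right_idCell {x y : B} (f : ob x ⟶ ob y) : right (idCell f) = f
  idCell_id (x : B) : idCell (𝟙 (ob x)) = ofHom (𝟙 (𝟙 x))
  idCell_comp {x y z : B} (f : ob x ⟶ ob y) (g : ob y ⟶ ob z) :
    idCell (f ≫ g) = comp (idCell f) (idCell g)
  hcomp {x y z x' y' z' : B} {m : x ⟶ y} {n : y ⟶ z} {m' : x' ⟶ y'} {n' : y' ⟶ z'}
    (α : Cell m m') (β : Cell n n') (h : right α = left β) : Cell (m ≫ n) (m' ≫ n')
  left_hcomp {x y z x' y' z' : B} {m : x ⟶ y} {n : y ⟶ z} {m' : x' ⟶ y'} {n' : y' ⟶ z'}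
    (α : Cell m m') (β : Cell n n') (h : right α = left β) : left (hcomp α β h) = left α
  right_hcomp {x y z x' y' z' : B} {m : x ⟶ y} {n : y ⟶ z} {m' : x' ⟶ y'} {n' : y' ⟶ z'}
    (α : Cell m m') (β : Cell n n') (h : right α = left β) : right (hcomp α β h) = right β
  hcomp_comp_hcomp {x y z x' y' z' x'' y'' z'' : B} {m : x ⟶ y} {n : y ⟶ z} {m' : x' ⟶ y'}
    {n' : y' ⟶ z'} {m'' : x'' ⟶ y''} {n'' : y'' ⟶ z''}
    (α : Cell m m') (β : Cell n n') (α' : Cell m' m'') (β' : Cell n' n'')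
    (h : right α = left β) (h' : right α' = left β') :
    comp (hcomp α β h) (hcomp α' β' h') =
      hcomp (comp α α') (comp β β') (by rw [right_comp, left_comp, h, h'])
  ofHom_whiskerLeft {x y z : B} (m : x ⟶ y) {n n' : y ⟶ z} (θ : n ⟶ n') :
    ofHom (m ◁ θ) = hcomp (ofHom (𝟙 m)) (ofHom θ) (by rw [left_ofHom, right_ofHom])
  ofHom_whiskerRight {x y z : B} {m m' : x ⟶ y} (θ : m ⟶ m') (n : y ⟶ z) :
    ofHom (θ ▷ n) = hcomp (ofHom θ) (ofHom (𝟙 n)) (by rw [left_ofHom, right_ofHom])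
  associator_naturality {x y z a x' y' z' a' : B} {m : x ⟶ y} {n : y ⟶ z} {p : z ⟶ a}
    {m' : x' ⟶ y'} {n' : y' ⟶ z'} {p' : z' ⟶ a'}
    (α : Cell m m') (β : Cell n n') (γ : Cell p p') (h : right α = left β)
    (h' : right β = left γ) :
    comp (hcomp (hcomp α β h) γ ((right_hcomp α β h).trans h')) (ofHom (α_ m' n' p').hom) =
      comp (ofHom (α_ m n p).hom)
        (hcomp α (hcomp β γ h') (h.trans (left_hcomp β γ h').symm))
  leftUnitor_naturality {x y x' y' : B} {m : x ⟶ y} {m' : x' ⟶ y'} (α : Cell m m') :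
    comp (hcomp (idCell (left α)) α (right_idCell _)) (ofHom (λ_ m').hom) =
      comp (ofHom (λ_ m).hom) α
  rightUnitor_naturality {x y x' y' : B} {m : x ⟶ y} {m' : x' ⟶ y'} (α : Cell m m') :
    comp (hcomp α (idCell (right α)) (left_idCell _).symm) (ofHom (ρ_ m').hom) =
      comp (ofHom (ρ_ m).hom) α

local notation:80 α:81 " ≫ᶜ " β:80 => DoubleStructure.comp α β

namespace DoubleStructure

attribute [simp] left_comp right_comp left_ofHom right_ofHom ofHom_id_comp comp_ofHom_id
  ofHom_toHom left_idCell right_idCell left_hcomp right_hcomp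

section Calculus

variable {B : Type u} [Bicategory.{w, v} B] {T : Type u₂} [Category.{v₂} T]
  [DoubleStructure.{t} B T]

section

variable {x y x' y' z z' : B} {m : x ⟶ y} {m' : x' ⟶ y'} {n : y ⟶ z} {n' : y' ⟶ z'}

@[simp]
theorem ofHom_hom_inv_comp {a b : x ⟶ y} (e : a ≅ b) (α : Cell a m') :
    ofHom e.hom ≫ᶜ ofHom e.inv ≫ᶜ α = α := by
  rw [← comp_assoc, ← ofHom_comp, e.hom_inv_id, ofHom_id_comp]

@[simp]
theorem ofHom_inv_hom_comp {a b : x ⟶ y} (e : a ≅ b) (α : Cell b m') :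
    ofHom e.inv ≫ᶜ ofHom e.hom ≫ᶜ α = α :=
  ofHom_hom_inv_comp e.symm α

theorem hcomp_congr {α α' : Cell m m'} {β β' : Cell n n'} (hα : α = α') (hβ : β = β')
    (h : right α = left β) : hcomp α β h = hcomp α' β' (by rw [← hα, ← hβ, h]) := by
  subst hα hβ
  rfl

theorem idCell_hcomp_comp_leftUnitor {f : ob x ⟶ ob x'} (α : Cell m m') (h : left α = f) :
    hcomp (idCell f) α (by simp [h]) ≫ᶜ ofHom (λ_ m').hom = ofHom (λ_ m).hom ≫ᶜ α := by
  subst h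
  exact leftUnitor_naturality α

theorem leftUnitor_inv_comp_idCell_hcomp {f : ob x ⟶ ob x'} (α : Cell m m')
    (h : left α = f) :
    ofHom (λ_ m).inv ≫ᶜ hcomp (idCell f) α (by simp [h]) = α ≫ᶜ ofHom (λ_ m').inv := by
  rw [← comp_ofHom_id (hcomp _ _ _), ← (λ_ m').hom_inv_id, ofHom_comp, ← comp_assoc (hcomp _ _ _),
    idCell_hcomp_comp_leftUnitor α h, comp_assoc, ofHom_inv_hom_comp]

theorem hcomp_idCell_comp_rightUnitor {g : ob y ⟶ ob y'} (α : Cell m m') (h : right α = g) :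
    hcomp α (idCell g) (by simp [h]) ≫ᶜ ofHom (ρ_ m').hom = ofHom (ρ_ m).hom ≫ᶜ α := by
  subst h
  exact rightUnitor_naturality α

theorem associator_inv_naturality {a a' : B} {p : z ⟶ a} {p' : z' ⟶ a'} (α : Cell m m')
    (β : Cell n n') (γ : Cell p p') (h : right α = left β) (h' : right β = left γ) :
    ofHom (α_ m n p).inv ≫ᶜ hcomp (hcomp α β h) γ (by simp [h']) =
      hcomp α (hcomp β γ h') (by simp [h]) ≫ᶜ ofHom (α_ m' n' p').inv := by
  rw [← comp_ofHom_id (hcomp (hcomp α β h) γ _), ← (α_ m' n' p').hom_inv_id, ofHom_comp,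
    ← comp_assoc (hcomp _ _ _), associator_naturality, comp_assoc, ofHom_inv_hom_comp]

theorem ofHom_whiskerLeft_comp_hcomp {k : y ⟶ z} (θ : k ⟶ n) (α : Cell m m') (β : Cell n n')
    (h : right α = left β) :
    ofHom (m ◁ θ) ≫ᶜ hcomp α β h = hcomp α (ofHom θ ≫ᶜ β) (by simp [h]) := by
  rw [ofHom_whiskerLeft, hcomp_comp_hcomp]
  exact hcomp_congr (by simp) rfl _

theorem ofHom_whiskerRight_comp_hcomp {k : x ⟶ y} (θ : k ⟶ m) (α : Cell m m') (β : Cell n n')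
    (h : right α = left β) :
    ofHom (θ ▷ n) ≫ᶜ hcomp α β h = hcomp (ofHom θ ≫ᶜ α) β (by simp [h]) := by
  rw [ofHom_whiskerRight, hcomp_comp_hcomp]
  exact hcomp_congr rfl (by simp) _

theorem hcomp_comp_ofHom_whiskerLeft {k : y' ⟶ z'} (θ : n' ⟶ k) (α : Cell m m') (β : Cell n n')
    (h : right α = left β) :
    hcomp α β h ≫ᶜ ofHom (m' ◁ θ) = hcomp α (β ≫ᶜ ofHom θ) (by simp [h]) := by
  rw [ofHom_whiskerLeft, hcomp_comp_hcomp]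
  exact hcomp_congr (by simp) rfl _

theorem hcomp_comp_ofHom_whiskerRight {k : x' ⟶ y'} (θ : m' ⟶ k) (α : Cell m m')
    (β : Cell n n') (h : right α = left β) :
    hcomp α β h ≫ᶜ ofHom (θ ▷ n') = hcomp (α ≫ᶜ ofHom θ) β (by simp [h]) := by
  rw [ofHom_whiskerRight, hcomp_comp_hcomp]
  exact hcomp_congr rfl (by simp) _

end

end Calculus

end DoubleStructure

namespace DoubleStructure

section Companions

variable {B : Type u} [Bicategory.{w, v} B] {T : Type u₂} [Category.{v₂} T]
  [DoubleStructure.{t} B T]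

/-- A companion of the arrow `f`: a 1-cell `p` in the direction of `f` with binding cells exhibiting
it as the proarrow version of `f`. -/
structure Companion {x y : B} (f : ob x ⟶ ob y) (p : x ⟶ y) where
  unit : Cell (𝟙 x) p
  counit : Cell p (𝟙 y)
  left_unit : left unit = 𝟙 (ob x)
  right_unit : right unit = f
  left_counit : left counit = f
  right_counit : right counit = 𝟙 (ob y)
  unit_counit : unit ≫ᶜ counit = idCell f
  unit_hcomp_counit :
    ofHom (λ_ p).inv ≫ᶜ hcomp unit counit (right_unit.trans left_counit.symm) ≫ᶜ
      ofHom (ρ_ p).hom = ofHom (𝟙 p)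

namespace Companion

attribute [simp] left_unit right_unit left_counit right_counit unit_counit

section LeftReduce

variable {x y z : B} {f : ob x ⟶ ob y} {p : x ⟶ y} (c : Companion f p)

/-- The cell `p ≫ n ⟶ n` erasing a companion on the left. It exhibits `p ≫ n` as the restriction of
`n` along `f`. -/
def leftReduce (n : y ⟶ z) : Cell (p ≫ n) n :=
  hcomp c.counit (ofHom (𝟙 n)) (by simp) ≫ᶜ ofHom (λ_ n).hom

@[simp]
theorem left_leftReduce (n : y ⟶ z) : left (c.leftReduce n) = f := by simp [leftReduce]

@[simp]
theorem right_leftReduce (n : y ⟶ z) : right (c.leftReduce n) = 𝟙 (ob z) := by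
  simp [leftReduce]

theorem id_hcomp_leftReduce {z' : B} {n : y ⟶ z} {n' : y ⟶ z'} (β : Cell n n')
    (hβ : left β = 𝟙 (ob y)) :
    hcomp (ofHom (𝟙 p)) β (by simp [hβ]) ≫ᶜ c.leftReduce n' = c.leftReduce n ≫ᶜ β := by
  rw [leftReduce, leftReduce, comp_assoc, ← idCell_hcomp_comp_leftUnitor β hβ, ← comp_assoc,
    ← comp_assoc, hcomp_comp_hcomp, hcomp_comp_hcomp]
  exact congrArg (· ≫ᶜ _) (hcomp_congr
    (by rw [ofHom_id_comp, idCell_id, comp_ofHom_id]) (by simp) _)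

theorem whiskerLeft_leftReduce {n n' : y ⟶ z} (θ : n ⟶ n') :
    ofHom (p ◁ θ) ≫ᶜ c.leftReduce n' = c.leftReduce n ≫ᶜ ofHom θ := by
  rw [ofHom_whiskerLeft, id_hcomp_leftReduce _ _ (left_ofHom θ)]

theorem leftReduce_comp {a : B} (n : y ⟶ z) (n' : z ⟶ a) :
    ofHom (α_ p n n').hom ≫ᶜ c.leftReduce (n ≫ n') =
      hcomp (c.leftReduce n) (ofHom (𝟙 n')) (by simp) := by
  rw [leftReduce, hcomp_congr rfl ((congrArg ofHom (id_whiskerRight n n')).symm.trans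
    (ofHom_whiskerRight _ _)), ← comp_assoc, ← associator_naturality, comp_assoc, ← ofHom_comp,
    leftUnitor_comp, Iso.hom_inv_id_assoc, hcomp_comp_ofHom_whiskerRight]
  rfl

theorem leftReduce_id : c.leftReduce (𝟙 y) = ofHom (ρ_ p).hom ≫ᶜ c.counit := by
  rw [← hcomp_idCell_comp_rightUnitor c.counit c.right_counit, leftReduce, unitors_equal]
  exact congrArg (· ≫ᶜ _) (hcomp_congr rfl (idCell_id y).symm _)

theorem whiskerRight_leftReduce {f' : ob x ⟶ ob y} {p' : x ⟶ y} (c' : Companion f' p')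
    {κ : p' ⟶ p} (hκ : ofHom κ ≫ᶜ c.counit = c'.counit) (n : y ⟶ z) :
    ofHom (κ ▷ n) ≫ᶜ c.leftReduce n = c'.leftReduce n := by
  rw [leftReduce, ← comp_assoc, ofHom_whiskerRight_comp_hcomp, hcomp_congr hκ rfl]
  rfl

/-- The 2-cell `k ⟶ p ≫ n` factoring a cell over `f` through the restriction `p ≫ n`. -/
def lift {k : x ⟶ z} {n : y ⟶ z} (β : Cell k n) (hl : left β = f) (hr : right β = 𝟙 (ob z)) :
    k ⟶ p ≫ n :=
  toHom (ofHom (λ_ k).inv ≫ᶜ hcomp c.unit β (by simp [hl])) (by simp) (by simp [hr])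

theorem lift_leftReduce {k : x ⟶ z} {n : y ⟶ z} (β : Cell k n) (hl : left β = f)
    (hr : right β = 𝟙 (ob z)) : ofHom (c.lift β hl hr) ≫ᶜ c.leftReduce n = β := by
  rw [lift, ofHom_toHom, leftReduce, comp_assoc, ← comp_assoc (hcomp _ _ _), hcomp_comp_hcomp,
    hcomp_congr c.unit_counit (comp_ofHom_id β), idCell_hcomp_comp_leftUnitor β hl,
    ofHom_inv_hom_comp]

theorem unit_hcomp_leftReduce (n : y ⟶ z) :
    ofHom (λ_ (p ≫ n)).inv ≫ᶜ hcomp c.unit (c.leftReduce n) (by simp) =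
      ofHom (𝟙 (p ≫ n)) := by
  have unitors : ofHom (λ_ (p ≫ n)).inv =
      ofHom ((λ_ p).inv ▷ n) ≫ᶜ ofHom (α_ (𝟙 x) p n).hom := by
    rw [← ofHom_comp, leftUnitor_comp_inv]
  simp only [leftReduce]
  rw [← hcomp_comp_ofHom_whiskerLeft, unitors, comp_assoc,
    ← comp_assoc (ofHom (α_ (𝟙 x) p n).hom), ← associator_naturality, comp_assoc, ← ofHom_comp,
    triangle, hcomp_comp_ofHom_whiskerRight, ofHom_whiskerRight_comp_hcomp,
    hcomp_congr c.unit_hcomp_counit rfl, ← ofHom_whiskerRight, id_whiskerRight]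
  all_goals simp

theorem cell_ext {v z' : B} {k : v ⟶ z'} {n : y ⟶ z} {γ γ' : Cell k (p ≫ n)}
    (hl : left γ = left γ') (h : γ ≫ᶜ c.leftReduce n = γ' ≫ᶜ c.leftReduce n) : γ = γ' := by
  have recover (δ : Cell k (p ≫ n)) (hδ : left δ = left γ) : δ = ofHom (λ_ k).inv ≫ᶜ
      hcomp (idCell (left γ) ≫ᶜ c.unit) (δ ≫ᶜ c.leftReduce n) (by simp [hδ]) := by
    rw [← hcomp_comp_hcomp _ _ _ _ (by simp [hδ]) (by simp), ← comp_assoc,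
      leftUnitor_inv_comp_idCell_hcomp δ hδ, comp_assoc, unit_hcomp_leftReduce, comp_ofHom_id]
  rw [recover γ rfl, recover γ' hl.symm, hcomp_congr rfl h]

theorem hom_ext {k : x ⟶ z} {n : y ⟶ z} {θ θ' : k ⟶ p ≫ n}
    (h : ofHom θ ≫ᶜ c.leftReduce n = ofHom θ' ≫ᶜ c.leftReduce n) : θ = θ' :=
  ofHom_injective (c.cell_ext (by simp) h)

theorem cell_ext_counit {v z' : B} {k : v ⟶ z'} {γ γ' : Cell k p} (hl : left γ = left γ')
    (h : γ ≫ᶜ c.counit = γ' ≫ᶜ c.counit) : γ = γ' := by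
  have h' : γ ≫ᶜ ofHom (ρ_ p).inv = γ' ≫ᶜ ofHom (ρ_ p).inv := by
    apply c.cell_ext (by simp [hl])
    simpa only [leftReduce_id, comp_assoc, ofHom_inv_hom_comp] using h
  simpa only [comp_assoc, ← ofHom_comp, Iso.inv_hom_id, comp_ofHom_id] using
    congrArg (· ≫ᶜ ofHom (ρ_ p).hom) h'

theorem hom_ext_counit {k : x ⟶ y} {θ θ' : k ⟶ p}
    (h : ofHom θ ≫ᶜ c.counit = ofHom θ' ≫ᶜ c.counit) : θ = θ' :=
  ofHom_injective (c.cell_ext_counit (by simp) h)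

end LeftReduce

section RightReduce

variable {x y w w' : B} {f : ob x ⟶ ob y} {p : x ⟶ y} (c : Companion f p) {m : w ⟶ x}
  {n : w' ⟶ y}

/-- The cell `m ≫ p ⟶ n` obtained from a cell `α : m ⟶ n` with right boundary `f` by erasing the
companion of `f`. -/
def rightReduce (α : Cell m n) (hα : right α = f) : Cell (m ≫ p) n :=
  hcomp α c.counit (by simp [hα]) ≫ᶜ ofHom (ρ_ n).hom

@[simp]
theorem left_rightReduce (α : Cell m n) (hα : right α = f) :
    left (c.rightReduce α hα) = left α := by
  simp [rightReduce]

@[simp]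
theorem right_rightReduce (α : Cell m n) (hα : right α = f) :
    right (c.rightReduce α hα) = 𝟙 (ob y) := by
  simp [rightReduce]

theorem whiskerRight_rightReduce {k : w ⟶ x} (θ : k ⟶ m) (α : Cell m n) (hα : right α = f) :
    ofHom (θ ▷ p) ≫ᶜ c.rightReduce α hα = c.rightReduce (ofHom θ ≫ᶜ α) (by simp [hα]) := by
  rw [rightReduce, ← comp_assoc, ofHom_whiskerRight_comp_hcomp]
  rfl

theorem rightReduce_comp {v' : B} {k : v' ⟶ y} (α : Cell m n) (hα : right α = f)
    (β : Cell n k) (hβ : right β = 𝟙 (ob y)) :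
    c.rightReduce (α ≫ᶜ β) (by simp [hα, hβ]) = c.rightReduce α hα ≫ᶜ β := by
  rw [rightReduce, rightReduce, comp_assoc, ← hcomp_idCell_comp_rightUnitor β hβ, ← comp_assoc,
    hcomp_comp_hcomp]
  exact congrArg (· ≫ᶜ _) (hcomp_congr rfl (by rw [idCell_id, comp_ofHom_id]) _)

theorem whiskerLeft_rightReduce {f' : ob x ⟶ ob y} {p' : x ⟶ y} (c' : Companion f' p')
    {κ : p' ⟶ p} (hκ : ofHom κ ≫ᶜ c.counit = c'.counit) (α : Cell m n) (hα : right α = f)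
    (hα' : right α = f') :
    ofHom (m ◁ κ) ≫ᶜ c.rightReduce α hα = c'.rightReduce α hα' := by
  rw [rightReduce, ← comp_assoc, ofHom_whiskerLeft_comp_hcomp, hcomp_congr rfl hκ]
  rfl

theorem rightReduce_hcomp {v v' : B} {k : v ⟶ w} {k' : v' ⟶ w'} (β : Cell k k')
    (α : Cell m n) (h : right β = left α) (hα : right α = f) :
    ofHom (α_ k m p).inv ≫ᶜ c.rightReduce (hcomp β α h) (by simp [hα]) =
      hcomp β (c.rightReduce α hα) (by simp [h]) := by
  simp only [rightReduce]
  rw [← comp_assoc, associator_inv_naturality _ _ _ h (by simp [hα]), comp_assoc,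
    ← ofHom_comp, ← hcomp_comp_ofHom_whiskerLeft, rightUnitor_comp, Iso.inv_hom_id_assoc]

theorem hcomp_leftReduce {z : B} (α : Cell m n) (hα : right α = f) (k : y ⟶ z) :
    ofHom (α_ m p k).hom ≫ᶜ hcomp α (c.leftReduce k) (by simp [hα]) =
      hcomp (c.rightReduce α hα) (ofHom (𝟙 k)) (by simp) := by
  simp only [leftReduce, rightReduce]
  rw [← hcomp_comp_ofHom_whiskerLeft _ _ _ (by simp [hα]), ← comp_assoc,
    ← associator_naturality, comp_assoc, ← ofHom_comp, triangle, hcomp_comp_ofHom_whiskerRight]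

end RightReduce

section Slide

variable {x y x' y' : B} {f : ob x ⟶ ob x'} {g : ob y ⟶ ob y'} {p : x ⟶ x'} {q : y ⟶ y'}
  (c : Companion f p) (d : Companion g q) {m : x ⟶ y} {n : x' ⟶ y'}

/-- The 2-cell `m ≫ q ⟶ p ≫ n` into which companions of its boundary arrows reshape a cell
`m ⟶ n`. -/
def slide (α : Cell m n) (hl : left α = f) (hr : right α = g) : m ≫ q ⟶ p ≫ n :=
  c.lift (d.rightReduce α hr) (by simp [hl]) (by simp)

variable (α : Cell m n) (hl : left α = f) (hr : right α = g)

theorem slide_leftReduce : ofHom (c.slide d α hl hr) ≫ᶜ c.leftReduce n = d.rightReduce α hr :=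
  c.lift_leftReduce _ _ _

theorem eq_slide {θ : m ≫ q ⟶ p ≫ n} (h : ofHom θ ≫ᶜ c.leftReduce n = d.rightReduce α hr) :
    θ = c.slide d α hl hr :=
  c.hom_ext (h.trans (c.slide_leftReduce d α hl hr).symm)

theorem ofHom_slide : ofHom (c.slide d α hl hr) =
    ofHom ((λ_ m).inv ▷ q) ≫ᶜ hcomp (hcomp c.unit α (by simp [hl])) d.counit (by simp [hr]) ≫ᶜ
      ofHom (ρ_ (p ≫ n)).hom := by
  have unitor : ofHom (ρ_ (p ≫ n)).hom = ofHom (α_ p n (𝟙 y')).hom ≫ᶜ ofHom (p ◁ (ρ_ n).hom) := by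
    rw [← ofHom_comp, rightUnitor_comp]
  have unitor_inv : ofHom (λ_ (m ≫ q)).inv =
      ofHom ((λ_ m).inv ▷ q) ≫ᶜ ofHom (α_ (𝟙 x) m q).hom := by
    rw [← ofHom_comp, leftUnitor_comp_inv]
  rw [slide, lift, ofHom_toHom, unitor_inv, unitor, ← comp_assoc (hcomp (hcomp _ _ _) _ _),
    associator_naturality _ _ _ (by simp [hl]) (by simp [hr]), comp_assoc, comp_assoc,
    hcomp_comp_ofHom_whiskerLeft]
  rfl

theorem whiskerRight_slide {k : x ⟶ y} (θ : k ⟶ m) :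
    θ ▷ q ≫ c.slide d α hl hr = c.slide d (ofHom θ ≫ᶜ α) (by simp [hl]) (by simp [hr]) := by
  apply eq_slide
  rw [ofHom_comp, comp_assoc, slide_leftReduce, whiskerRight_rightReduce]

theorem slide_whiskerLeft {k : x' ⟶ y'} (θ : n ⟶ k) :
    c.slide d α hl hr ≫ p ◁ θ = c.slide d (α ≫ᶜ ofHom θ) (by simp [hl]) (by simp [hr]) := by
  apply eq_slide
  rw [ofHom_comp, comp_assoc, whiskerLeft_leftReduce, ← comp_assoc, slide_leftReduce,
    rightReduce_comp _ _ hr _ (right_ofHom θ)]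

theorem whiskerLeft_slide {g' : ob y ⟶ ob y'} {q' : y ⟶ y'} (d' : Companion g' q') {κ : q' ⟶ q}
    (hκ : ofHom κ ≫ᶜ d.counit = d'.counit) (hr' : right α = g') :
    m ◁ κ ≫ c.slide d α hl hr = c.slide d' α hl hr' := by
  apply eq_slide
  rw [ofHom_comp, comp_assoc, slide_leftReduce, d.whiskerLeft_rightReduce d' hκ]

theorem slide_whiskerRight {f' : ob x ⟶ ob x'} {p' : x ⟶ x'} (c' : Companion f' p') {κ : p ⟶ p'}
    (hκ : ofHom κ ≫ᶜ c'.counit = c.counit) (hl' : left α = f') :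
    c.slide d α hl hr ≫ κ ▷ n = c'.slide d α hl' hr := by
  apply eq_slide
  rw [ofHom_comp, comp_assoc, c'.whiskerRight_leftReduce c hκ, slide_leftReduce]

theorem slide_idCell : c.slide c (idCell f) (by simp) (by simp) = (λ_ p).hom ≫ (ρ_ p).inv := by
  symm
  apply eq_slide
  rw [ofHom_comp, comp_assoc, leftReduce_id, ofHom_inv_hom_comp,
    ← idCell_hcomp_comp_leftUnitor c.counit c.left_counit, unitors_equal]
  rfl

theorem slide_hcomp {z z' : B} {h : ob z ⟶ ob z'} {r : z ⟶ z'} (e : Companion h r) {m' : y ⟶ z}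
    {n' : y' ⟶ z'} (β : Cell m' n') (hl' : left β = g) (hr' : right β = h) :
    c.slide e (hcomp α β (hr.trans hl'.symm)) (by simp [hl]) (by simp [hr']) =
      (α_ m m' r).hom ≫ m ◁ d.slide e β hl' hr' ≫ (α_ m q n').inv ≫ c.slide d α hl hr ▷ n' ≫
        (α_ p n n').hom := by
  symm
  apply eq_slide
  simp only [ofHom_comp, comp_assoc]
  rw [leftReduce_comp, ofHom_whiskerRight_comp_hcomp, hcomp_congr (c.slide_leftReduce ..) rfl,
    ← d.hcomp_leftReduce α hr, ofHom_inv_hom_comp,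
    ofHom_whiskerLeft_comp_hcomp, hcomp_congr rfl (d.slide_leftReduce ..),
    ← rightReduce_hcomp _ _ _ (by simp [hr, hl']), ofHom_hom_inv_comp]

end Slide

end Companion

end Companions

end DoubleStructure

namespace DoubleStructure

namespace Companion

variable {B : Type u} [Bicategory.{w, v} B] {T : Type u₂} [Category.{v₂} T]
  [DoubleStructure.{t} B T]

/-- A companion, from binding cells of which only the first binding identity is known: the second
one is automatic when 2-cells into `p` are determined by their composites with the counit. -/
def ofCancel {x y : B} {f : ob x ⟶ ob y} {p : x ⟶ y} (unit : Cell (𝟙 x) p)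
    (counit : Cell p (𝟙 y)) (left_unit : left unit = 𝟙 (ob x)) (right_unit : right unit = f)
    (left_counit : left counit = f) (right_counit : right counit = 𝟙 (ob y))
    (unit_counit : unit ≫ᶜ counit = idCell f)
    (cancel : ∀ θ : p ⟶ p, ofHom θ ≫ᶜ counit = counit → θ = 𝟙 p) : Companion f p where
  unit := unit
  counit := counit
  left_unit := left_unit
  right_unit := right_unit
  left_counit := left_counit
  right_counit := right_counit
  unit_counit := unit_counit
  unit_hcomp_counit := by
    have h : right unit = left counit := right_unit.trans left_counit.symm
    rw [← ofHom_toHom (ofHom (λ_ p).inv ≫ᶜ hcomp unit counit h ≫ᶜ ofHom (ρ_ p).hom)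
      (by simp [left_unit]) (by simp [right_counit])]
    congr 1
    apply cancel
    rw [ofHom_toHom, comp_assoc, comp_assoc,
      ← hcomp_idCell_comp_rightUnitor counit right_counit, ← comp_assoc (hcomp _ _ _),
      hcomp_comp_hcomp, hcomp_congr unit_counit (by rw [idCell_id, comp_ofHom_id]),
      ← unitors_equal, idCell_hcomp_comp_leftUnitor counit left_counit, ofHom_inv_hom_comp]

/-- The identity 1-cell as a companion of the identity arrow. -/
def id (x : B) : Companion (𝟙 (ob x)) (𝟙 x) :=
  ofCancel (ofHom (𝟙 (𝟙 x))) (ofHom (𝟙 (𝟙 x))) (by simp) (by simp) (by simp) (by simp)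
    (by rw [ofHom_id_comp, idCell_id])
    fun θ h => ofHom_injective (by rwa [comp_ofHom_id] at h)

@[simp]
theorem id_counit (x : B) : (id x).counit = ofHom (𝟙 (𝟙 x)) := rfl

theorem id_leftReduce {x y : B} (n : x ⟶ y) : (id x).leftReduce n = ofHom (λ_ n).hom := by
  rw [leftReduce, hcomp_congr (id_counit x) rfl, ← ofHom_whiskerRight, ← ofHom_comp,
    id_whiskerRight, Category.id_comp]

theorem id_rightReduce {w x y : B} {m : w ⟶ x} {n : y ⟶ x} (α : Cell m n)
    (hα : right α = 𝟙 (ob x)) : (id x).rightReduce α hα = ofHom (ρ_ m).hom ≫ᶜ α := by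
  rw [rightReduce, ← hcomp_idCell_comp_rightUnitor α hα]
  exact congrArg (· ≫ᶜ _) (hcomp_congr rfl (idCell_id x).symm _)

theorem id_slide_id {x y : B} {m n : x ⟶ y} (θ : m ⟶ n) :
    (id x).slide (id y) (ofHom θ) (by simp) (by simp) = (ρ_ m).hom ≫ θ ≫ (λ_ n).inv := by
  symm
  apply eq_slide
  rw [id_rightReduce, id_leftReduce, ← ofHom_comp, ← ofHom_comp, Category.assoc, Category.assoc,
    Iso.inv_hom_id, Category.comp_id]

section Comp

variable {x y z : B} {f : ob x ⟶ ob y} {f' : ob y ⟶ ob z} {p : x ⟶ y} {p' : y ⟶ z}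
  (c : Companion f p) (c' : Companion f' p')

/-- The composite of two companions is a companion of the composite arrow. -/
def comp : Companion (f ≫ f') (p ≫ p') :=
  ofCancel (c.unit ≫ᶜ ofHom (ρ_ p).inv ≫ᶜ hcomp (ofHom (𝟙 p)) c'.unit (by simp))
    (c.leftReduce p' ≫ᶜ c'.counit) (by simp) (by simp) (by simp) (by simp)
    (by
      rw [comp_assoc, comp_assoc, ← comp_assoc (hcomp _ _ _),
        id_hcomp_leftReduce _ _ c'.left_unit, leftReduce_id, comp_assoc,
        comp_assoc (ofHom (ρ_ p).hom), ofHom_inv_hom_comp,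
        c'.unit_counit, ← comp_assoc, c.unit_counit, idCell_comp])
    fun θ h => c.hom_ext <| c'.cell_ext_counit (by simp) <| by
      rw [comp_assoc, h, ofHom_id_comp]

theorem comp_counit : (c.comp c').counit = c.leftReduce p' ≫ᶜ c'.counit := rfl

theorem comp_leftReduce {a : B} (n : z ⟶ a) :
    (c.comp c').leftReduce n =
      ofHom (α_ p p' n).hom ≫ᶜ c.leftReduce (p' ≫ n) ≫ᶜ c'.leftReduce n := by
  rw [← comp_assoc, leftReduce_comp]
  change _ = hcomp _ _ _ ≫ᶜ hcomp _ _ _ ≫ᶜ _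
  rw [← comp_assoc, hcomp_comp_hcomp,
    ← hcomp_congr (comp_counit c c') (ofHom_id_comp (ofHom (𝟙 n))).symm]
  rfl

theorem comp_rightReduce {w w' w'' : B} {m : w ⟶ x} {n : w' ⟶ y} {k : w'' ⟶ z} (α : Cell m n)
    (hα : right α = f) (β : Cell n k) (hβ : right β = f') :
    (c.comp c').rightReduce (α ≫ᶜ β) (by simp [hα, hβ]) =
      ofHom (α_ m p p').inv ≫ᶜ hcomp (c.rightReduce α hα) (ofHom (𝟙 p')) (by simp) ≫ᶜ
        c'.rightReduce β hβ := by
  rw [← hcomp_leftReduce _ _ hα, comp_assoc, ofHom_inv_hom_comp, rightReduce, rightReduce,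
    ← comp_assoc, hcomp_comp_hcomp, hcomp_congr rfl (comp_counit c c')]

theorem comp_slide_comp {x' y' z' : B} {g : ob x' ⟶ ob y'} {g' : ob y' ⟶ ob z'} {q : x' ⟶ y'}
    {q' : y' ⟶ z'} (d : Companion g q) (d' : Companion g' q') {m : x ⟶ x'} {n : y ⟶ y'}
    {k : z ⟶ z'} (α : Cell m n) (hl : left α = f) (hr : right α = g) (β : Cell n k)
    (hl' : left β = f') (hr' : right β = g') :
    (c.comp c').slide (d.comp d') (α ≫ᶜ β) (by simp [hl, hl']) (by simp [hr, hr']) =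
      (α_ m q q').inv ≫ c.slide d α hl hr ▷ q' ≫ (α_ p n q').hom ≫ p ◁ c'.slide d' β hl' hr' ≫
        (α_ p p' k).inv := by
  symm
  apply eq_slide
  simp only [ofHom_comp, comp_assoc]
  rw [comp_leftReduce, ofHom_inv_hom_comp, ← comp_assoc (ofHom (p ◁ _)), whiskerLeft_leftReduce,
    comp_assoc, slide_leftReduce, ← comp_assoc (ofHom (α_ p n q').hom), leftReduce_comp,
    ← comp_assoc (ofHom (_ ▷ q')), ofHom_whiskerRight_comp_hcomp,
    hcomp_congr (c.slide_leftReduce ..) rfl, comp_rightReduce]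

end Comp

end Companion

end DoubleStructure

namespace DoubleStructure

namespace Companion

variable {B : Type u} [Bicategory.{w, v} B] {T : Type u₂} [Category.{v₂} T]
  [DoubleStructure.{t} B T]

/-- Compatibility with the counits of a 2-cell between companions. All coherence 2-cells between
companions of the same arrow have this property, and it determines them. -/
def Compatible {x y : B} {f f' : ob x ⟶ ob y} {p p' : x ⟶ y} (c : Companion f p)
    (c' : Companion f' p') (θ : p ⟶ p') : Prop :=
  ofHom θ ≫ᶜ c'.counit = c.counit

variable {x y z z' : B} {f f' f'' : ob x ⟶ ob y} {p p' p'' : x ⟶ y} {c : Companion f p}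
  {c' : Companion f' p'} {c'' : Companion f'' p''} {g g' : ob y ⟶ ob z} {q q' : y ⟶ z}
  {d : Companion g q} {d' : Companion g' q'}

theorem Compatible.eq_id {θ : p ⟶ p} (h : c.Compatible c θ) : θ = 𝟙 p :=
  c.hom_ext_counit (h.trans (ofHom_id_comp _).symm)

theorem Compatible.trans {θ : p ⟶ p'} {θ' : p' ⟶ p''} (h : c.Compatible c' θ)
    (h' : c'.Compatible c'' θ') : c.Compatible c'' (θ ≫ θ') := by
  rw [Compatible, ofHom_comp, comp_assoc, h', h]

theorem Compatible.inv {e : p ≅ p'} (h : c.Compatible c' e.hom) : c'.Compatible c e.inv := by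
  rw [Compatible, ← h, ofHom_inv_hom_comp]

theorem Compatible.whiskerLeft (c : Companion f p) {θ : q ⟶ q'} (h : d.Compatible d' θ) :
    (c.comp d).Compatible (c.comp d') (p ◁ θ) := by
  rw [Compatible, comp_counit, comp_counit, ← comp_assoc, whiskerLeft_leftReduce, comp_assoc, h]

theorem Compatible.whiskerRight {θ : p ⟶ p'} (h : c.Compatible c' θ) (d : Companion g q) :
    (c.comp d).Compatible (c'.comp d) (θ ▷ q) := by
  rw [Compatible, comp_counit, comp_counit, ← comp_assoc, c'.whiskerRight_leftReduce c h]

theorem compatible_associator {k : ob z ⟶ ob z'} {r : z ⟶ z'} (c : Companion f p)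
    (d : Companion g q) (e : Companion k r) :
    ((c.comp d).comp e).Compatible (c.comp (d.comp e)) (α_ p q r).hom := by
  rw [Compatible, comp_counit, comp_counit, comp_counit, comp_leftReduce, comp_assoc, comp_assoc]

theorem compatible_leftUnitor (c : Companion f p) :
    ((id x).comp c).Compatible c (λ_ p).hom := by
  rw [Compatible, comp_counit, id_leftReduce]

theorem compatible_rightUnitor (c : Companion f p) :
    (c.comp (id y)).Compatible c (ρ_ p).hom := by
  rw [Compatible, comp_counit, leftReduce_id, id_counit, comp_ofHom_id]

theorem compatible_slide {x' y' : B} {a : ob x ⟶ ob x'} {r : x ⟶ x'} {b : ob y ⟶ ob y'}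
    {s : y ⟶ y'} {g : ob x' ⟶ ob y'} {q : x' ⟶ y'} (c : Companion f p) (d : Companion g q)
    (l : Companion a r) (k : Companion b s) {α : Cell p q} (hl : left α = a) (hr : right α = b)
    (h : α ≫ᶜ d.counit = c.counit ≫ᶜ idCell b) :
    (c.comp k).Compatible (l.comp d) (l.slide k α hl hr) := by
  rw [Compatible, comp_counit, comp_counit, ← comp_assoc, slide_leftReduce,
    ← rightReduce_comp _ _ hr _ d.right_counit, rightReduce, hcomp_congr h rfl, leftReduce,
    comp_assoc, ← idCell_hcomp_comp_leftUnitor _ k.left_counit, ← comp_assoc, hcomp_comp_hcomp,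
    hcomp_congr rfl (ofHom_id_comp k.counit), unitors_equal]

/-- The comparison 2-cell between companions of equal arrows. -/
def homOfEq (c : Companion f p) (c' : Companion f' p') (h : f = f') : p ⟶ p' :=
  c'.lift c.counit (by simp [h]) (by simp) ≫ (ρ_ p').hom

theorem compatible_homOfEq (c : Companion f p) (c' : Companion f' p') (h : f = f') :
    c.Compatible c' (c.homOfEq c' h) := by
  rw [Compatible, homOfEq, ofHom_comp, comp_assoc, ← leftReduce_id, lift_leftReduce]

/-- Companions of equal arrows are isomorphic. -/
def isoOfEq (c : Companion f p) (c' : Companion f' p') (h : f = f') : p ≅ p' where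
  hom := c.homOfEq c' h
  inv := c'.homOfEq c h.symm
  hom_inv_id := ((c.compatible_homOfEq c' h).trans (c'.compatible_homOfEq c h.symm)).eq_id
  inv_hom_id := ((c'.compatible_homOfEq c h.symm).trans (c.compatible_homOfEq c' h)).eq_id

theorem compatible_isoOfEq (c : Companion f p) (c' : Companion f' p') (h : f = f') :
    c.Compatible c' (c.isoOfEq c' h).hom :=
  c.compatible_homOfEq c' h

end Companion

end DoubleStructure

namespace DoubleStructure

/-- An extension of a pseudofunctor between underlying bicategories to a pseudo double functor: an
action on arrows and cells which is compatible with all structure. -/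
class DoubleFunctor {B : Type u} [Bicategory.{w, v} B] {T : outParam (Type u₂)} [Category.{v₂} T]
    [DoubleStructure.{t} B T] {C : Type u'} [Bicategory.{w', v'} C] {U : outParam (Type u₃)}
    [Category.{v₃} U] [DoubleStructure.{t'} C U] (F : Pseudofunctor B C) where
  mapArrow (F) {x y : B} (f : ob x ⟶ ob y) : ob (F.obj x) ⟶ ob (F.obj y)
  mapCell (F) {x y x' y' : B} {m : x ⟶ y} {n : x' ⟶ y'} (α : Cell m n) :
    Cell (F.map m) (F.map n)
  mapArrow_id (F) (x : B) : mapArrow (𝟙 (ob x)) = 𝟙 (ob (F.obj x))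
  mapArrow_comp (F) {x y z : B} (f : ob x ⟶ ob y) (g : ob y ⟶ ob z) :
    mapArrow (f ≫ g) = mapArrow f ≫ mapArrow g
  left_mapCell (F) {x y x' y' : B} {m : x ⟶ y} {n : x' ⟶ y'} (α : Cell m n) :
    left (mapCell α) = mapArrow (left α)
  right_mapCell (F) {x y x' y' : B} {m : x ⟶ y} {n : x' ⟶ y'} (α : Cell m n) :
    right (mapCell α) = mapArrow (right α)
  mapCell_ofHom (F) {x y : B} {m n : x ⟶ y} (θ : m ⟶ n) : mapCell (ofHom θ) = ofHom (F.map₂ θ)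
  mapCell_comp (F) {x y x' y' x'' y'' : B} {m : x ⟶ y} {n : x' ⟶ y'} {p : x'' ⟶ y''}
    (α : Cell m n) (β : Cell n p) : mapCell (α ≫ᶜ β) = mapCell α ≫ᶜ mapCell β
  mapCell_idCell (F) {x y : B} (f : ob x ⟶ ob y) :
    mapCell (idCell f) ≫ᶜ ofHom (F.mapId y).hom = ofHom (F.mapId x).hom ≫ᶜ idCell (mapArrow f)
  mapCell_hcomp (F) {x y z x' y' z' : B} {m : x ⟶ y} {n : y ⟶ z} {m' : x' ⟶ y'} {n' : y' ⟶ z'}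
    (α : Cell m m') (β : Cell n n') (h : right α = left β) :
    mapCell (hcomp α β h) ≫ᶜ ofHom (F.mapComp m' n').hom = ofHom (F.mapComp m n).hom ≫ᶜ
      hcomp (mapCell α) (mapCell β) (by rw [left_mapCell, right_mapCell, h])

open DoubleFunctor

attribute [simp] mapArrow_id mapArrow_comp left_mapCell right_mapCell

namespace Companion

variable {B : Type u} [Bicategory.{w, v} B] {T : Type u₂} [Category.{v₂} T]
  [DoubleStructure.{t} B T] {C : Type u'} [Bicategory.{w', v'} C] {U : Type u₃}
  [Category.{v₃} U] [DoubleStructure.{t'} C U] (F : Pseudofunctor B C) [DoubleFunctor F]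

section

variable {x y : B} {f : ob x ⟶ ob y} {p : x ⟶ y} (c : Companion f p)

/-- The image of a companion under a double functor. -/
def map : Companion (mapArrow F f) (F.map p) where
  unit := ofHom (F.mapId x).inv ≫ᶜ mapCell F c.unit
  counit := mapCell F c.counit ≫ᶜ ofHom (F.mapId y).hom
  left_unit := by simp
  right_unit := by simp
  left_counit := by simp
  right_counit := by simp
  unit_counit := by
    rw [comp_assoc, ← comp_assoc (mapCell F c.unit), ← mapCell_comp F, c.unit_counit,
      mapCell_idCell, ofHom_inv_hom_comp]
  unit_hcomp_counit := by
    have image := congrArg (mapCell F) c.unit_hcomp_counit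
    rw [mapCell_comp, mapCell_comp, mapCell_ofHom, mapCell_ofHom, mapCell_ofHom, F.map₂_id] at image
    rw [← ofHom_whiskerRight_comp_hcomp _ _ _ (by simp), ← hcomp_comp_ofHom_whiskerLeft _ _ _
      (by simp), F.whiskerRight_mapId_inv, F.whiskerLeft_mapId_hom]
    simp only [ofHom_comp, comp_assoc, ofHom_inv_hom_comp]
    rw [← comp_assoc (ofHom (F.mapComp _ _).hom), ← mapCell_hcomp _ _ _ (by simp), comp_assoc,
      ofHom_hom_inv_comp, ← ofHom_comp (ρ_ _).inv, Iso.inv_hom_id, comp_ofHom_id, image]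

theorem map_counit : (c.map F).counit = mapCell F c.counit ≫ᶜ ofHom (F.mapId y).hom := rfl

theorem map_leftReduce {z : B} (n : y ⟶ z) :
    ofHom (F.mapComp p n).hom ≫ᶜ (c.map F).leftReduce (F.map n) = mapCell F (c.leftReduce n) := by
  rw [leftReduce, leftReduce, mapCell_comp, mapCell_ofHom, F.map₂_left_unitor, ofHom_comp,
    ← comp_assoc (mapCell F _), mapCell_hcomp]
  simp only [ofHom_comp, comp_assoc]
  rw [← comp_assoc (hcomp (mapCell F _) _ _), hcomp_comp_ofHom_whiskerRight]
  exact congrArg (_ ≫ᶜ · ≫ᶜ _) (hcomp_congr rfl (by rw [mapCell_ofHom, F.map₂_id]) _)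

theorem map_rightReduce {w w' : B} {m : w ⟶ x} {n : w' ⟶ y} (α : Cell m n) (hα : right α = f) :
    ofHom (F.mapComp m p).hom ≫ᶜ (c.map F).rightReduce (mapCell F α) (by simp [hα]) =
      mapCell F (c.rightReduce α hα) := by
  rw [rightReduce, rightReduce, mapCell_comp, mapCell_ofHom, F.map₂_right_unitor, ofHom_comp,
    ← comp_assoc (mapCell F _), mapCell_hcomp]
  simp only [ofHom_comp, comp_assoc]
  rw [← comp_assoc (hcomp (mapCell F _) (mapCell F _) _), hcomp_comp_ofHom_whiskerLeft]
  rfl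

theorem map_slide {x' y' : B} {g : ob x' ⟶ ob y'} {q : x' ⟶ y'} (d : Companion g q) {m : x ⟶ x'}
    {n : y ⟶ y'} (α : Cell m n) (hl : left α = f) (hr : right α = g) :
    (F.mapComp m q).inv ≫ F.map₂ (c.slide d α hl hr) ≫ (F.mapComp p n).hom =
      (c.map F).slide (d.map F) (mapCell F α) (by simp [hl]) (by simp [hr]) := by
  have image := congrArg (mapCell F) (c.slide_leftReduce d α hl hr)
  rw [mapCell_comp, mapCell_ofHom, ← map_leftReduce, ← map_rightReduce] at image
  apply eq_slide
  rw [ofHom_comp, ofHom_comp, comp_assoc, comp_assoc, image, ofHom_inv_hom_comp]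

end

theorem Compatible.map₂ {x y : B} {f f' : ob x ⟶ ob y} {p p' : x ⟶ y} {c : Companion f p}
    {c' : Companion f' p'} {θ : p ⟶ p'} (h : c.Compatible c' θ) :
    (c.map F).Compatible (c'.map F) (F.map₂ θ) := by
  rw [Compatible, map_counit, map_counit, ← h, mapCell_comp, mapCell_ofHom, comp_assoc]

theorem compatible_mapComp {x y z : B} {f : ob x ⟶ ob y} {p : x ⟶ y} (c : Companion f p)
    {g : ob y ⟶ ob z} {q : y ⟶ z} (d : Companion g q) :
    ((c.comp d).map F).Compatible ((c.map F).comp (d.map F)) (F.mapComp p q).hom := by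
  rw [Compatible, comp_counit, map_counit, map_counit, ← comp_assoc, map_leftReduce, comp_counit,
    mapCell_comp, comp_assoc]

theorem compatible_mapId (x : B) :
    ((id x).map F).Compatible (id (F.obj x)) (F.mapId x).hom := by
  rw [Compatible, map_counit, id_counit, id_counit, mapCell_ofHom, F.map₂_id, ofHom_id_comp,
    comp_ofHom_id]

end Companion

end DoubleStructure

namespace DoubleStructure

open DoubleFunctor

variable {B : Type u} [Bicategory.{w, v} B] {T : Type u₂} [Category.{v₂} T]
  [DoubleStructure.{t} B T] {C : Type u'} [Bicategory.{w', v'} C] {U : Type u₃}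
  [Category.{v₃} U] [DoubleStructure.{t'} C U]

instance doubleFunctorId : DoubleFunctor (Pseudofunctor.id B) where
  mapArrow f := f
  mapCell α := α
  mapArrow_id _ := rfl
  mapArrow_comp _ _ := rfl
  left_mapCell _ := rfl
  right_mapCell _ := rfl
  mapCell_ofHom _ := rfl
  mapCell_comp _ _ := rfl
  mapCell_idCell _ := (comp_ofHom_id _).trans (ofHom_id_comp _).symm
  mapCell_hcomp _ _ _ := (comp_ofHom_id _).trans (ofHom_id_comp _).symm

instance doubleFunctorComp {E : Type u''} [Bicategory.{w'', v''} E] {V : Type u₄}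
    [Category.{v₄} V] [DoubleStructure.{t''} E V] (F : Pseudofunctor B C) (G : Pseudofunctor C E)
    [DoubleFunctor F] [DoubleFunctor G] : DoubleFunctor (F.comp G) where
  mapArrow f := mapArrow G (mapArrow F f)
  mapCell α := mapCell G (mapCell F α)
  mapArrow_id x := (congrArg (mapArrow G) (mapArrow_id F x)).trans (mapArrow_id G _)
  mapArrow_comp f g := (congrArg (mapArrow G) (mapArrow_comp F f g)).trans (mapArrow_comp G _ _)
  left_mapCell α := (left_mapCell G _).trans (congrArg (mapArrow G) (left_mapCell F α))
  right_mapCell α := (right_mapCell G _).trans (congrArg (mapArrow G) (right_mapCell F α))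
  mapCell_ofHom θ := (congrArg (mapCell G) (mapCell_ofHom F θ)).trans (mapCell_ofHom G _)
  mapCell_comp α β := (congrArg (mapCell G) (mapCell_comp F α β)).trans (mapCell_comp G _ _)
  mapCell_idCell {x y} f := by
    have image := congrArg (mapCell G) (mapCell_idCell F f)
    rw [mapCell_comp, mapCell_comp, mapCell_ofHom, mapCell_ofHom] at image
    change mapCell G (mapCell F (idCell f)) ≫ᶜ
        ofHom (G.map₂ (F.mapId y).hom ≫ (G.mapId (F.obj y)).hom) =
      ofHom (G.map₂ (F.mapId x).hom ≫ (G.mapId (F.obj x)).hom) ≫ᶜ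
        idCell (x := G.obj (F.obj x)) (y := G.obj (F.obj y)) (mapArrow G (mapArrow F f))
    rw [ofHom_comp, ← comp_assoc, image, comp_assoc, mapCell_idCell, ofHom_comp, comp_assoc]
  mapCell_hcomp {_ _ _ _ _ _ m n m' n'} α β h := by
    have image := congrArg (mapCell G) (mapCell_hcomp F α β h)
    rw [mapCell_comp, mapCell_comp, mapCell_ofHom, mapCell_ofHom] at image
    change mapCell G (mapCell F (hcomp α β h)) ≫ᶜ
        ofHom (G.map₂ (F.mapComp m' n').hom ≫ (G.mapComp (F.map m') (F.map n')).hom) =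
      ofHom (G.map₂ (F.mapComp m n).hom ≫ (G.mapComp (F.map m) (F.map n)).hom) ≫ᶜ
        hcomp (mapCell G (mapCell F α)) (mapCell G (mapCell F β)) (by simp [h])
    rw [ofHom_comp, ← comp_assoc, image, comp_assoc, mapCell_hcomp, ofHom_comp, comp_assoc]

/-- A transformation of double functors in the direction of the arrows: its components are arrows at
objects and cells at 1-cells. -/
structure DoubleTransformation (F G : Pseudofunctor B C) [DoubleFunctor F] [DoubleFunctor G] where
  app (x : B) : ob (F.obj x) ⟶ ob (G.obj x)
  cell {x y : B} (m : x ⟶ y) : Cell (F.map m) (G.map m)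
  left_cell {x y : B} (m : x ⟶ y) : left (cell m) = app x
  right_cell {x y : B} (m : x ⟶ y) : right (cell m) = app y
  cell_naturality {x y x' y' : B} {m : x ⟶ y} {n : x' ⟶ y'} (α : Cell m n) :
    mapCell F α ≫ᶜ cell n = cell m ≫ᶜ mapCell G α
  cell_id (x : B) :
    cell (𝟙 x) ≫ᶜ ofHom (G.mapId x).hom = ofHom (F.mapId x).hom ≫ᶜ idCell (app x)
  cell_comp {x y z : B} (m : x ⟶ y) (n : y ⟶ z) :
    cell (m ≫ n) ≫ᶜ ofHom (G.mapComp m n).hom = ofHom (F.mapComp m n).hom ≫ᶜ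
      hcomp (cell m) (cell n) ((right_cell m).trans (left_cell n).symm)

namespace DoubleTransformation

attribute [simp] left_cell right_cell

variable {F G : Pseudofunctor B C} [DoubleFunctor F] [DoubleFunctor G]
  (θ : DoubleTransformation F G)

/-- Companions of the component arrows of a transformation along which its component cells reshape
to isomorphisms. -/
structure Companions where
  obj (x : B) : F.obj x ⟶ G.obj x
  companion (x : B) : Companion (θ.app x) (obj x)
  isIso_slide {x y : B} (m : x ⟶ y) :
    IsIso ((companion x).slide (companion y) (θ.cell m) (θ.left_cell m) (θ.right_cell m))

variable {θ} (c : θ.Companions)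

namespace Companions

/-- The companions of the components of a transformation form a pseudonatural transformation. -/
noncomputable def strongTrans : Pseudofunctor.StrongTrans F G where
  app := c.obj
  naturality m :=
    have := c.isIso_slide m
    asIso ((c.companion _).slide (c.companion _) (θ.cell m) (θ.left_cell m) (θ.right_cell m))
  naturality_naturality {x y m n} σ := by
    have natural := θ.cell_naturality (ofHom σ)
    rw [mapCell_ofHom, mapCell_ofHom] at natural
    rw [asIso_hom, asIso_hom, Companion.whiskerRight_slide, Companion.slide_whiskerLeft]
    simp only [natural]
  naturality_id x := by
    rw [asIso_hom, Companion.slide_whiskerLeft, ← (c.companion x).slide_idCell,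
      Companion.whiskerRight_slide]
    simp only [θ.cell_id]
  naturality_comp {x y z} m n := by
    rw [asIso_hom, asIso_hom, asIso_hom, Companion.slide_whiskerLeft, ← Companion.slide_hcomp,
      Companion.whiskerRight_slide]
    simp only [θ.cell_comp]

theorem strongTrans_naturality_hom {x y : B} (m : x ⟶ y) : (c.strongTrans.naturality m).hom =
    (c.companion x).slide (c.companion y) (θ.cell m) (θ.left_cell m) (θ.right_cell m) :=
  rfl

theorem compatible_naturality {x y : B} {f : ob x ⟶ ob y} {m : x ⟶ y} (d : Companion f m) :
    ((d.map F).comp (c.companion y)).Compatible ((c.companion x).comp (d.map G))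
      (c.strongTrans.naturality m).hom := by
  refine Companion.compatible_slide _ _ _ _ (θ.left_cell m) (θ.right_cell m) ?_
  rw [Companion.map_counit, Companion.map_counit, ← comp_assoc, ← θ.cell_naturality, comp_assoc,
    θ.cell_id, comp_assoc]

end Companions

end DoubleTransformation

/-- An adjunction of double functors in the direction of the arrows. -/
structure DoubleAdjunction (F : Pseudofunctor B C) (G : Pseudofunctor C B) [DoubleFunctor F]
    [DoubleFunctor G] where
  unit : DoubleTransformation (Pseudofunctor.id B) (F.comp G)
  counit : DoubleTransformation (G.comp F) (Pseudofunctor.id C)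
  left_triangle {b b' : B} (m : b ⟶ b') :
    mapCell F (unit.cell m) ≫ᶜ counit.cell (F.map m) = ofHom (𝟙 (F.map m))
  right_triangle {c c' : C} (m : c ⟶ c') :
    unit.cell (G.map m) ≫ᶜ mapCell G (counit.cell m) = ofHom (𝟙 (G.map m))

end DoubleStructure

namespace DoubleStructure

open DoubleFunctor

namespace Companion

section Triangles

variable {B : Type u} [Bicategory.{w, v} B] {T : Type u₂} [Category.{v₂} T]
  [DoubleStructure.{t} B T]

theorem whiskerLeft_slide_eq_slide_whiskerRight {x y x' y' : B} {f f' : ob x ⟶ ob x'}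
    {g g' : ob y ⟶ ob y'} {p p' : x ⟶ x'} {q q' : y ⟶ y'}
    {c : Companion f p} {c' : Companion f' p'} {d : Companion g q} {d' : Companion g' q'}
    {m : x ⟶ y} {n : x' ⟶ y'} {κ : p ⟶ p'} {ν : q ⟶ q'} (hκ : c.Compatible c' κ)
    (hν : d.Compatible d' ν) (α : Cell m n) (hl : left α = f) (hr : right α = g)
    (hl' : left α = f') (hr' : right α = g') :
    m ◁ ν ≫ c'.slide d' α hl' hr' = c.slide d α hl hr ≫ κ ▷ n :=
  (c'.whiskerLeft_slide d' α hl' hr' d hν hr).trans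
    (c.slide_whiskerRight d α hl hr c' hκ hl').symm

theorem comp_eq_id_of_comp_eq_ofHom_id {x y x' y' : B} {f : ob x ⟶ ob y} {f' : ob y ⟶ ob x}
    {m : x ⟶ x'} {n : y ⟶ y'} {α : Cell m n} (hl : left α = f) {β : Cell n m} (hl' : left β = f')
    (hαβ : α ≫ᶜ β = ofHom (𝟙 m)) : f ≫ f' = 𝟙 (ob x) := by
  rw [← hl, ← hl', ← left_comp, hαβ, left_ofHom]

variable {x y x' y' : B} {f : ob x ⟶ ob y} {f' : ob y ⟶ ob x} {g : ob x' ⟶ ob y'}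
  {g' : ob y' ⟶ ob x'} {p : x ⟶ y} {p' : y ⟶ x} {q : x' ⟶ y'} {q' : y' ⟶ x'}
  {c : Companion f p} {c' : Companion f' p'} {d : Companion g q} {d' : Companion g' q'}
  {m : x ⟶ x'} {n : y ⟶ y'} {α : Cell m n} {hl : left α = f} {hr : right α = g}
  {σ : m ≫ q ⟶ p ≫ n} (hσ : σ = c.slide d α hl hr) {β : Cell n m} {hl' : left β = f'}
  {hr' : right β = g'} {τ : n ≫ q' ⟶ p' ≫ m} (hτ : τ = c'.slide d' β hl' hr')
  (hαβ : α ≫ᶜ β = ofHom (𝟙 m))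

include hσ hτ hαβ

theorem comp_slide_comp_of_comp_eq_id :
    (c.comp c').slide (d.comp d') (ofHom (𝟙 m)) (by rw [← hαβ]; simp [hl, hl'])
        (by rw [← hαβ]; simp [hr, hr']) =
      (α_ m q q').inv ≫ σ ▷ q' ≫ (α_ p n q').hom ≫ p ◁ τ ≫ (α_ p p' m).inv := by
  simp only [← hαβ, hσ, hτ]
  exact c.comp_slide_comp c' d d' α hl hr β hl' hr'

theorem whiskerLeft_comp_slide_of_comp_eq_id {κ : 𝟙 x ⟶ p ≫ p'}
    (hκ : (id x).Compatible (c.comp c') κ) {ν : 𝟙 x' ⟶ q ≫ q'}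
    (hν : (id x').Compatible (d.comp d') ν) :
    m ◁ ν ≫ (α_ m q q').inv ≫ σ ▷ q' ≫ (α_ p n q').hom ≫ p ◁ τ ≫ (α_ p p' m).inv =
      (ρ_ m).hom ≫ (λ_ m).inv ≫ κ ▷ m := by
  rw [← comp_slide_comp_of_comp_eq_id hσ hτ hαβ,
    whiskerLeft_slide_eq_slide_whiskerRight hκ hν _ (left_ofHom _) (right_ofHom _), id_slide_id,
    Category.id_comp, Category.assoc]

theorem comp_slide_whiskerRight_of_comp_eq_id {κ : p ≫ p' ⟶ 𝟙 x}
    (hκ : (c.comp c').Compatible (id x) κ) {ν : q ≫ q' ⟶ 𝟙 x'}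
    (hν : (d.comp d').Compatible (id x') ν) :
    m ◁ ν ≫ (ρ_ m).hom ≫ (λ_ m).inv =
      (α_ m q q').inv ≫ σ ▷ q' ≫ (α_ p n q').hom ≫ p ◁ τ ≫ (α_ p p' m).inv ≫ κ ▷ m := by
  have slides := whiskerLeft_slide_eq_slide_whiskerRight hκ hν (ofHom (𝟙 m))
    (by rw [← hαβ]; simp [hl, hl']) (by rw [← hαβ]; simp [hr, hr']) (left_ofHom _)
    (right_ofHom _)
  rw [comp_slide_comp_of_comp_eq_id hσ hτ hαβ, id_slide_id, Category.id_comp] at slides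
  simpa only [Category.assoc] using slides

end Triangles

variable {B : Type u} [Bicategory.{w, v} B] {T : Type u₂} [Category.{v₂} T]
  [DoubleStructure.{t} B T] {x y : B} {f : ob x ⟶ ob y} {p : x ⟶ y}

theorem eq_of_counit_eq {c c' : Companion f p} (h : c.counit = c'.counit) : c = c' := by
  have units : c.unit = c'.unit :=
    c.cell_ext_counit (by simp) (by rw [unit_counit, h, unit_counit])
  cases c
  cases c'
  simp_all

variable (c : Companion f p)

theorem map_id : c.map (Pseudofunctor.id B) = c :=
  eq_of_counit_eq (comp_ofHom_id _)

theorem map_comp {C : Type u'} [Bicategory.{w', v'} C] {U : Type u₃} [Category.{v₃} U]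
    [DoubleStructure.{t'} C U] {E : Type u''} [Bicategory.{w'', v''} E] {V : Type u₄}
    [Category.{v₄} V] [DoubleStructure.{t''} E V] (F : Pseudofunctor B C) (G : Pseudofunctor C E)
    [DoubleFunctor F] [DoubleFunctor G] : c.map (F.comp G) = (c.map F).map G :=
  eq_of_counit_eq <| by
    rw [map_counit G (c.map F), map_counit F c, mapCell_comp, mapCell_ofHom, comp_assoc,
      ← ofHom_comp]
    rfl

end Companion

namespace DoubleAdjunction

open Companion

variable {B : Type u} [Bicategory.{w, v} B] {T : Type u₂} [Category.{v₂} T]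
  [DoubleStructure.{t} B T] {C : Type u'} [Bicategory.{w', v'} C] {U : Type u₃}
  [Category.{v₃} U] [DoubleStructure.{t'} C U] {F : Pseudofunctor B C} {G : Pseudofunctor C B}
  [DoubleFunctor F] [DoubleFunctor G] (A : DoubleAdjunction F G)

theorem map_unit_app_comp_counit_app (b : B) :
    mapArrow F (A.unit.app b) ≫ A.counit.app (F.obj b) = 𝟙 (ob (F.obj b)) :=
  comp_eq_id_of_comp_eq_ofHom_id
    ((left_mapCell F _).trans (congrArg (mapArrow F) (A.unit.left_cell _)))
    (A.counit.left_cell _) (A.left_triangle (𝟙 b))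

theorem unit_app_comp_map_counit_app (e : C) :
    A.unit.app (G.obj e) ≫ mapArrow G (A.counit.app e) = 𝟙 (ob (G.obj e)) :=
  comp_eq_id_of_comp_eq_ofHom_id (A.unit.left_cell _)
    ((left_mapCell G _).trans (congrArg (mapArrow G) (A.counit.left_cell _)))
    (A.right_triangle (𝟙 e))

theorem compatible_unit_naturality (c : A.unit.Companions) (b : B) :
    ((c.companion b).comp (c.companion (G.obj (F.obj b)))).Compatible
      ((c.companion b).comp (((c.companion b).map F).map G))
      (c.strongTrans.naturality (c.obj b)).hom := by
  have naturality := c.compatible_naturality (c.companion b)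
  rwa [map_id, map_comp] at naturality

theorem compatible_counit_naturality (d : A.counit.Companions) (e : C) :
    ((((d.companion e).map G).map F).comp (d.companion e)).Compatible
      ((d.companion (F.obj (G.obj e))).comp (d.companion e))
      (d.strongTrans.naturality (d.obj e)).hom := by
  have naturality := d.compatible_naturality (d.companion e)
  rwa [map_id, map_comp] at naturality

/-- Taking companions of the unit and counit of an adjunction of double functors yields a
biadjunction between the underlying bicategories. -/
noncomputable def biadjunction (c : A.unit.Companions) (d : A.counit.Companions) :
    Biadjunction F G where
  unit := c.strongTrans
  counit := d.strongTrans
  triangulatorLeft b := (Companion.id (F.obj b)).isoOfEq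
    (((c.companion b).map F).comp (d.companion (F.obj b))) (A.map_unit_app_comp_counit_app b).symm
  triangulatorRight e := ((c.companion (G.obj e)).comp ((d.companion e).map G)).isoOfEq
    (Companion.id (G.obj e)) (A.unit_app_comp_map_counit_app e)
  triangulatorLeft_naturality {b b'} f :=
    whiskerLeft_comp_slide_of_comp_eq_id
      ((c.companion b).map_slide F (c.companion b') _ (A.unit.left_cell f) (A.unit.right_cell f))
      (d.strongTrans_naturality_hom (F.map f)) (A.left_triangle f) (compatible_isoOfEq _ _ _)
      (compatible_isoOfEq _ _ _)
  triangulatorRight_naturality {e e'} g :=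
    comp_slide_whiskerRight_of_comp_eq_id (c.strongTrans_naturality_hom (G.map g))
      ((d.companion e).map_slide G (d.companion e') _ (A.counit.left_cell g)
        (A.counit.right_cell g)) (A.right_triangle g) (compatible_isoOfEq _ _ _)
      (compatible_isoOfEq _ _ _)
  swallowtail_unit b := Compatible.eq_id <|
    (compatible_rightUnitor (c.companion b)).inv.trans <|
    (Compatible.whiskerLeft (c.companion b) <| (compatible_mapId G (F.obj b)).inv.trans <|
      (Compatible.map₂ G (compatible_isoOfEq _ _ _)).trans <|
      compatible_mapComp G ((c.companion b).map F) (d.companion (F.obj b))).trans <|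
    (compatible_associator _ _ _).inv.trans <|
    (Compatible.whiskerRight (A.compatible_unit_naturality c b).inv _).trans <|
    (compatible_associator _ _ _).trans <|
    (Compatible.whiskerLeft (c.companion b) (compatible_isoOfEq _ _ _)).trans <|
    compatible_rightUnitor (c.companion b)
  swallowtail_counit e := Compatible.eq_id <|
    (compatible_leftUnitor (d.companion e)).inv.trans <|
    (Compatible.whiskerRight (compatible_isoOfEq _ _ _) (d.companion e)).trans <|
    (compatible_associator _ _ _).trans <|
    (Compatible.whiskerLeft ((c.companion (G.obj e)).map F)
      (A.compatible_counit_naturality d e).inv).trans <|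
    (compatible_associator _ _ _).inv.trans <|
    (Compatible.whiskerRight ((compatible_mapComp F (c.companion (G.obj e))
        ((d.companion e).map G)).inv.trans <|
      (Compatible.map₂ F (compatible_isoOfEq _ _ _)).trans <| compatible_mapId F (G.obj e))
      (d.companion e)).trans <|
    compatible_leftUnitor (d.companion e)

end DoubleAdjunction

end DoubleStructure

namespace DoubleStructure

/-- The double category `D`, as a structure on its underlying bicategory. -/
instance loose (D : Type u) [DoubleCategory.{t, w, v} D] : DoubleStructure.{t} (Loose D) D where
  ob X := X.obj
  Cell m n := DoubleCategory.Cell (D := D) m n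
  left α := DoubleCategory.left α
  right α := DoubleCategory.right α
  comp α β := cellComp α β
  comp_assoc := cellComp_assoc
  left_comp := left_cellComp
  right_comp := right_cellComp
  ofHom θ := θ.cell
  left_ofHom θ := θ.left_eq
  right_ofHom θ := θ.right_eq
  ofHom_comp _ _ := rfl
  ofHom_id_comp := id_cellComp
  comp_ofHom_id := cellComp_id
  toHom α hl hr := Globular.mk α hl hr
  ofHom_toHom _ _ _ := rfl
  ofHom_injective h := Globular.ext h
  idCell f := DoubleCategory.idCell f
  left_idCell := DoubleCategory.left_idCell
  right_idCell := DoubleCategory.right_idCell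
  idCell_id X := DoubleCategory.idCell_id X.obj
  idCell_comp := DoubleCategory.idCell_comp
  hcomp α β h := DoubleCategory.hcomp α β h
  left_hcomp := DoubleCategory.left_hcomp
  right_hcomp := DoubleCategory.right_hcomp
  hcomp_comp_hcomp α β α' β' h h' := (hcomp_cellComp α β α' β' h h').symm
  ofHom_whiskerLeft _ _ _ _ := rfl
  ofHom_whiskerRight _ _ := rfl
  associator_naturality := assoc_naturality
  leftUnitor_naturality := leftUnitorHom_naturality
  rightUnitor_naturality := rightUnitorHom_naturality

section

variable {B : Type u} [Bicategory.{w, v} B] {T : Type u₂} [Category.{v₂} T]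
  [DoubleStructure.{t} B T]

/-- Families of arrows and of cells indexed by `I`. -/
instance power (I : Type) : DoubleStructure.{t} (I → B) (I → T) where
  ob x i := ob (x i)
  Cell m n := ∀ i, Cell (m i) (n i)
  left α i := left (α i)
  right α i := right (α i)
  comp α β i := α i ≫ᶜ β i
  comp_assoc _ _ _ := funext fun _ => comp_assoc _ _ _
  left_comp _ _ := funext fun _ => left_comp _ _
  right_comp _ _ := funext fun _ => right_comp _ _
  ofHom θ i := ofHom (θ i)
  left_ofHom _ := funext fun _ => left_ofHom _
  right_ofHom _ := funext fun _ => right_ofHom _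
  ofHom_comp _ _ := funext fun _ => ofHom_comp _ _
  ofHom_id_comp _ := funext fun _ => ofHom_id_comp _
  comp_ofHom_id _ := funext fun _ => comp_ofHom_id _
  toHom α hl hr i := toHom (α i) (congrFun hl i) (congrFun hr i)
  ofHom_toHom _ _ _ := funext fun _ => ofHom_toHom _ _ _
  ofHom_injective h := funext fun i => ofHom_injective (congrFun h i)
  idCell f i := idCell (f i)
  left_idCell _ := funext fun _ => left_idCell _
  right_idCell _ := funext fun _ => right_idCell _
  idCell_id _ := funext fun _ => idCell_id _
  idCell_comp _ _ := funext fun _ => idCell_comp _ _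
  hcomp α β h i := hcomp (α i) (β i) (congrFun h i)
  left_hcomp _ _ _ := funext fun _ => left_hcomp _ _ _
  right_hcomp _ _ _ := funext fun _ => right_hcomp _ _ _
  hcomp_comp_hcomp _ _ _ _ _ _ := funext fun _ => hcomp_comp_hcomp _ _ _ _ _ _
  ofHom_whiskerLeft _ _ _ _ := funext fun _ => ofHom_whiskerLeft _ _
  ofHom_whiskerRight _ _ := funext fun _ => ofHom_whiskerRight _ _
  associator_naturality _ _ _ _ _ := funext fun _ => associator_naturality _ _ _ _ _
  leftUnitor_naturality _ := funext fun _ => leftUnitor_naturality _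
  rightUnitor_naturality _ := funext fun _ => rightUnitor_naturality _

instance doubleFunctorDiagonal (I : Type) : DoubleFunctor (diagonal I B) where
  mapArrow f _ := f
  mapCell α _ := α
  mapArrow_id _ := rfl
  mapArrow_comp _ _ := rfl
  left_mapCell _ := rfl
  right_mapCell _ := rfl
  mapCell_ofHom _ := rfl
  mapCell_comp _ _ := rfl
  mapCell_idCell f := funext fun _ =>
    (comp_ofHom_id (idCell f)).trans (ofHom_id_comp (idCell f)).symm
  mapCell_hcomp α β h := funext fun _ =>
    (comp_ofHom_id (hcomp α β h)).trans (ofHom_id_comp (hcomp α β h)).symm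

open _root_.Opposite _root_.Bicategory.Opposite

/-- The horizontal opposite: 1-cells are reversed and arrows are kept, so that the left and right
boundaries of cells are exchanged. -/
instance opposite : DoubleStructure.{t} Bᵒᵖ T where
  ob x := ob x.unop
  Cell m n := Cell m.unop n.unop
  left α := right α
  right α := left α
  comp α β := α ≫ᶜ β
  comp_assoc := comp_assoc
  left_comp := right_comp
  right_comp := left_comp
  ofHom θ := ofHom θ.unop2
  left_ofHom θ := right_ofHom θ.unop2
  right_ofHom θ := left_ofHom θ.unop2
  ofHom_comp θ η := ofHom_comp θ.unop2 η.unop2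
  ofHom_id_comp := ofHom_id_comp
  comp_ofHom_id := comp_ofHom_id
  toHom α hl hr := op2 (toHom α hr hl)
  ofHom_toHom α hl hr := ofHom_toHom α hr hl
  ofHom_injective h := congrArg op2 (ofHom_injective h)
  idCell f := idCell f
  left_idCell := right_idCell
  right_idCell := left_idCell
  idCell_id x := idCell_id x.unop
  idCell_comp := idCell_comp
  hcomp α β h := hcomp β α h.symm
  left_hcomp α β h := right_hcomp β α h.symm
  right_hcomp α β h := left_hcomp β α h.symm
  hcomp_comp_hcomp α β α' β' h h' := hcomp_comp_hcomp β α β' α' h.symm h'.symm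
  ofHom_whiskerLeft m _ _ θ := ofHom_whiskerRight θ.unop2 m.unop
  ofHom_whiskerRight θ n := ofHom_whiskerLeft n.unop θ.unop2
  associator_naturality α β γ h h' := (associator_inv_naturality γ β α h'.symm h.symm).symm
  leftUnitor_naturality α := rightUnitor_naturality α
  rightUnitor_naturality α := leftUnitor_naturality α

end

end DoubleStructure

namespace DoubleStructure

section Opposite

open DoubleFunctor _root_.Opposite _root_.Bicategory.Opposite

variable {B : Type u} [Bicategory.{w, v} B] {C : Type u'} [Bicategory.{w', v'} C]

/-- The pseudofunctor between the 1-cell duals induced by a pseudofunctor. -/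
def oppositePseudofunctor (F : Pseudofunctor B C) : Pseudofunctor Bᵒᵖ Cᵒᵖ where
  obj x := op (F.obj x.unop)
  map f := (F.map f.unop).op
  map₂ θ := op2 (F.map₂ θ.unop2)
  map₂_id _ := congrArg op2 (F.map₂_id _)
  map₂_comp _ _ := congrArg op2 (F.map₂_comp _ _)
  mapId x := (F.mapId x.unop).op2
  mapComp f g := (F.mapComp g.unop f.unop).op2
  map₂_whisker_left f _ _ η := congrArg op2 (F.map₂_whisker_right η.unop2 f.unop)
  map₂_whisker_right η h := congrArg op2 (F.map₂_whisker_left h.unop η.unop2)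
  map₂_associator f g h := congrArg op2 <| by
    rw [← cancel_epi (F.map₂ (α_ h.unop g.unop f.unop).hom), ← F.map₂_comp]
    simp [F.map₂_associator]
  map₂_left_unitor f := congrArg op2 (F.map₂_right_unitor f.unop)
  map₂_right_unitor f := congrArg op2 (F.map₂_left_unitor f.unop)

variable {T : Type u₂} [Category.{v₂} T] [DoubleStructure.{t} B T] {U : Type u₃} [Category.{v₃} U]
  [DoubleStructure.{t'} C U]

instance doubleFunctorOpposite (F : Pseudofunctor B C) [DoubleFunctor F] :
    DoubleFunctor (oppositePseudofunctor F) where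
  mapArrow f := mapArrow F f
  mapCell α := mapCell F α
  mapArrow_id x := mapArrow_id F x.unop
  mapArrow_comp f g := mapArrow_comp F f g
  left_mapCell α := right_mapCell F α
  right_mapCell α := left_mapCell F α
  mapCell_ofHom θ := mapCell_ofHom F θ.unop2
  mapCell_comp α β := mapCell_comp F α β
  mapCell_idCell f := mapCell_idCell F f
  mapCell_hcomp α β h := mapCell_hcomp F β α h.symm

/-- The transformation induced between the double functors of horizontal opposites. -/
def DoubleTransformation.opposite {F G : Pseudofunctor B C} [DoubleFunctor F] [DoubleFunctor G]
    (θ : DoubleTransformation F G) :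
    DoubleTransformation (oppositePseudofunctor F) (oppositePseudofunctor G) where
  app x := θ.app x.unop
  cell m := θ.cell m.unop
  left_cell m := θ.right_cell m.unop
  right_cell m := θ.left_cell m.unop
  cell_naturality α := θ.cell_naturality α
  cell_id x := θ.cell_id x.unop
  cell_comp m n := θ.cell_comp n.unop m.unop

/-- The adjunction induced between the horizontal opposites, in the same direction since the arrows
are unchanged. -/
def DoubleAdjunction.opposite {F : Pseudofunctor B C} {G : Pseudofunctor C B} [DoubleFunctor F]
    [DoubleFunctor G] (A : DoubleAdjunction F G) :
    DoubleAdjunction (oppositePseudofunctor F) (oppositePseudofunctor G) where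
  unit := A.unit.opposite
  counit := A.counit.opposite
  left_triangle m := A.left_triangle m.unop
  right_triangle m := A.right_triangle m.unop

/-- A pseudonatural transformation given by the inverses of its naturality 2-cells. -/
def strongTransOfInv {F G : Pseudofunctor B C} (app : ∀ x, F.obj x ⟶ G.obj x)
    (naturality : ∀ {x y : B} (f : x ⟶ y), app x ≫ G.map f ≅ F.map f ≫ app y)
    (naturality_naturality : ∀ {x y : B} {f g : x ⟶ y} (θ : f ⟶ g),
      app x ◁ G.map₂ θ ≫ (naturality g).hom = (naturality f).hom ≫ F.map₂ θ ▷ app y)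
    (naturality_id : ∀ x : B, (naturality (𝟙 x)).hom ≫ (F.mapId x).hom ▷ app x =
      app x ◁ (G.mapId x).hom ≫ (ρ_ (app x)).hom ≫ (λ_ (app x)).inv)
    (naturality_comp : ∀ {x y z : B} (f : x ⟶ y) (g : y ⟶ z),
      (naturality (f ≫ g)).hom ≫ (F.mapComp f g).hom ▷ app z =
        app x ◁ (G.mapComp f g).hom ≫ (α_ _ _ _).inv ≫ (naturality f).hom ▷ G.map g ≫
          (α_ _ _ _).hom ≫ F.map f ◁ (naturality g).hom ≫ (α_ _ _ _).inv) :
    Pseudofunctor.StrongTrans F G where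
  app := app
  naturality f := (naturality f).symm
  naturality_naturality θ := by
    rw [Iso.symm_hom, Iso.symm_hom, Iso.comp_inv_eq, Category.assoc, naturality_naturality,
      Iso.inv_hom_id_assoc]
  naturality_id x := by
    rw [Iso.symm_hom, Iso.inv_comp_eq, reassoc_of% naturality_id x]
    simp
  naturality_comp f g := by
    rw [Iso.symm_hom, Iso.inv_comp_eq, reassoc_of% naturality_comp f g]
    simp

section Inverses

variable {a b c d : B}

theorem inv_triangulatorLeft_naturality {m : a ⟶ b} {n : c ⟶ d} {p : a ⟶ c}
    {q : c ⟶ a} {p' : b ⟶ d} {q' : d ⟶ b} (e : p ≫ q ≅ 𝟙 a) (e' : p' ≫ q' ≅ 𝟙 b)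
    {k k' : a ⟶ d} (u : k ≅ m ≫ p') (σ : k ≅ k') (v : k' ≅ p ≫ n) (τ : n ≫ q' ≅ q ≫ m)
    (h : e.hom ▷ m ≫ (λ_ m).hom ≫ (ρ_ m).inv = (α_ p q m).hom ≫ p ◁ τ.inv ≫ (α_ p n q').inv ≫
      (v.inv ≫ σ.inv ≫ u.hom) ▷ q' ≫ (α_ m p' q').hom ≫ m ◁ e'.hom) :
    m ◁ e'.inv ≫ (α_ m p' q').inv ≫ (u.inv ≫ σ.hom ≫ v.hom) ▷ q' ≫ (α_ p n q').hom ≫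
      p ◁ τ.hom ≫ (α_ p q m).inv = (ρ_ m).hom ≫ (λ_ m).inv ≫ e.inv ▷ m := by
  simpa using (IsIso.inv_eq_inv.mpr h).symm

theorem inv_triangulatorRight_naturality {m : a ⟶ b} {n : c ⟶ d} {p : a ⟶ c}
    {q : c ⟶ a} {p' : b ⟶ d} {q' : d ⟶ b} (e : 𝟙 a ≅ p ≫ q) (e' : 𝟙 b ≅ p' ≫ q')
    (σ : m ≫ p' ≅ p ≫ n) {k k' : c ⟶ b} (u : k ≅ n ≫ q') (τ : k ≅ k') (v : k' ≅ q ≫ m)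
    (h : e.hom ▷ m ≫ (α_ p q m).hom ≫ p ◁ (v.inv ≫ τ.inv ≫ u.hom) ≫ (α_ p n q').inv ≫
      σ.inv ▷ q' ≫ (α_ m p' q').hom = (λ_ m).hom ≫ (ρ_ m).inv ≫ m ◁ e'.hom) :
    m ◁ e'.inv ≫ (ρ_ m).hom ≫ (λ_ m).inv = (α_ m p' q').inv ≫ σ.hom ▷ q' ≫ (α_ p n q').hom ≫
      p ◁ (u.inv ≫ τ.hom ≫ v.hom) ≫ (α_ p q m).inv ≫ e.inv ▷ m := by
  simpa using (IsIso.inv_eq_inv.mpr h).symm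

theorem inv_swallowtail_unit {p : a ⟶ b} {q : b ⟶ c} {r : c ⟶ b} {s : b ⟶ c}
    (e : 𝟙 b ≅ q ≫ r) (σ : p ≫ q ≅ p ≫ s) {k k' : b ⟶ b} (u : k ≅ s ≫ r) (τ : k ≅ k')
    (v : k' ≅ 𝟙 b)
    (h : (ρ_ p).inv ≫ p ◁ e.hom ≫ (α_ p q r).inv ≫ σ.hom ▷ r ≫ (α_ p s r).hom ≫
        p ◁ (u.inv ≫ τ.hom ≫ v.hom) ≫ (ρ_ p).hom = 𝟙 p) :
    (ρ_ p).inv ≫ p ◁ (v.inv ≫ τ.inv ≫ u.hom) ≫ (α_ p s r).inv ≫ σ.inv ▷ r ≫ (α_ p q r).hom ≫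
      p ◁ e.inv ≫ (ρ_ p).hom = 𝟙 p := by
  simpa using IsIso.inv_eq_inv.mpr h

theorem inv_swallowtail_counit {p : a ⟶ b} {q : a ⟶ c} {r : c ⟶ a} {s : c ⟶ a}
    (e : q ≫ r ≅ 𝟙 a) (σ : s ≫ p ≅ r ≫ p) {k k' : a ⟶ a} (u : k ≅ 𝟙 a) (τ : k ≅ k')
    (v : k' ≅ q ≫ s)
    (h : (λ_ p).inv ≫ (u.inv ≫ τ.hom ≫ v.hom) ▷ p ≫ (α_ q s p).hom ≫ q ◁ σ.hom ≫
        (α_ q r p).inv ≫ e.hom ▷ p ≫ (λ_ p).hom = 𝟙 p) :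
    (λ_ p).inv ≫ e.inv ▷ p ≫ (α_ q r p).hom ≫ q ◁ σ.inv ≫ (α_ q s p).inv ≫
      (v.inv ≫ τ.inv ≫ u.hom) ▷ p ≫ (λ_ p).hom = 𝟙 p := by
  simpa using IsIso.inv_eq_inv.mpr h

end Inverses

/-- A pseudonatural transformation between 1-cell duals, read in the original bicategories. -/
def unopStrongTrans {F G : Pseudofunctor B C}
    (η : Pseudofunctor.StrongTrans (oppositePseudofunctor F) (oppositePseudofunctor G)) :
    Pseudofunctor.StrongTrans G F :=
  strongTransOfInv (fun x => (η.app (op x)).unop) (fun f => (η.naturality f.op).unop2)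
    (fun θ => congrArg Hom2.unop2 (η.naturality_naturality (op2 θ)))
    (fun x => congrArg Hom2.unop2 (η.naturality_id (op x)))
    (fun f g => congrArg Hom2.unop2 (η.naturality_comp g.op f.op))

/-- A biadjunction between 1-cell duals, read in the original bicategories, where the two functors
and the unit and counit exchange their roles. -/
def unopBiadjunction {F : Pseudofunctor B C} {G : Pseudofunctor C B}
    (E : Biadjunction (oppositePseudofunctor F) (oppositePseudofunctor G)) : Biadjunction G F where
  unit := unopStrongTrans E.counit
  counit := unopStrongTrans E.unit
  triangulatorLeft b := (E.triangulatorRight (op b)).unop2.symm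
  triangulatorRight b := (E.triangulatorLeft (op b)).unop2.symm
  triangulatorLeft_naturality f :=
    inv_triangulatorLeft_naturality _ _ (G.mapComp _ _) (G.map₂Iso _) (G.mapComp _ _) _
      (congrArg Hom2.unop2 (E.triangulatorRight_naturality f.op))
  triangulatorRight_naturality f :=
    inv_triangulatorRight_naturality _ _ _ (F.mapComp _ _) (F.map₂Iso _) (F.mapComp _ _)
      (congrArg Hom2.unop2 (E.triangulatorLeft_naturality f.op))
  swallowtail_unit b :=
    inv_swallowtail_unit _ _ (F.mapComp _ _) (F.map₂Iso _) (F.mapId _)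
      (congrArg Hom2.unop2 (E.swallowtail_counit (op b)))
  swallowtail_counit b :=
    inv_swallowtail_counit _ _ (G.mapId _) (G.map₂Iso _) (G.mapComp _ _)
      (congrArg Hom2.unop2 (E.swallowtail_unit (op b)))

end Opposite

end DoubleStructure

namespace DoubleCategory.StrongFiniteCoproducts

open DoubleStructure

variable {D : Type u} [DoubleCategory.{t, w, v} D] (S : StrongFiniteCoproducts D) {I : Type}
  [Finite I]

/-- The arrow between coproducts induced by a family of arrows. -/
def sumHom {x y : I → D} (f : ∀ i, x i ⟶ y i) : S.sum x ⟶ S.sum y :=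
  Cofan.IsColimit.desc (S.isColimit x) fun i => f i ≫ S.inj y i

theorem inj_sumHom {x y : I → D} (f : ∀ i, x i ⟶ y i) (i : I) :
    S.inj x i ≫ S.sumHom f = f i ≫ S.inj y i :=
  Cofan.IsColimit.fac (S.isColimit x) _ i

theorem sum_hom_ext {x : I → D} {z : D} {f g : S.sum x ⟶ z}
    (h : ∀ i, S.inj x i ≫ f = S.inj x i ≫ g) : f = g :=
  Cofan.IsColimit.hom_ext (S.isColimit x) f g h

/-- The cell between coproducts induced by a family of cells. -/
noncomputable def sumCell {x y x' y' : I → D} {m : ∀ i, Pro (x i) (y i)}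
    {n : ∀ i, Pro (x' i) (y' i)} (α : ∀ i, DoubleCategory.Cell (m i) (n i)) :
    DoubleCategory.Cell (S.sumPro m) (S.sumPro n) :=
  S.descPro (S.sumHom fun i => DoubleCategory.left (α i))
    (S.sumHom fun i => DoubleCategory.right (α i))
    (fun i => cellComp (α i) (S.inclPro n i)) (fun i => by simp [inj_sumHom])
    (fun i => by simp [inj_sumHom])

theorem inclPro_sumCell {x y x' y' : I → D} {m : ∀ i, Pro (x i) (y i)}
    {n : ∀ i, Pro (x' i) (y' i)} (α : ∀ i, DoubleCategory.Cell (m i) (n i)) (i : I) :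
    cellComp (S.inclPro m i) (S.sumCell α) = cellComp (α i) (S.inclPro n i) :=
  S.inclPro_descPro _ _ _ _ _ i

theorem sumHom_id (x : I → D) : S.sumHom (fun i => 𝟙 (x i)) = 𝟙 (S.sum x) :=
  S.sum_hom_ext fun i => by simp [inj_sumHom]

theorem sumHom_comp {x y z : I → D} (f : ∀ i, x i ⟶ y i) (g : ∀ i, y i ⟶ z i) :
    S.sumHom (fun i => f i ≫ g i) = S.sumHom f ≫ S.sumHom g :=
  S.sum_hom_ext fun i => by
    rw [inj_sumHom, ← Category.assoc, inj_sumHom, Category.assoc, Category.assoc, inj_sumHom]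

theorem sumCell_globular {x y : I → D} {m n : ∀ i, Pro (x i) (y i)}
    (θ : ∀ i, Globular (m i) (n i)) : S.sumCell (fun i => (θ i).cell) = (S.sumMap θ).cell := by
  refine S.sumPro_hom_ext ?_ ?_ fun i => ?_
  · simp [sumCell, Globular.left_eq, sumHom_id]
  · simp [sumCell, Globular.right_eq, sumHom_id]
  · rw [inclPro_sumCell, inclPro_sumMap]

theorem sumCell_comp {x y x' y' x'' y'' : I → D} {m : ∀ i, Pro (x i) (y i)}
    {n : ∀ i, Pro (x' i) (y' i)} {p : ∀ i, Pro (x'' i) (y'' i)}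
    (α : ∀ i, DoubleCategory.Cell (m i) (n i)) (β : ∀ i, DoubleCategory.Cell (n i) (p i)) :
    S.sumCell (fun i => cellComp (α i) (β i)) = cellComp (S.sumCell α) (S.sumCell β) := by
  refine S.sumPro_hom_ext ?_ ?_ fun i => ?_
  · simp [sumCell, sumHom_comp]
  · simp [sumCell, sumHom_comp]
  · rw [inclPro_sumCell, ← cellComp_assoc, inclPro_sumCell, cellComp_assoc, cellComp_assoc,
      inclPro_sumCell]

theorem sumCell_idCell {x y : I → D} (f : ∀ i, x i ⟶ y i) :
    cellComp (S.sumCell fun i => DoubleCategory.idCell (f i)) (S.sumId y).hom.cell =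
      cellComp (S.sumId x).hom.cell (DoubleCategory.idCell (S.sumHom f)) := by
  refine S.sumPro_hom_ext ?_ ?_ fun i => ?_
  · simp [sumCell, Globular.left_eq]
  · simp [sumCell, Globular.right_eq]
  · rw [← cellComp_assoc, inclPro_sumCell, cellComp_assoc, inclPro_sumId_hom, ← cellComp_assoc,
      inclPro_sumId_hom, ← DoubleCategory.idCell_comp, ← DoubleCategory.idCell_comp, inj_sumHom]

theorem sumCell_hcomp {x y z x' y' z' : I → D} {m : ∀ i, Pro (x i) (y i)}
    {n : ∀ i, Pro (y i) (z i)} {m' : ∀ i, Pro (x' i) (y' i)} {n' : ∀ i, Pro (y' i) (z' i)}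
    (α : ∀ i, DoubleCategory.Cell (m i) (m' i)) (β : ∀ i, DoubleCategory.Cell (n i) (n' i))
    (h : ∀ i, DoubleCategory.right (α i) = DoubleCategory.left (β i)) :
    cellComp (S.sumCell fun i => DoubleCategory.hcomp (α i) (β i) (h i))
        (S.sumComp m' n').hom.cell =
      cellComp (S.sumComp m n).hom.cell
        (DoubleCategory.hcomp (S.sumCell α) (S.sumCell β) (by simp [sumCell, h])) := by
  refine S.sumPro_hom_ext ?_ ?_ fun i => ?_
  · simp [sumCell, Globular.left_eq]
  · simp [sumCell, Globular.right_eq]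
  · rw [← cellComp_assoc, inclPro_sumCell, cellComp_assoc, inclPro_sumComp_hom, ← cellComp_assoc,
      inclPro_sumComp_hom, ← hcomp_cellComp, ← hcomp_cellComp,
      hcomp_congr _ (S.inclPro_sumCell α i) (S.inclPro_sumCell β i)]

noncomputable instance doubleFunctorDirectSum : DoubleFunctor (S.directSum I) where
  mapArrow {x y} f := S.sumHom (x := fun i => (x i).obj) (y := fun i => (y i).obj) f
  mapCell α := S.sumCell (D := D) α
  mapArrow_id _ := S.sumHom_id _
  mapArrow_comp _ _ := S.sumHom_comp _ _
  left_mapCell _ := S.left_descPro _ _ _ _ _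
  right_mapCell _ := S.right_descPro _ _ _ _ _
  mapCell_ofHom θ := S.sumCell_globular θ
  mapCell_comp α β := S.sumCell_comp (D := D) α β
  mapCell_idCell f := S.sumCell_idCell (D := D) f
  mapCell_hcomp α β h := S.sumCell_hcomp (D := D) α β (congrFun h)

theorem inclPro_codiagPro {z w : D} (n : Pro z w) (i : I) :
    cellComp (S.inclPro (fun _ => n) i) (S.codiagPro I n) = cellId n :=
  S.inclPro_descPro _ _ _ _ _ i

theorem sumHom_codiag {z w : D} (f : z ⟶ w) :
    S.sumHom (fun _ : I => f) ≫ S.codiag I w = S.codiag I z ≫ f :=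
  S.sum_hom_ext fun i => by
    rw [← Category.assoc, inj_sumHom, Category.assoc, inj_codiag, Category.comp_id,
      ← Category.assoc, inj_codiag, Category.id_comp]

theorem sumHom_inj_codiag (x : I → D) :
    S.sumHom (S.inj x) ≫ S.codiag I (S.sum x) = 𝟙 (S.sum x) :=
  S.sum_hom_ext fun i => by
    rw [← Category.assoc, inj_sumHom, Category.assoc, inj_codiag, Category.comp_id]

theorem sumCell_codiagPro {z w z' w' : D} {m : Pro z w} {n : Pro z' w'}
    (α : DoubleCategory.Cell m n) :
    cellComp (S.sumCell fun _ : I => α) (S.codiagPro I n) = cellComp (S.codiagPro I m) α := by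
  refine S.sumPro_hom_ext ?_ ?_ fun i => ?_
  · simp [sumCell, left_codiagPro, sumHom_codiag]
  · simp [sumCell, right_codiagPro, sumHom_codiag]
  · rw [← cellComp_assoc, inclPro_sumCell, cellComp_assoc, inclPro_codiagPro, cellComp_id,
      ← cellComp_assoc, inclPro_codiagPro, id_cellComp]

theorem sumCell_inclPro_codiagPro {x y : I → D} (m : ∀ i, Pro (x i) (y i)) :
    cellComp (S.sumCell (S.inclPro m)) (S.codiagPro I (S.sumPro m)) = cellId (S.sumPro m) := by
  refine S.sumPro_hom_ext ?_ ?_ fun i => ?_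
  · simp [sumCell, left_codiagPro, sumHom_inj_codiag]
  · simp [sumCell, right_codiagPro, sumHom_inj_codiag]
  · rw [← cellComp_assoc, inclPro_sumCell, cellComp_assoc, inclPro_codiagPro]

theorem codiagPro_proId (z : D) :
    S.codiagPro I (proId z) =
      cellComp (S.sumId fun _ : I => z).hom.cell (DoubleCategory.idCell (S.codiag I z)) := by
  refine S.sumPro_hom_ext ?_ ?_ fun i => ?_
  · simp [left_codiagPro, Globular.left_eq]
  · simp [right_codiagPro, Globular.right_eq]
  · rw [← cellComp_assoc, inclPro_sumId_hom, inclPro_codiagPro, ← DoubleCategory.idCell_comp,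
      inj_codiag, DoubleCategory.idCell_id]

theorem codiagPro_proComp {x y z : D} (m : Pro x y) (n : Pro y z) :
    S.codiagPro I (proComp m n) = cellComp (S.sumComp (fun _ : I => m) fun _ => n).hom.cell
      (DoubleCategory.hcomp (S.codiagPro I m) (S.codiagPro I n)
        ((S.right_codiagPro I m).trans (S.left_codiagPro I n).symm)) := by
  refine S.sumPro_hom_ext ?_ ?_ fun i => ?_
  · simp [left_codiagPro, Globular.left_eq]
  · simp [right_codiagPro, Globular.right_eq]
  · rw [← cellComp_assoc, inclPro_sumComp_hom, inclPro_codiagPro, ← hcomp_cellComp,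
      hcomp_congr _ (S.inclPro_codiagPro m i) (S.inclPro_codiagPro n i), hcomp_id]

theorem map₂_id_cellComp {x y : I → Loose D} (m : x ⟶ y) {z w : D} {n : Pro z w}
    (α : DoubleCategory.Cell (D := D) ((S.directSum I).map m) n) :
    cellComp ((S.directSum I).map₂ (𝟙 m)).cell α = α :=
  (congrArg (fun θ => cellComp (Globular.cell θ) α) ((S.directSum I).map₂_id m)).trans
    (id_cellComp α)

variable (I) in
/-- The adjunction `⊕ ⊣ Δ` whose unit consists of the coprojections and whose counit consists of the
codiagonals. -/
noncomputable def directSumDiagonal :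
    DoubleAdjunction (S.directSum I) (diagonal I (Loose D)) where
  unit :=
    { app x i := S.inj (fun i => (x i).obj) i
      cell m i := S.inclPro (D := D) m i
      left_cell m := funext fun i => S.left_inclPro (D := D) m i
      right_cell m := funext fun i => S.right_inclPro (D := D) m i
      cell_naturality α := funext fun i => (S.inclPro_sumCell (D := D) α i).symm
      cell_id x := funext fun i => (congrArg _ (cellComp_id _)).trans
        ((S.inclPro_sumId_hom (fun i => (x i).obj) i).trans (id_cellComp _).symm)
      cell_comp m n := funext fun i => (congrArg _ (cellComp_id _)).trans
        ((S.inclPro_sumComp_hom (D := D) m n i).trans (id_cellComp _).symm) }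
  counit :=
    { app z := S.codiag I z.obj
      cell n := S.codiagPro (D := D) I n
      left_cell n := S.left_codiagPro (D := D) I n
      right_cell n := S.right_codiagPro (D := D) I n
      cell_naturality α := S.sumCell_codiagPro α
      cell_id x := (cellComp_id _).trans ((S.codiagPro_proId x.obj).trans
        (congrArg (cellComp · _) (S.map₂_id_cellComp (𝟙 fun _ => x) _).symm))
      cell_comp m n := (cellComp_id _).trans ((S.codiagPro_proComp m n).trans
        (congrArg (cellComp · _) (S.map₂_id_cellComp (fun _ => m ≫ n) _).symm)) }
  left_triangle m := S.sumCell_inclPro_codiagPro (D := D) m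
  right_triangle n := funext fun i => S.inclPro_codiagPro (D := D) n i

end DoubleCategory.StrongFiniteCoproducts

namespace DoubleStructure

variable {B : Type u} [Bicategory.{w, v} B] {T : Type u₂} [Category.{v₂} T]
  [DoubleStructure.{t} B T]

/-- The cells `κ a : m a ⟶ P` exhibit `P` as a coproduct of the 1-cells `m a`, relative to the
boundary arrows of the `κ a`: cells out of `P` over given arrows `f` and `g` are the same as
families of cells out of the `m a` over the composites of those boundary arrows with `f` and `g`.
-/
def IsCoproductCell {A : Type} {x y : A → B} {m : ∀ a, x a ⟶ y a} {X Y : B} {P : X ⟶ Y}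
    (κ : ∀ a, Cell (m a) P) : Prop :=
  ∀ ⦃z w : B⦄ (n : z ⟶ w) (f : ob X ⟶ ob z) (g : ob Y ⟶ ob w) (φ : ∀ a, Cell (m a) n),
    (∀ a, left (φ a) = left (κ a) ≫ f) → (∀ a, right (φ a) = right (κ a) ≫ g) →
      ∃! ψ : Cell P n, left ψ = f ∧ right ψ = g ∧ ∀ a, κ a ≫ᶜ ψ = φ a

namespace IsCoproductCell

variable {A : Type} {x y : A → B} {m : ∀ a, x a ⟶ y a} {X Y : B} {P P' : X ⟶ Y}
  {κ : ∀ a, Cell (m a) P} {κ' : ∀ a, Cell (m a) P'}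

theorem ext (h : IsCoproductCell κ) {z w : B} {n : z ⟶ w} {ψ ψ' : Cell P n}
    (hl : left ψ = left ψ') (hr : right ψ = right ψ') (hκ : ∀ a, κ a ≫ᶜ ψ = κ a ≫ᶜ ψ') :
    ψ = ψ' :=
  (h n (left ψ') (right ψ') (fun a => κ a ≫ᶜ ψ') (by simp) (by simp)).unique ⟨hl, hr, hκ⟩
    ⟨rfl, rfl, fun _ => rfl⟩

theorem hom_ext (h : IsCoproductCell κ) {Q : X ⟶ Y} {θ θ' : P ⟶ Q}
    (hκ : ∀ a, κ a ≫ᶜ ofHom θ = κ a ≫ᶜ ofHom θ') : θ = θ' :=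
  ofHom_injective (h.ext (by simp) (by simp) hκ)

theorem exists_hom (h : IsCoproductCell κ) (hl : ∀ a, left (κ a) = left (κ' a))
    (hr : ∀ a, right (κ a) = right (κ' a)) : ∃ θ : P ⟶ P', ∀ a, κ a ≫ᶜ ofHom θ = κ' a := by
  obtain ⟨ψ, ⟨hψl, hψr, hψ⟩, -⟩ := h P' (𝟙 _) (𝟙 _) κ' (by simp [hl]) (by simp [hr])
  exact ⟨toHom ψ hψl hψr, by simpa using hψ⟩

theorem exists_iso (h : IsCoproductCell κ) (h' : IsCoproductCell κ')
    (hl : ∀ a, left (κ a) = left (κ' a)) (hr : ∀ a, right (κ a) = right (κ' a)) :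
    ∃ e : P ≅ P', ∀ a, κ a ≫ᶜ ofHom e.hom = κ' a := by
  obtain ⟨θ, hθ⟩ := h.exists_hom hl hr
  obtain ⟨θ', hθ'⟩ := h'.exists_hom (fun a => (hl a).symm) (fun a => (hr a).symm)
  refine ⟨⟨θ, θ', h.hom_ext fun a => ?_, h'.hom_ext fun a => ?_⟩, hθ⟩
  · rw [ofHom_comp, ← comp_assoc, hθ, hθ', comp_ofHom_id]
  · rw [ofHom_comp, ← comp_assoc, hθ', hθ, comp_ofHom_id]

theorem isIso (h : IsCoproductCell κ) (h' : IsCoproductCell κ') {θ : P ⟶ P'}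
    (hθ : ∀ a, κ a ≫ᶜ ofHom θ = κ' a) : IsIso θ := by
  obtain ⟨e, he⟩ := h.exists_iso h' (fun a => by simp [← hθ]) (fun a => by simp [← hθ])
  rw [h.hom_ext fun a => (hθ a).trans (he a).symm]
  infer_instance

theorem comp_iso (h : IsCoproductCell κ) (e : P ≅ P') :
    IsCoproductCell fun a => κ a ≫ᶜ ofHom e.hom := by
  intro z w n f g φ hl hr
  obtain ⟨ψ, ⟨hψl, hψr, hψ⟩, unique⟩ := h n f g φ (by simpa using hl) (by simpa using hr)
  refine ⟨ofHom e.inv ≫ᶜ ψ, ⟨by simpa, by simpa, fun a => ?_⟩, fun ψ' ⟨hl', hr', hψ'⟩ => ?_⟩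
  · rw [comp_assoc, ofHom_hom_inv_comp, hψ]
  · rw [← unique (ofHom e.hom ≫ᶜ ψ') ⟨by simpa, by simpa, by simpa only [comp_assoc] using hψ'⟩,
      ofHom_inv_hom_comp]

theorem iso_comp (h : IsCoproductCell κ) {m' : ∀ a, x a ⟶ y a} (e : ∀ a, m' a ≅ m a) :
    IsCoproductCell fun a => ofHom (e a).hom ≫ᶜ κ a := by
  intro z w n f g φ hl hr
  obtain ⟨ψ, ⟨hψl, hψr, hψ⟩, unique⟩ := h n f g (fun a => ofHom (e a).inv ≫ᶜ φ a)
    (by simpa using hl) (by simpa using hr)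
  refine ⟨ψ, ⟨hψl, hψr, fun a => ?_⟩, fun ψ' ⟨hl', hr', hψ'⟩ => unique ψ' ⟨hl', hr', fun a => ?_⟩⟩
  · rw [comp_assoc, hψ, ofHom_hom_inv_comp]
  · rw [← hψ', comp_assoc, ofHom_inv_hom_comp]

theorem reindex (h : IsCoproductCell κ) {A' : Type} {e : A' → A} (he : e.Bijective) :
    IsCoproductCell fun a => κ (e a) := by
  intro z w n f g φ hl hr
  obtain ⟨φ', hφ'⟩ : ∃ φ' : ∀ a, Cell (m a) n, ∀ a, φ' (e a) = φ a :=
    ⟨_, Equiv.piCongrLeft_apply_apply (fun a => Cell (m a) n) (.ofBijective e he) φ⟩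
  obtain ⟨ψ, ⟨hψl, hψr, hψ⟩, unique⟩ := h n f g φ'
    (he.surjective.forall.mpr fun a => by rw [hφ', hl])
    (he.surjective.forall.mpr fun a => by rw [hφ', hr])
  refine ⟨ψ, ⟨hψl, hψr, fun a => (hψ (e a)).trans (hφ' a)⟩,
    fun ψ' ⟨hl', hr', hψ'⟩ => unique ψ' ⟨hl', hr', ?_⟩⟩
  exact he.surjective.forall.mpr fun a => by rw [hφ', hψ']

theorem hcomp_iso {y' : A → B} {n : ∀ a, y a ⟶ y' a} {Z : B} {Q Q' : Y ⟶ Z}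
    {ν : ∀ a, Cell (n a) Q} {ν' : ∀ a, Cell (n a) Q'} {hκν : ∀ a, right (κ a) = left (ν a)}
    (h : IsCoproductCell fun a => hcomp (κ a) (ν a) (hκν a)) (e : P ≅ P')
    (he : ∀ a, κ a ≫ᶜ ofHom e.hom = κ' a) (d : Q ≅ Q') (hd : ∀ a, ν a ≫ᶜ ofHom d.hom = ν' a)
    (hκν' : ∀ a, right (κ' a) = left (ν' a)) :
    IsCoproductCell fun a => hcomp (κ' a) (ν' a) (hκν' a) := by
  convert (h.comp_iso (whiskerRightIso e Q)).comp_iso (whiskerLeftIso P' d) using 2 with a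
  rw [whiskerRightIso_hom, whiskerLeftIso_hom, hcomp_comp_ofHom_whiskerRight,
    hcomp_comp_ofHom_whiskerLeft _ _ _ (by simp [hκν])]
  exact hcomp_congr (he a).symm (hd a).symm _

theorem ofHom_id {x y : B} (m : x ⟶ y) :
    IsCoproductCell fun _ : PUnit.{1} => ofHom (𝟙 m) := by
  intro z w n f g φ hl hr
  refine ⟨φ ⟨⟩, ⟨by simp [hl], by simp [hr], fun _ => ofHom_id_comp _⟩, fun ψ ⟨_, _, hψ⟩ => ?_⟩
  rw [← hψ, ofHom_id_comp]

end IsCoproductCell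

section Opposite

open _root_.Opposite

variable {A : Type}

theorem IsCoproductCell.op {x y : A → B} {X Y : B} {m : ∀ a, x a ⟶ y a} {P : X ⟶ Y}
    {κ : ∀ a, Cell (m a) P} (h : IsCoproductCell κ) :
    IsCoproductCell (B := Bᵒᵖ) (x := fun a => op (y a)) (y := fun a => op (x a))
      (m := fun a => (m a).op) (P := P.op) κ := by
  intro z w n f g φ hl hr
  obtain ⟨ψ, ⟨hψl, hψr, hψ⟩, unique⟩ := h n.unop g f φ hr hl
  exact ⟨ψ, ⟨hψr, hψl, hψ⟩, fun ψ' ⟨hl', hr', hψ'⟩ => unique ψ' ⟨hr', hl', hψ'⟩⟩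

theorem IsCoproductCell.unop {x y : A → Bᵒᵖ} {X Y : Bᵒᵖ} {m : ∀ a, x a ⟶ y a} {P : X ⟶ Y}
    {κ : ∀ a, Cell (m a) P} (h : IsCoproductCell κ) :
    IsCoproductCell (B := B) (x := fun a => (y a).unop) (y := fun a => (x a).unop)
      (m := fun a => (m a).unop) (P := P.unop) κ := by
  intro z w n f g φ hl hr
  obtain ⟨ψ, ⟨hψl, hψr, hψ⟩, unique⟩ := h n.op g f φ hr hl
  exact ⟨ψ, ⟨hψr, hψl, hψ⟩, fun ψ' ⟨hl', hr', hψ'⟩ => unique ψ' ⟨hr', hl', hψ'⟩⟩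

end Opposite

end DoubleStructure

namespace DoubleStructure

variable {B : Type u} [Bicategory.{w, v} B] {T : Type u₂} [Category.{v₂} T]
  [DoubleStructure.{t} B T]

/-- A companion of `f` on a coproduct of identity 1-cells: when the source of `f` is the coproduct
of the `x j`, with coprojections `s j`, a cell out of the companion is determined by cells out of
the identities of the `x j`. -/
structure CoproductCompanion {J : Type} {x : J → B} {X Y : B} (s : ∀ j, ob (x j) ⟶ ob X)
    (f : ob X ⟶ ob Y) where
  obj : X ⟶ Y
  companion : Companion f obj
  cell (j : J) : Cell (𝟙 (x j)) obj
  left_cell (j : J) : left (cell j) = s j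
  isCoproductCell : IsCoproductCell cell
  cell_counit (j : J) : cell j ≫ᶜ companion.counit = idCell (s j ≫ f)

namespace CoproductCompanion

variable {J : Type} {x : J → B} {X Y : B} {s : ∀ j, ob (x j) ⟶ ob X} {f : ob X ⟶ ob Y}

theorem right_cell (c : CoproductCompanion s f) (j : J) : right (c.cell j) = s j ≫ f := by
  have := congrArg right (c.cell_counit j)
  rwa [right_comp, c.companion.right_counit, Category.comp_id, right_idCell] at this

theorem nonempty_of_isCoproductCell (hs : IsCoproductCell fun j => idCell (s j)) {P : X ⟶ Y}
    {κ : ∀ j, Cell (𝟙 (x j)) P} (hκ : IsCoproductCell κ) (hl : ∀ j, left (κ j) = s j)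
    (hr : ∀ j, right (κ j) = s j ≫ f) : Nonempty (CoproductCompanion s f) := by
  obtain ⟨unit, ⟨left_unit, right_unit, hunit⟩, -⟩ :=
    hs P (𝟙 _) f κ (by simp [hl]) (by simp [hr])
  obtain ⟨counit, ⟨left_counit, right_counit, hcounit⟩, -⟩ :=
    hκ (𝟙 Y) f (𝟙 _) (fun j => idCell (s j ≫ f)) (by simp [hl]) (by simp [hr])
  have unit_counit : unit ≫ᶜ counit = idCell f := hs.ext (by simp [left_unit, left_counit])
    (by simp [right_unit, right_counit]) fun j => by
      rw [← comp_assoc, hunit, hcounit, idCell_comp]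
  have h : right unit = left counit := right_unit.trans left_counit.symm
  have unit_hcomp_counit : ofHom (λ_ P).inv ≫ᶜ hcomp unit counit h ≫ᶜ ofHom (ρ_ P).hom =
      ofHom (𝟙 P) := hκ.ext (by simp [left_unit]) (by simp [right_counit]) fun j => by
    have interchange : hcomp (idCell (s j)) (κ j) (by simp [hl]) ≫ᶜ hcomp unit counit h =
        hcomp (κ j) (idCell (s j ≫ f)) (by simp [hr]) := by
      rw [hcomp_comp_hcomp]
      exact hcomp_congr (hunit j) (hcounit j) _
    rw [← comp_assoc, ← leftUnitor_inv_comp_idCell_hcomp (κ j) (hl j), comp_assoc,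
      ← comp_assoc (hcomp _ _ _), interchange, hcomp_idCell_comp_rightUnitor (κ j) (hr j),
      ← unitors_equal, ofHom_inv_hom_comp, comp_ofHom_id]
  exact ⟨P, ⟨unit, counit, left_unit, right_unit, left_counit, right_counit, unit_counit,
    unit_hcomp_counit⟩, κ, hl, hκ, hcounit⟩

theorem cell_hcomp_leftReduce (c : CoproductCompanion s f) (j : J) {z w : B} {m : x j ⟶ z}
    {n : Y ⟶ w} {β : Cell m n} (hβ : left β = s j ≫ f) :
    hcomp (c.cell j) β ((c.right_cell j).trans hβ.symm) ≫ᶜ c.companion.leftReduce n =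
      ofHom (λ_ m).hom ≫ᶜ β := by
  rw [Companion.leftReduce, ← comp_assoc, hcomp_comp_hcomp _ _ _ _ _ (by simp),
    hcomp_congr (c.cell_counit j) (comp_ofHom_id β), idCell_hcomp_comp_leftUnitor β hβ]

theorem hcomp_cell_rightReduce (d : CoproductCompanion s f) (j : J) {w z z' : B} {m : w ⟶ x j}
    {M : z ⟶ X} {N : z' ⟶ Y} {μ : Cell m M} (hμ : right μ = s j) {α : Cell M N}
    (hα : right α = f) :
    hcomp μ (d.cell j) (hμ.trans (d.left_cell j).symm) ≫ᶜ d.companion.rightReduce α hα =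
      ofHom (ρ_ m).hom ≫ᶜ μ ≫ᶜ α := by
  rw [Companion.rightReduce, ← comp_assoc, hcomp_comp_hcomp _ _ _ _ _ (by simp [hα]),
    hcomp_congr rfl (d.cell_counit j), hcomp_idCell_comp_rightUnitor _ (by simp [hμ, hα])]

variable {x' : J → B} {X' Y' : B} {s' : ∀ j, ob (x' j) ⟶ ob X'} {g : ob X' ⟶ ob Y'}

theorem isIso_slide (c : CoproductCompanion s f) (d : CoproductCompanion s' g)
    {m : ∀ j, x j ⟶ x' j} {M : X ⟶ X'} {N : Y ⟶ Y'} {μ : ∀ j, Cell (m j) M} {α : Cell M N}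
    (hμl : ∀ j, left (μ j) = s j) (hμr : ∀ j, right (μ j) = s' j) (hl : left α = f)
    (hr : right α = g)
    (h : IsCoproductCell fun j => hcomp (μ j) (d.cell j) ((hμr j).trans (d.left_cell j).symm))
    (h' : IsCoproductCell fun j => hcomp (c.cell j) (μ j ≫ᶜ α)
      (by rw [c.right_cell, left_comp, hμl, hl])) :
    IsIso (c.companion.slide d.companion α hl hr) := by
  refine (h.iso_comp fun j => (ρ_ (m j)).symm).isIso (h'.iso_comp fun j => (λ_ (m j)).symm)
    fun j => c.companion.cell_ext (by simp [hμl, c.left_cell]) ?_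
  simp only [Iso.symm_hom, comp_assoc]
  rw [c.companion.slide_leftReduce, d.hcomp_cell_rightReduce j (hμr j) hr,
    c.cell_hcomp_leftReduce j (by simp [hμl, hl]), ofHom_inv_hom_comp, ofHom_inv_hom_comp]

end CoproductCompanion

end DoubleStructure

namespace DoubleStructure

variable {B : Type u} [Bicategory.{w, v} B] {T : Type u₂} [Category.{v₂} T]
  [DoubleStructure.{t} B T]

variable (B) in
/-- Finite coproducts of objects and of 1-cells indexed by spans `I ← A → J`, which are compatible
with identities and with composition when one of the spans is the graph of a function. This is the
self-dual part of strong finite coproducts from which companions are built; in the horizontal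
opposite it yields conjoints. -/
structure SpanCoproducts where
  /-- The arrows `s` exhibit `X` as one of the coproducts of objects under consideration. -/
  IsSum {I : Type} [Finite I] (x : I → B) (X : B) (s : ∀ i, ob (x i) ⟶ ob X) : Prop
  isCoproductCell_idCell {I : Type} [Finite I] {x : I → B} {X : B} {s : ∀ i, ob (x i) ⟶ ob X}
    (hs : IsSum x X s) : IsCoproductCell fun i => idCell (s i)
  exists_isCoproductCell {I J A : Type} [Finite I] [Finite J] [Finite A] {x : I → B} {y : J → B}
    {X Y : B} {s : ∀ i, ob (x i) ⟶ ob X} {r : ∀ j, ob (y j) ⟶ ob Y} (hs : IsSum x X s)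
    (hr : IsSum y Y r) (φ : A → I) (ψ : A → J) (m : ∀ a, x (φ a) ⟶ y (ψ a)) :
    ∃ (P : X ⟶ Y) (κ : ∀ a, Cell (m a) P),
      (∀ a, left (κ a) = s (φ a)) ∧ (∀ a, right (κ a) = r (ψ a)) ∧ IsCoproductCell κ
  isCoproductCell_hcomp_graph {I J K A : Type} [Finite I] [Finite J] [Finite K] [Finite A]
    {x : I → B} {y : J → B} {z : K → B} {X Y Z : B} {s : ∀ i, ob (x i) ⟶ ob X}
    {r : ∀ j, ob (y j) ⟶ ob Y} {t : ∀ k, ob (z k) ⟶ ob Z} (hs : IsSum x X s) (hr : IsSum y Y r)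
    (ht : IsSum z Z t) {φ : A → I} {ψ : A → J} {χ : J → K} {m : ∀ a, x (φ a) ⟶ y (ψ a)}
    {n : ∀ j, y j ⟶ z (χ j)} {P : X ⟶ Y} {Q : Y ⟶ Z} {κ : ∀ a, Cell (m a) P}
    {ν : ∀ j, Cell (n j) Q} (hκ : IsCoproductCell κ) (hν : IsCoproductCell ν)
    (hκl : ∀ a, left (κ a) = s (φ a)) (hκr : ∀ a, right (κ a) = r (ψ a))
    (hνl : ∀ j, left (ν j) = r j) (hνr : ∀ j, right (ν j) = t (χ j)) :
    IsCoproductCell fun a => hcomp (κ a) (ν (ψ a)) ((hκr a).trans (hνl _).symm)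
  isCoproductCell_cograph_hcomp {I J K A : Type} [Finite I] [Finite J] [Finite K] [Finite A]
    {x : I → B} {y : J → B} {z : K → B} {X Y Z : B} {s : ∀ i, ob (x i) ⟶ ob X}
    {r : ∀ j, ob (y j) ⟶ ob Y} {t : ∀ k, ob (z k) ⟶ ob Z} (hs : IsSum x X s) (hr : IsSum y Y r)
    (ht : IsSum z Z t) {φ : J → I} {ψ : A → J} {χ : A → K} {m : ∀ j, x (φ j) ⟶ y j}
    {n : ∀ a, y (ψ a) ⟶ z (χ a)} {P : X ⟶ Y} {Q : Y ⟶ Z} {κ : ∀ j, Cell (m j) P}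
    {ν : ∀ a, Cell (n a) Q} (hκ : IsCoproductCell κ) (hν : IsCoproductCell ν)
    (hκl : ∀ j, left (κ j) = s (φ j)) (hκr : ∀ j, right (κ j) = r j)
    (hνl : ∀ a, left (ν a) = r (ψ a)) (hνr : ∀ a, right (ν a) = t (χ a)) :
    IsCoproductCell fun a => hcomp (κ (ψ a)) (ν a) ((hκr _).trans (hνl a).symm)

namespace SpanCoproducts

/-- The span-indexed coproducts of the horizontal opposite, in which spans are reversed. -/
def opposite (G : SpanCoproducts B) : SpanCoproducts Bᵒᵖ where
  IsSum x X s := G.IsSum (fun i => (x i).unop) X.unop s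
  isCoproductCell_idCell hs := (G.isCoproductCell_idCell hs).op
  exists_isCoproductCell hs hr φ ψ m := by
    obtain ⟨P, κ, hl, hr, hκ⟩ := G.exists_isCoproductCell hr hs ψ φ fun a => (m a).unop
    exact ⟨P.op, κ, hr, hl, hκ.op⟩
  isCoproductCell_hcomp_graph hs hr ht _ _ _ _ _ _ _ _ _ hκ hν hκl hκr hνl hνr :=
    (G.isCoproductCell_cograph_hcomp ht hr hs hν.unop hκ.unop hνr hνl hκr hκl).op
  isCoproductCell_cograph_hcomp hs hr ht _ _ _ _ _ _ _ _ _ hκ hν hκl hκr hνl hνr :=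
    (G.isCoproductCell_hcomp_graph ht hr hs hν.unop hκ.unop hνr hνl hκr hκl).op

variable (G : SpanCoproducts B) {I J : Type} [Finite I] [Finite J] {φ : J → I} {y y' : I → B}
  {X X' Y Y' : B} {s : ∀ j, ob (y (φ j)) ⟶ ob X} {r : ∀ i, ob (y i) ⟶ ob Y}
  {s' : ∀ j, ob (y' (φ j)) ⟶ ob X'} {r' : ∀ i, ob (y' i) ⟶ ob Y'} {f : ob X ⟶ ob Y}
  {g : ob X' ⟶ ob Y'}

include G in
theorem nonempty_coproductCompanion (hs : G.IsSum (fun j => y (φ j)) X s) (hr : G.IsSum y Y r)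
    (hf : ∀ j, s j ≫ f = r (φ j)) : Nonempty (CoproductCompanion s f) := by
  obtain ⟨P, κ, hκl, hκr, hκ⟩ := G.exists_isCoproductCell hs hr id φ fun j => 𝟙 (y (φ j))
  exact CoproductCompanion.nonempty_of_isCoproductCell (G.isCoproductCell_idCell hs) hκ hκl
    fun j => (hκr j).trans (hf j).symm

include G in
theorem isIso_slide (hs : G.IsSum (fun j => y (φ j)) X s) (hr : G.IsSum y Y r)
    (hs' : G.IsSum (fun j => y' (φ j)) X' s') (hr' : G.IsSum y' Y' r')
    (hf : ∀ j, s j ≫ f = r (φ j)) (hg : ∀ j, s' j ≫ g = r' (φ j)) (c : CoproductCompanion s f)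
    (d : CoproductCompanion s' g) {m : ∀ i, y i ⟶ y' i} {M : X ⟶ X'} {N : Y ⟶ Y'}
    {μ : ∀ j, Cell (m (φ j)) M} {ν : ∀ i, Cell (m i) N} (hμ : IsCoproductCell μ)
    (hν : IsCoproductCell ν) (hμl : ∀ j, left (μ j) = s j) (hμr : ∀ j, right (μ j) = s' j)
    (hνl : ∀ i, left (ν i) = r i) (hνr : ∀ i, right (ν i) = r' i) {α : Cell M N}
    {hαl : left α = f} {hαr : right α = g} (hα : ∀ j, μ j ≫ᶜ α = ν (φ j)) :
    IsIso (c.companion.slide d.companion α hαl hαr) := by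
  refine c.isIso_slide d hμl hμr hαl hαr ?_ ?_
  · exact G.isCoproductCell_hcomp_graph (φ := id) (ψ := id) hs hs' hr' hμ d.isCoproductCell hμl hμr
      d.left_cell fun j => (d.right_cell j).trans (hg j)
  · simp only [hα]
    exact G.isCoproductCell_hcomp_graph (φ := id) (χ := id) hs hr hr' c.isCoproductCell hν
      c.left_cell (fun j => (c.right_cell j).trans (hf j)) hνl hνr

end SpanCoproducts

end DoubleStructure

namespace DoubleStructure

open _root_.Opposite _root_.Bicategory.Opposite

variable {B : Type u} [Bicategory.{w, v} B] {T : Type u₂} [Category.{v₂} T]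
  [DoubleStructure.{t} B T] {I : Type}

namespace Companion

/-- The companion of a family of arrows formed by companions of its members. -/
def pi {x y : I → B} {f : ob x ⟶ ob y} {p : x ⟶ y} (c : ∀ i, Companion (f i) (p i)) :
    Companion f p where
  unit i := (c i).unit
  counit i := (c i).counit
  left_unit := funext fun i => (c i).left_unit
  right_unit := funext fun i => (c i).right_unit
  left_counit := funext fun i => (c i).left_counit
  right_counit := funext fun i => (c i).right_counit
  unit_counit := funext fun i => (c i).unit_counit
  unit_hcomp_counit := funext fun i => (c i).unit_hcomp_counit

theorem isIso_pi_slide {x y x' y' : I → B} {f : ob x ⟶ ob x'} {g : ob y ⟶ ob y'} {p : x ⟶ x'}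
    {q : y ⟶ y'} (c : ∀ i, Companion (f i) (p i)) (d : ∀ i, Companion (g i) (q i)) {m : x ⟶ y}
    {n : x' ⟶ y'} (α : Cell m n) (hl : left α = f) (hr : right α = g)
    (h : ∀ i, IsIso ((c i).slide (d i) (α i) (congrFun hl i) (congrFun hr i))) :
    IsIso ((pi c).slide (pi d) α hl hr) :=
  (isIso_pi_iff _).mpr h

/-- The companion of a family of arrows formed by companions of its members, in the horizontal
opposite. -/
def piOpposite {x y : (I → B)ᵒᵖ} {f : ob x ⟶ ob y} {p : ∀ i, op (x.unop i) ⟶ op (y.unop i)}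
    (c : ∀ i, Companion (B := Bᵒᵖ) (f i) (p i)) :
    Companion f (Quiver.Hom.op fun i => (p i).unop) where
  unit i := (c i).unit
  counit i := (c i).counit
  left_unit := funext fun i => (c i).left_unit
  right_unit := funext fun i => (c i).right_unit
  left_counit := funext fun i => (c i).left_counit
  right_counit := funext fun i => (c i).right_counit
  unit_counit := funext fun i => (c i).unit_counit
  unit_hcomp_counit := funext fun i => (c i).unit_hcomp_counit

theorem isIso_piOpposite_slide {x y x' y' : (I → B)ᵒᵖ} {f : ob x ⟶ ob x'} {g : ob y ⟶ ob y'}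
    {p : ∀ i, op (x.unop i) ⟶ op (x'.unop i)} {q : ∀ i, op (y.unop i) ⟶ op (y'.unop i)}
    (c : ∀ i, Companion (B := Bᵒᵖ) (f i) (p i))
    (d : ∀ i, Companion (B := Bᵒᵖ) (g i) (q i)) {m : x ⟶ y} {n : x' ⟶ y'} (α : Cell m n)
    (hl : left α = f) (hr : right α = g)
    (h : ∀ i, IsIso ((c i).slide (d i) (m := (m.unop i).op) (n := (n.unop i).op) (α i)
      (congrFun hl i) (congrFun hr i))) :
    IsIso ((piOpposite c).slide (piOpposite d) α hl hr) := by
  have components : IsIso ((piOpposite c).slide (piOpposite d) α hl hr).unop2 :=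
    (isIso_pi_iff _).mpr fun i =>
      have := h i
      inferInstanceAs (IsIso ((unopFunctor _ _).map ((c i).slide (d i) _ _ _)))
  exact inferInstanceAs (IsIso ((opFunctor _ _).map
    ((piOpposite c).slide (piOpposite d) α hl hr).unop2))

end Companion

end DoubleStructure

namespace DoubleCategory

open DoubleStructure

variable {D : Type u} [DoubleCategory.{t, w, v} D]

/-- The fibres of the span `I ← A → J`. -/
abbrev SpanFibre {I J A : Type} (φ : A → I) (ψ : A → J) (i : I) (j : J) : Type :=
  {a : A // φ a = i ∧ ψ a = j}

section SpanFamily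

variable {I J K A : Type}

theorem bijective_spanFibre (φ : A → I) (ψ : A → J) :
    (fun a => (⟨φ a, ψ a, a, rfl, rfl⟩ : Σ i j, SpanFibre φ ψ i j)).Bijective :=
  Function.bijective_iff_has_inverse.mpr ⟨fun a => a.2.2.1, fun _ => rfl,
    fun ⟨_, _, _, rfl, rfl⟩ => rfl⟩

theorem bijective_spanFibre_graph (φ : A → I) (ψ : A → J) (χ : J → K) :
    (fun a => (⟨φ a, χ (ψ a), ψ a, ⟨a, rfl, rfl⟩, ⟨ψ a, rfl, rfl⟩⟩ :
      Σ i k, Σ j, SpanFibre φ ψ i j × SpanFibre id χ j k)).Bijective :=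
  Function.bijective_iff_has_inverse.mpr ⟨fun a => a.2.2.2.1.1, fun _ => rfl,
    fun ⟨_, _, _, ⟨_, rfl, rfl⟩, ⟨_, rfl, rfl⟩⟩ => rfl⟩

theorem bijective_cograph_spanFibre (φ : J → I) (ψ : A → J) (χ : A → K) :
    (fun a => (⟨φ (ψ a), χ a, ψ a, ⟨ψ a, rfl, rfl⟩, ⟨a, rfl, rfl⟩⟩ :
      Σ i k, Σ j, SpanFibre φ id i j × SpanFibre ψ χ j k)).Bijective :=
  Function.bijective_iff_has_inverse.mpr ⟨fun a => a.2.2.2.2.1, fun _ => rfl,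
    fun ⟨_, _, _, ⟨_, rfl, rfl⟩, ⟨_, rfl, rfl⟩⟩ => rfl⟩

variable {x : I → Loose D} {y : J → Loose D}

/-- A family of proarrows indexed by the apex of a span, as a family indexed by its fibres. -/
def spanFamily (φ : A → I) (ψ : A → J) (m : ∀ a, x (φ a) ⟶ y (ψ a)) :
    ∀ i j, SpanFibre φ ψ i j → Pro (x i).obj (y j).obj
  | _, _, ⟨a, rfl, rfl⟩ => m a

theorem IsSpanCoproduct.isCoproductCell {F : I → J → Type}
    {m : ∀ i j, F i j → Pro (x i).obj (y j).obj} {X Y : Loose D} {s : ∀ i, (x i).obj ⟶ X.obj}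
    {r : ∀ j, (y j).obj ⟶ Y.obj} {P : Pro X.obj Y.obj}
    {κ : ∀ i j (a : F i j), DoubleCategory.Cell (m i j a) P} (h : IsSpanCoproduct m s r P κ) :
    IsCoproductCell (B := Loose D) (A := Σ i j, F i j) (m := fun a => m a.1 a.2.1 a.2.2) (P := P)
      fun a => κ a.1 a.2.1 a.2.2 := by
  intro z w n f g φ hl hr
  obtain ⟨ψ, ⟨hψl, hψr, hψ⟩, unique⟩ := h.existsUnique n f g (fun i j a => φ ⟨i, j, a⟩)
    (fun i j a => (hl ⟨i, j, a⟩).trans (congrArg (· ≫ f) (h.left_eq i j a)))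
    (fun i j a => (hr ⟨i, j, a⟩).trans (congrArg (· ≫ g) (h.right_eq i j a)))
  exact ⟨ψ, ⟨hψl, hψr, fun a => hψ a.1 a.2.1 a.2.2⟩,
    fun ψ' ⟨hl', hr', hψ'⟩ => unique ψ' ⟨hl', hr', fun i j a => hψ' ⟨i, j, a⟩⟩⟩

end SpanFamily

namespace StrongFiniteCoproducts

variable (S : StrongFiniteCoproducts D)

/-- The chosen coproduct of a family of objects of the underlying bicategory. -/
abbrev sumObj {I : Type} [Finite I] (x : I → Loose D) : Loose D :=
  ⟨S.sum fun i => (x i).obj⟩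

/-- The arrows `s` are the coprojections of a chosen coproduct `X`. By normalization this includes
the identity arrow of a single object. -/
inductive IsSum {I : Type} [Finite I] (x : I → Loose D) :
    ∀ X : Loose D, (∀ i, ob (x i) ⟶ ob X) → Prop
  | chosen : IsSum x (S.sumObj x) (S.inj fun i => (x i).obj)

theorem isSum_single (x : Loose D) : S.IsSum (fun _ : PUnit.{1} => x) x fun _ => 𝟙 (ob x) := by
  have h (c : Cofan fun _ : PUnit.{1} => x.obj) (hc : S.cofan _ = c) :
      S.IsSum (fun _ => x) ⟨c.pt⟩ c.inj := by
    subst hc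
    exact .chosen
  exact h _ (S.cofan_single x.obj)

variable {I J K A : Type} [Finite I] [Finite J] [Finite K] [Finite A]

theorem isCoproductCell_inclPro {x y : I → Loose D} (m : ∀ i, x i ⟶ y i) :
    IsCoproductCell (B := Loose D) (X := S.sumObj x) (Y := S.sumObj y) (P := S.sumPro m)
      (m := m) (S.inclPro m) := by
  intro z w n f g φ hl hr
  exact existsUnique_of_isSpanCoproduct (S.isSpanCoproduct_sumPro m) n f g φ
    (fun i => (hl i).trans (congrArg (· ≫ f) (S.left_inclPro m i)))
    fun i => (hr i).trans (congrArg (· ≫ g) (S.right_inclPro m i))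

variable {x : I → Loose D} {y : J → Loose D} {z : K → Loose D}

/-- The coproduct of a family of proarrows indexed by the apex of a span. -/
def spanPro (φ : A → I) (ψ : A → J) (m : ∀ a, x (φ a) ⟶ y (ψ a)) : S.sumObj x ⟶ S.sumObj y :=
  S.pro (spanFamily φ ψ m)

/-- The coprojections of `spanPro`. -/
def spanIncl (φ : A → I) (ψ : A → J) (m : ∀ a, x (φ a) ⟶ y (ψ a)) (a : A) :
    DoubleStructure.Cell (m a) (S.spanPro φ ψ m) :=
  S.incl (spanFamily φ ψ m) (φ a) (ψ a) ⟨a, rfl, rfl⟩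

theorem left_spanIncl (φ : A → I) (ψ : A → J) (m : ∀ a, x (φ a) ⟶ y (ψ a)) (a : A) :
    DoubleStructure.left (S.spanIncl φ ψ m a) = S.inj (fun i => (x i).obj) (φ a) :=
  (S.isSpanCoproduct (spanFamily φ ψ m)).left_eq (φ a) (ψ a) ⟨a, rfl, rfl⟩

theorem right_spanIncl (φ : A → I) (ψ : A → J) (m : ∀ a, x (φ a) ⟶ y (ψ a)) (a : A) :
    DoubleStructure.right (S.spanIncl φ ψ m a) = S.inj (fun j => (y j).obj) (ψ a) :=
  (S.isSpanCoproduct (spanFamily φ ψ m)).right_eq (φ a) (ψ a) ⟨a, rfl, rfl⟩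

theorem isCoproductCell_spanIncl (φ : A → I) (ψ : A → J) (m : ∀ a, x (φ a) ⟶ y (ψ a)) :
    IsCoproductCell (S.spanIncl φ ψ m) :=
  (S.isSpanCoproduct (spanFamily φ ψ m)).isCoproductCell.reindex (bijective_spanFibre φ ψ)

theorem isCoproductCell_spanIncl_graph (φ : A → I) (ψ : A → J) (χ : J → K)
    (m : ∀ a, x (φ a) ⟶ y (ψ a)) (n : ∀ j, y j ⟶ z (χ j)) :
    IsCoproductCell fun a => DoubleStructure.hcomp (S.spanIncl φ ψ m a) (S.spanIncl id χ n (ψ a))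
      ((S.right_spanIncl φ ψ m a).trans (S.left_spanIncl id χ n _).symm) :=
  (S.isSpanCoproduct_comp (spanFamily φ ψ m) (spanFamily id χ n)).isCoproductCell.reindex
    (bijective_spanFibre_graph φ ψ χ)

theorem isCoproductCell_cograph_spanIncl (φ : J → I) (ψ : A → J) (χ : A → K)
    (m : ∀ j, x (φ j) ⟶ y j) (n : ∀ a, y (ψ a) ⟶ z (χ a)) :
    IsCoproductCell fun a => DoubleStructure.hcomp (S.spanIncl φ id m (ψ a)) (S.spanIncl ψ χ n a)
      ((S.right_spanIncl φ id m _).trans (S.left_spanIncl ψ χ n a).symm) :=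
  (S.isSpanCoproduct_comp (spanFamily φ id m) (spanFamily ψ χ n)).isCoproductCell.reindex
    (bijective_cograph_spanFibre φ ψ χ)

variable {S}

theorem IsSum.isCoproductCell_idCell {X : Loose D} {s : ∀ i, ob (x i) ⟶ ob X}
    (hs : S.IsSum x X s) : IsCoproductCell fun i => DoubleStructure.idCell (s i) := by
  cases hs
  intro z w n f g φ hl hr
  exact existsUnique_of_isSpanCoproduct (S.isSpanCoproduct_id fun i => (x i).obj) n f g φ
    (fun i => (hl i).trans (congrArg (· ≫ f) (DoubleCategory.left_idCell _)))
    fun i => (hr i).trans (congrArg (· ≫ g) (DoubleCategory.right_idCell _))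

theorem exists_iso_spanPro {φ : A → I} {ψ : A → J} {m : ∀ a, x (φ a) ⟶ y (ψ a)}
    {P : S.sumObj x ⟶ S.sumObj y} {κ : ∀ a, DoubleStructure.Cell (m a) P} (hκ : IsCoproductCell κ)
    (hκl : ∀ a, DoubleStructure.left (κ a) = S.inj (fun i => (x i).obj) (φ a))
    (hκr : ∀ a, DoubleStructure.right (κ a) = S.inj (fun j => (y j).obj) (ψ a)) :
    ∃ e : S.spanPro φ ψ m ≅ P, ∀ a, S.spanIncl φ ψ m a ≫ᶜ ofHom e.hom = κ a :=
  (S.isCoproductCell_spanIncl φ ψ m).exists_iso hκ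
    (fun a => (S.left_spanIncl φ ψ m a).trans (hκl a).symm)
    fun a => (S.right_spanIncl φ ψ m a).trans (hκr a).symm

variable (S) in
/-- The coproducts of a double category with strong finite coproducts. -/
def spanCoproducts : SpanCoproducts (Loose D) where
  IsSum x X s := S.IsSum x X s
  isCoproductCell_idCell hs := hs.isCoproductCell_idCell
  exists_isCoproductCell hs hr φ ψ m := by
    cases hs
    cases hr
    exact ⟨_, _, S.left_spanIncl φ ψ m, S.right_spanIncl φ ψ m, S.isCoproductCell_spanIncl φ ψ m⟩
  isCoproductCell_hcomp_graph hs hr ht φ ψ χ m n _ _ _ _ hκ hν hκl hκr hνl hνr := by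
    cases hs
    cases hr
    cases ht
    obtain ⟨e, he⟩ := exists_iso_spanPro hκ hκl hκr
    obtain ⟨d, hd⟩ := exists_iso_spanPro (φ := id) hν hνl hνr
    exact (S.isCoproductCell_spanIncl_graph φ ψ χ m n).hcomp_iso e he d (fun _ => hd _) _
  isCoproductCell_cograph_hcomp hs hr ht φ ψ χ m n _ _ _ _ hκ hν hκl hκr hνl hνr := by
    cases hs
    cases hr
    cases ht
    obtain ⟨e, he⟩ := exists_iso_spanPro (ψ := id) hκ hκl hκr
    obtain ⟨d, hd⟩ := exists_iso_spanPro hν hνl hνr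
    exact (S.isCoproductCell_cograph_spanIncl φ ψ χ m n).hcomp_iso e (fun _ => he _) d hd _

end StrongFiniteCoproducts

end DoubleCategory

namespace DoubleCategory.StrongFiniteCoproducts

open DoubleStructure _root_.Opposite

variable {D : Type u} [DoubleCategory.{t, w, v} D] (S : StrongFiniteCoproducts D) {I : Type}
  [Finite I]

/-- A companion of a coprojection. -/
noncomputable def injCompanion (x : I → Loose D) (i : I) :
    CoproductCompanion (B := Loose D) (X := x i) (Y := S.sumObj x)
      (fun _ : PUnit.{1} => 𝟙 (ob (x i))) (S.inj (fun i => (x i).obj) i) :=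
  Classical.choice <| S.spanCoproducts.nonempty_coproductCompanion (φ := fun _ => i)
    (S.isSum_single (x i)) (IsSum.chosen (x := x)) fun _ => Category.id_comp _

variable (I) in
/-- A companion of a codiagonal. -/
noncomputable def codiagCompanion (z : Loose D) :
    CoproductCompanion (B := Loose D) (X := S.sumObj fun _ : I => z) (Y := z)
      (S.inj fun _ : I => z.obj) (S.codiag I z.obj) :=
  Classical.choice <| S.spanCoproducts.nonempty_coproductCompanion (y := fun _ => z)
    (φ := fun _ => PUnit.unit)
    (IsSum.chosen (x := fun _ : I => z)) (S.isSum_single z) (S.inj_codiag z.obj)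

/-- A conjoint of a coprojection. -/
noncomputable def injConjoint (x : I → Loose D) (i : I) :
    CoproductCompanion (B := (Loose D)ᵒᵖ) (X := op (x i)) (Y := op (S.sumObj x))
      (fun _ : PUnit.{1} => 𝟙 (ob (x i))) (S.inj (fun i => (x i).obj) i) :=
  Classical.choice <| S.spanCoproducts.opposite.nonempty_coproductCompanion
    (y := fun i => op (x i)) (φ := fun _ => i)
    (S.isSum_single (x i)) (IsSum.chosen (x := x)) fun _ => Category.id_comp _

variable (I) in
/-- A conjoint of a codiagonal. -/
noncomputable def codiagConjoint (z : Loose D) :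
    CoproductCompanion (B := (Loose D)ᵒᵖ) (X := op (S.sumObj fun _ : I => z)) (Y := op z)
      (S.inj fun _ : I => z.obj) (S.codiag I z.obj) :=
  Classical.choice <| S.spanCoproducts.opposite.nonempty_coproductCompanion
    (y := fun _ => op z) (φ := fun _ => PUnit.unit)
    (IsSum.chosen (x := fun _ : I => z)) (S.isSum_single z) (S.inj_codiag z.obj)

variable (I)

/-- Companions of the coprojections. -/
noncomputable def injCompanions : (S.directSumDiagonal I).unit.Companions where
  obj x i := (S.injCompanion x i).obj
  companion x := Companion.pi fun i => (S.injCompanion x i).companion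
  isIso_slide {x y} m := Companion.isIso_pi_slide _ _ _ _ _ fun i =>
    S.spanCoproducts.isIso_slide (φ := fun _ => i) (y := x) (y' := y) (S.isSum_single (x i))
      (IsSum.chosen (x := x)) (S.isSum_single (y i)) (IsSum.chosen (x := y))
      (fun _ => Category.id_comp _) (fun _ => Category.id_comp _)
      (S.injCompanion x i) (S.injCompanion y i)
      (IsCoproductCell.ofHom_id (m i)) (S.isCoproductCell_inclPro m) (fun _ => left_ofHom _)
      (fun _ => right_ofHom _) (S.left_inclPro m) (S.right_inclPro m) fun _ => ofHom_id_comp _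

/-- Companions of the codiagonals. -/
noncomputable def codiagCompanions : (S.directSumDiagonal I).counit.Companions where
  obj z := (S.codiagCompanion I z).obj
  companion z := (S.codiagCompanion I z).companion
  isIso_slide {z z'} n :=
    S.spanCoproducts.isIso_slide (φ := fun _ => PUnit.unit) (y := fun _ => z) (y' := fun _ => z')
      (IsSum.chosen (x := fun _ : I => z)) (S.isSum_single z) (IsSum.chosen (x := fun _ : I => z'))
      (S.isSum_single z') (S.inj_codiag z.obj) (S.inj_codiag z'.obj) (S.codiagCompanion I z)
      (S.codiagCompanion I z') (S.isCoproductCell_inclPro fun _ => n) (IsCoproductCell.ofHom_id n)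
      (S.left_inclPro _) (S.right_inclPro _) (fun _ => left_ofHom _) (fun _ => right_ofHom _)
      (S.inclPro_codiagPro n)

/-- Conjoints of the coprojections. -/
noncomputable def injConjoints : (S.directSumDiagonal I).opposite.unit.Companions where
  obj x := Quiver.Hom.op fun i => (S.injConjoint x.unop i).obj.unop
  companion x := Companion.piOpposite fun i => (S.injConjoint x.unop i).companion
  isIso_slide {x y} m := Companion.isIso_piOpposite_slide _ _ _ _ _ fun i =>
    S.spanCoproducts.opposite.isIso_slide (φ := fun _ => i) (y := fun i => op (x.unop i))
      (y' := fun i => op (y.unop i)) (S.isSum_single (x.unop i)) (IsSum.chosen (x := x.unop))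
      (S.isSum_single (y.unop i)) (IsSum.chosen (x := y.unop)) (fun _ => Category.id_comp _)
      (fun _ => Category.id_comp _) (S.injConjoint x.unop i) (S.injConjoint y.unop i)
      (IsCoproductCell.ofHom_id (B := Loose D) (m.unop i)).op
      (S.isCoproductCell_inclPro m.unop).op (fun _ => right_ofHom _) (fun _ => left_ofHom _)
      (S.right_inclPro m.unop) (S.left_inclPro m.unop) fun _ => ofHom_id_comp _

/-- Conjoints of the codiagonals. -/
noncomputable def codiagConjoints : (S.directSumDiagonal I).opposite.counit.Companions where
  obj z := (S.codiagConjoint I z.unop).obj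
  companion z := (S.codiagConjoint I z.unop).companion
  isIso_slide {z z'} n :=
    S.spanCoproducts.opposite.isIso_slide (φ := fun _ => PUnit.unit) (y := fun _ => z)
      (y' := fun _ => z') (IsSum.chosen (x := fun _ : I => z.unop)) (S.isSum_single z.unop)
      (IsSum.chosen (x := fun _ : I => z'.unop)) (S.isSum_single z'.unop) (S.inj_codiag z.unop.obj)
      (S.inj_codiag z'.unop.obj) (S.codiagConjoint I z.unop) (S.codiagConjoint I z'.unop)
      (S.isCoproductCell_inclPro fun _ => n.unop).op (IsCoproductCell.ofHom_id n.unop).op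
      (S.right_inclPro _) (S.left_inclPro _) (fun _ => right_ofHom _) (fun _ => left_ofHom _)
      (S.inclPro_codiagPro n.unop)

end DoubleCategory.StrongFiniteCoproducts

namespace Biadjunction

variable {B : Type u} [Bicategory.{w, v} B] {C : Type u₂} [Bicategory.{w₂, v₂} C]
  {F : Pseudofunctor B C} {G : Pseudofunctor C B} {b : B} {c : C}

variable (F G) in
/-- Transposition along a 1-cell `η : b ⟶ G (F b)`, in the role of the unit of a biadjunction. -/
def transpose (η : b ⟶ G.obj (F.obj b)) (c : C) : (F.obj b ⟶ c) ⥤ (b ⟶ G.obj c) where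
  obj f := η ≫ G.map f
  map θ := η ◁ G.map₂ θ
  map_id f := by rw [G.map₂_id, whiskerLeft_id]
  map_comp θ τ := by rw [G.map₂_comp, whiskerLeft_comp]

variable (F G) in
/-- Transposition along a 1-cell `ζ : F (G c) ⟶ c`, in the role of the counit of a biadjunction. -/
def cotranspose (ζ : F.obj (G.obj c) ⟶ c) (b : B) : (b ⟶ G.obj c) ⥤ (F.obj b ⟶ c) where
  obj f := F.map f ≫ ζ
  map θ := F.map₂ θ ▷ ζ
  map_id f := by rw [F.map₂_id, id_whiskerRight]
  map_comp θ τ := by rw [F.map₂_comp, comp_whiskerRight]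

variable {η : b ⟶ G.obj (F.obj b)} {ζ : F.obj (G.obj c) ⟶ c}

/-- Transposing along `η` and then along `ζ`, when `ζ` is natural and satisfies a triangle identity
with `η` up to isomorphism. -/
def transposeCompCotranspose {ζ' : F.obj (G.obj (F.obj b)) ⟶ F.obj b}
    (naturality : ∀ f : F.obj b ⟶ c, F.map (G.map f) ≫ ζ ≅ ζ' ≫ f)
    (naturality_naturality : ∀ {f g : F.obj b ⟶ c} (θ : f ⟶ g),
      F.map₂ (G.map₂ θ) ▷ ζ ≫ (naturality g).hom = (naturality f).hom ≫ ζ' ◁ θ)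
    (triangulator : 𝟙 (F.obj b) ≅ F.map η ≫ ζ') :
    transpose F G η c ⋙ cotranspose F G ζ b ≅ 𝟭 (F.obj b ⟶ c) :=
  NatIso.ofComponents
    (fun f => whiskerRightIso (F.mapComp η (G.map f)) ζ ≪≫ α_ _ _ _ ≪≫
      whiskerLeftIso (F.map η) (naturality f) ≪≫ (α_ _ _ _).symm ≪≫
      whiskerRightIso triangulator.symm f ≪≫ λ_ f)
    (fun {f g} θ => by
      simp only [transpose, cotranspose, Functor.comp_obj, Functor.comp_map, Functor.id_obj,
        Functor.id_map, Iso.trans_hom, Iso.symm_hom, whiskerRightIso_hom, whiskerLeftIso_hom,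
        Pseudofunctor.map₂_whisker_left, comp_whiskerRight, Category.assoc,
        inv_hom_whiskerRight_assoc, associator_naturality_middle_assoc]
      rw [← whiskerLeft_comp_assoc, naturality_naturality, whiskerLeft_comp_assoc,
        associator_inv_naturality_right_assoc, whisker_exchange_assoc, leftUnitor_naturality])

/-- Transposing along `ζ` and then along `η`, when `η` is natural and satisfies a triangle identity
with `ζ` up to isomorphism. -/
def cotransposeCompTranspose {η' : G.obj c ⟶ G.obj (F.obj (G.obj c))}
    (naturality : ∀ f : b ⟶ G.obj c, f ≫ η' ≅ η ≫ G.map (F.map f))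
    (naturality_naturality : ∀ {f g : b ⟶ G.obj c} (θ : f ⟶ g),
      θ ▷ η' ≫ (naturality g).hom = (naturality f).hom ≫ η ◁ G.map₂ (F.map₂ θ))
    (triangulator : η' ≫ G.map ζ ≅ 𝟙 (G.obj c)) :
    cotranspose F G ζ b ⋙ transpose F G η c ≅ 𝟭 (b ⟶ G.obj c) :=
  NatIso.ofComponents
    (fun f => whiskerLeftIso η (G.mapComp (F.map f) ζ) ≪≫ (α_ _ _ _).symm ≪≫
      whiskerRightIso (naturality f).symm (G.map ζ) ≪≫ α_ _ _ _ ≪≫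
      whiskerLeftIso f triangulator ≪≫ ρ_ f)
    (fun {f g} θ => by
      have naturality_inv : η ◁ G.map₂ (F.map₂ θ) ≫ (naturality g).inv =
          (naturality f).inv ≫ θ ▷ η' := by
        rw [Iso.comp_inv_eq, Category.assoc, Iso.eq_inv_comp, naturality_naturality]
      simp only [transpose, cotranspose, Functor.comp_obj, Functor.comp_map, Functor.id_obj,
        Functor.id_map, Iso.trans_hom, Iso.symm_hom, whiskerRightIso_hom, whiskerLeftIso_hom,
        Pseudofunctor.map₂_whisker_right, whiskerLeft_comp, Category.assoc,
        whiskerLeft_inv_hom_assoc, associator_inv_naturality_middle_assoc]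
      rw [← comp_whiskerRight_assoc, naturality_inv, comp_whiskerRight_assoc,
        associator_naturality_left_assoc, ← whisker_exchange_assoc, rightUnitor_naturality])

variable (E : Biadjunction F G)

/-- The equivalence of hom-categories induced by a biadjunction. -/
def homEquivalence (b : B) (c : C) : (F.obj b ⟶ c) ≌ (b ⟶ G.obj c) :=
  CategoryTheory.Equivalence.mk (transpose F G (E.unit.app b) c)
    (cotranspose F G (E.counit.app c) b)
    (transposeCompCotranspose (fun f => E.counit.naturality f)
      (fun θ => E.counit.naturality_naturality θ) (E.triangulatorLeft b)).symm
    (cotransposeCompTranspose (fun f => E.unit.naturality f)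
      (fun θ => E.unit.naturality_naturality θ) (E.triangulatorRight c))

end Biadjunction

namespace DoubleStructure

open _root_.Opposite

variable {D : Type u} [DoubleCategory.{t, w, v} D] {x y : Loose D}

/-- A companion in the underlying bicategory as companion data in the double category. -/
def Companion.companionData {f : x.obj ⟶ y.obj} {p : x ⟶ y} (c : Companion (B := Loose D) f p) :
    DoubleCategory.CompanionData f p where
  unit := c.unit
  counit := c.counit
  left_unit := c.left_unit
  right_unit := c.right_unit
  left_counit := c.left_counit
  right_counit := c.right_counit
  unit_counit := c.unit_counit
  unit_hcomp_counit := c.unit_hcomp_counit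

/-- A companion in the horizontal opposite of the underlying bicategory as conjoint data. -/
def Companion.conjointData {f : x.obj ⟶ y.obj} {p : op x ⟶ op y}
    (c : Companion (B := (Loose D)ᵒᵖ) f p) : DoubleCategory.ConjointData f p.unop where
  unit := c.unit
  counit := c.counit
  left_unit := c.right_unit
  right_unit := c.left_unit
  left_counit := c.right_counit
  right_counit := c.left_counit
  unit_counit := c.unit_counit
  counit_hcomp_unit := c.unit_hcomp_counit

end DoubleStructure

namespace DoubleStructure.Companion

open _root_.Opposite _root_.Bicategory.Opposite

variable {D : Type u} [DoubleCategory.{t, w, v} D] {x y x' y' : Loose D} {f : x.obj ⟶ x'.obj}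
  {g : y.obj ⟶ y'.obj} {m : x ⟶ y} {n : x' ⟶ y'} (α : DoubleCategory.Cell m n)
  (hl : DoubleCategory.left α = f) (hr : DoubleCategory.right α = g)

theorem cell_slide {p : x ⟶ x'} {q : y ⟶ y'} (c : Companion (B := Loose D) f p)
    (d : Companion (B := Loose D) g q) :
    (c.slide d α hl hr).cell =
      DoubleCategory.companionSlide c.companionData d.companionData α hl hr :=
  c.ofHom_slide d α hl hr

theorem cell_unop2_slide {p : op x ⟶ op x'} {q : op y ⟶ op y'}
    (c : Companion (B := (Loose D)ᵒᵖ) f p) (d : Companion (B := (Loose D)ᵒᵖ) g q) :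
    (d.slide c (m := m.op) (n := n.op) α hr hl).unop2.cell =
      DoubleCategory.conjointSlide c.conjointData d.conjointData α hl hr :=
  d.ofHom_slide c α hr hl

end DoubleStructure.Companion

namespace DoubleCategory.StrongFiniteCoproducts

open DoubleStructure

variable {D : Type u} [DoubleCategory.{t, w, v} D] (S : StrongFiniteCoproducts D)

theorem exists_companionBiadjunction (I : Type) [Finite I] :
    ∃ L : Biadjunction (S.directSum I) (diagonal I (Loose D)),
      S.IsCompanionOfInj L.unit ∧ S.IsCompanionOfCodiag L.counit :=
  ⟨(S.directSumDiagonal I).biadjunction (S.injCompanions I) (S.codiagCompanions I),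
    ⟨fun x i => (S.injCompanion x i).companion.companionData,
      fun x y _ i => (S.injCompanion x i).companion.cell_slide _ _ _
        (S.injCompanion y i).companion⟩,
    fun z => (S.codiagCompanion I z).companion.companionData,
    fun z z' _ => (S.codiagCompanion I z).companion.cell_slide _ _ _
      (S.codiagCompanion I z').companion⟩

theorem exists_conjointBiadjunction (I : Type) [Finite I] :
    ∃ R : Biadjunction (diagonal I (Loose D)) (S.directSum I),
      S.IsConjointOfCodiag R.unit ∧ S.IsConjointOfInj R.counit :=
  ⟨unopBiadjunction ((S.directSumDiagonal I).opposite.biadjunction (S.injConjoints I)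
      (S.codiagConjoints I)),
    ⟨fun z => Companion.conjointData (x := S.sumObj fun _ => z) (S.codiagConjoint I z).companion,
      fun z z' _ => Companion.cell_unop2_slide (x := S.sumObj fun _ => z)
        (y := S.sumObj fun _ => z') _ _ _ (S.codiagConjoint I z).companion
        (S.codiagConjoint I z').companion⟩,
    fun x i => Companion.conjointData (x := x i) (S.injConjoint x i).companion,
    fun x y _ i => Companion.cell_unop2_slide (x := x i) (y := y i) _ _ _
      (S.injConjoint x i).companion (S.injConjoint y i).companion⟩

variable {I : Type} [Finite I]

theorem isBicategoricalCoproduct_unit (L : Biadjunction (S.directSum I) (diagonal I (Loose D)))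
    (x : I → Loose D) :
    IsBicategoricalCoproduct (s := (S.directSum I).obj x) fun i => L.unit.app x i :=
  fun z => (L.homEquivalence x z).isEquivalence_functor

theorem isBicategoricalProduct_counit (R : Biadjunction (diagonal I (Loose D)) (S.directSum I))
    (x : I → Loose D) :
    IsBicategoricalProduct (s := (S.directSum I).obj x) fun i => R.counit.app x i :=
  fun z => (R.homEquivalence z x).isEquivalence_inverse

end DoubleCategory.StrongFiniteCoproducts

theorem mainTheorem6 {D : Type u} [DoubleCategory.{t, w, v} D]
    (S : StrongFiniteCoproducts D) :
    HasDirectSums (Loose D) ∧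
    ∀ (I : Type) [Finite I],
      ∃ (L : Biadjunction (S.directSum I) (diagonal I (Loose D)))
        (R : Biadjunction (diagonal I (Loose D)) (S.directSum I)),
        S.IsCompanionOfInj L.unit ∧ S.IsCompanionOfCodiag L.counit ∧
        S.IsConjointOfCodiag R.unit ∧ S.IsConjointOfInj R.counit ∧
        ∀ x : I → Loose D,
          IsBicategoricalCoproduct (s := (S.directSum I).obj x) (fun i => L.unit.app x i) ∧
          IsBicategoricalProduct (s := (S.directSum I).obj x) (fun i => R.counit.app x i) := by
  refine ⟨fun I _ x => ?_, fun I _ => ?_⟩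
  · obtain ⟨L, -⟩ := S.exists_companionBiadjunction I
    obtain ⟨R, -⟩ := S.exists_conjointBiadjunction I
    exact ⟨(S.directSum I).obj x, fun i => L.unit.app x i, fun i => R.counit.app x i,
      S.isBicategoricalCoproduct_unit L x, S.isBicategoricalProduct_counit R x⟩
  · obtain ⟨L, hι, hcod⟩ := S.exists_companionBiadjunction I
    obtain ⟨R, hcod', hι'⟩ := S.exists_conjointBiadjunction I
    exact ⟨L, R, hι, hcod, hcod', hι', fun x =>
      ⟨S.isBicategoricalCoproduct_unit L x, S.isBicategoricalProduct_counit R x⟩⟩
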